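/- Let $p>4$. For $\sigma,s\in\{\pm1\}^{\mathbb Z^2}$, $J\in\mathbb R$ and finite $X\subset\mathbb Z^2$ put $$H_X(\sigma_X|s)=-J\sum_{\substack{\{x,y\}\subset X\\ |x-y|=1}}(\sigma_x\sigma_y-1)+\sum_{\substack{\{x,y\}\subset X\\ x\ne y}}\frac{\sigma_x\sigma_y-1}{|x-y|^p}-J\sum_{\substack{x\in X,\,y\notin X\\ |x-y|=1}}(\sigma_xs_y-1)+\sum_{x\in X,\,y\notin X}\frac{\sigma_xs_y-1}{|x-y|^p},$$ where $|\cdot|$ is the Euclidean norm, and let $J_c=\sum_{y_1>0,\,y_2\in\mathbb Z}y_1\,(y_1^2+y_2^2)^{-p/2}$. For an integer $h\ge1$ let $\sigma^{(h)}_x=\operatorname{sign}(\sin(\pi(x_1+\tfrac12)/h))$ and let $e_s(h)$ be its energy per site, i.e. the average over one period of $\tfrac12\sum_{y\ne x}\big(-J\,\mathbf 1_{|x-y|=1}+|x-y|^{-p}\big)(\sigma^{(h)}_x\sigma^{(h)}_y-1)$. Let $h^*\ge1$ be a minimizer of $e_s$ over the positive integers, and $\sigma^*=\sigma^{(h^*)}$.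 For a configuration $\sigma$ let $\Delta=\{x:\sigma_x=-1\}$ and let $\Gamma(\Delta)$ be the set of bonds of the dual lattice separating a point of $\Delta$ from a point of $\Delta^c$. Either $0$, $2$ or $4$ bonds of $\Gamma(\Delta)$ meet at a dual vertex; the vertex carries one corner if exactly two bonds meet there and they are orthogonal, two corners if four bonds meet there, and no corner otherwise. $N_c$ is the total number of corners. A bond of $\Gamma(\Delta)$ belongs to a set of sites $Q$ if its adjacent point of $\Delta$ is in $Q$. Pave $\mathbb Z^2$ by a grid of square tiles of integer side $\ell$. For a tile $T$, $n_c(T)$ is $\tfrac12$ times the number of pairs consisting of a bond of $\Gamma(\Delta)$ that belongs to $T$ and an endpoint of this bond that carries a corner. A hole in $T$ is a square of side at least $\ell/5$ in $T$ that is contained in $\Delta$ or in $\Delta^c$. The tile $T$ is bad if $n_c(T)>0$ or $T$ contains a hole; $N_B^{\rm hole}$ is the number of bad tiles containing a hole. The good regions $G_i$ are the connected components (for nearest-neighbour adjacency) of the complement of the union of the bad tiles. $G_i$ is vertically striped if all bonds of $\Gamma(\Delta)$ belonging to $G_i$ are vertical, and horizontally striped otherwise. If $G_i$ is vertically (resp.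 horizontally) striped, $A_h(G_i)$ is the number of sites in the union of all rectangles $R\subset G_i$ of horizontal (resp. vertical) width $h$ that are contained in $\Delta$ or in $\Delta^c$ and whose two vertical (resp. horizontal) sides consist of bonds of $\Gamma(\Delta)$ belonging to $G_i$. **Theorem.** For every $p>4$ there are positive constants $C_0,C_1,\varepsilon$ such that, if $J_c-\varepsilon<J<J_c$ and $\ell$ is an integer with $C_0h^*\le\ell\le(C_0(J_c-J))^{-1}$, then for every $s\in\{\pm1\}^{\mathbb Z^2}$ and every finite $X\subset\mathbb Z^2$ $$H_X(s_X|\sigma^*)\ \ge\ H_X(\sigma^*_X|\sigma^*)+C_1\Big(N_c+(J_c-J)^{\frac{p-2}{p-3}}\ell^2N_B^{\rm hole}\Big)+\frac12\sum_{h\ne h^*}\sum_i\big(e_s(h)-e_s(h^*)\big)A_h(G_i),$$ where $N_c$, $N_B^{\rm hole}$, $G_i$ and $A_h(G_i)$ are those of the configuration that equals $s$ on $X$ and $\sigma^*$ on $X^c$. (In particular the right side is finite.) -/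

import Mathlib

open scoped ENNReal

namespace StripeModel

/-! ### The spin model on the square lattice -/

/-- Sites of the square lattice. -/
abbrev Site := ℤ × ℤ

/-- Spin configurations; the units of `ℤ` are exactly `1` and `-1`. -/
abbrev Config := Site → ℤˣ

/-- The nearest neighbour graph of the square lattice. -/
def latticeGraph : SimpleGraph Site where
  Adj x y := |x.1 - y.1| + |x.2 - y.2| = 1
  symm := ⟨fun x y h => by rw [abs_sub_comm y.1, abs_sub_comm y.2]; exact h⟩
  loopless := ⟨fun x h => by simp at h⟩

instance : DecidableRel latticeGraph.Adj :=
  fun x y => inferInstanceAs (Decidable (|x.1 - y.1| + |x.2 - y.2| = 1))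

/-- Euclidean distance between two sites. -/
noncomputable def siteDist (x y : Site) : ℝ :=
  Real.sqrt (((x.1 : ℝ) - y.1) ^ 2 + ((x.2 : ℝ) - y.2) ^ 2)

/-- The coefficient of `σ_x σ_y - 1` in the Hamiltonian: `-J` for nearest neighbours,
plus `1 / |x - y| ^ p` for distinct sites. -/
noncomputable def coupling (p J : ℝ) (x y : Site) : ℝ :=
  (if latticeGraph.Adj x y then -J else 0) + (if x = y then 0 else 1 / siteDist x y ^ p)

/-- The energy of the pair `x, y` carrying the spins `a, b`. -/
noncomputable def pairEnergy (p J : ℝ) (x y : Site) (a b : ℤˣ) : ℝ :=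
  coupling p J x y * (((a : ℤ) : ℝ) * ((b : ℤ) : ℝ) - 1)

/-- The energy `H_X(σ_X | s)` in the finite set `X` with boundary condition `s`: each unordered
pair in `X` is counted once, and so is each pair consisting of a site in `X` and one outside. -/
noncomputable def energy (p J : ℝ) (X : Finset Site) (σ s : Config) : ℝ :=
  (1 / 2) * ∑ x ∈ X, ∑ y ∈ X, pairEnergy p J x y (σ x) (σ y)
    + ∑ x ∈ X, ∑' y : {y : Site // y ∉ X}, pairEnergy p J x y (σ x) (s y)

/-- The critical value `J_c` of the nearest neighbour coupling. -/
noncomputable def Jc (p : ℝ) : ℝ :=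
  ∑' y : {y : Site // 0 < y.1},
    (y.1.1 : ℝ) / (((y.1.1 : ℝ) ^ 2 + (y.1.2 : ℝ) ^ 2) ^ (p / 2))

/-- The vertically striped configuration of stripe width `h`, that is
`sign (sin (π (x₁ + 1/2) / h))`; for `h ≥ 1` the sine does not vanish. -/
noncomputable def stripe (h : ℕ) : Config := fun x =>
  if 0 < Real.sin (Real.pi * ((x.1 : ℝ) + 1 / 2) / h) then 1 else -1

/-- The energy attributed to the site `x`: one half of its interaction with all other sites. -/
noncomputable def siteEnergy (p J : ℝ) (σ : Config) (x : Site) : ℝ :=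
  (1 / 2) * ∑' y : Site, pairEnergy p J x y (σ x) (σ y)

/-- The energy per site `e_s(h)` of the striped configuration of width `h`: the average of the
site energies over one period (this configuration is `2h`-periodic in the first coordinate and
does not depend on the second one). -/
noncomputable def stripeEnergy (p J : ℝ) (h : ℕ) : ℝ :=
  (1 / (2 * (h : ℝ))) * ∑ i ∈ Finset.range (2 * h), siteEnergy p J (stripe h) ((i : ℤ), 0)

/-- `h` is a minimizer of `e_s` over the positive integers. -/
def IsOptimalWidth (p J : ℝ) (h : ℕ) : Prop :=
  1 ≤ h ∧ ∀ k : ℕ, 1 ≤ k → stripeEnergy p J h ≤ stripeEnergy p J k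

/-! ### Contours and corners -/

/-- Orientation of a bond of the dual lattice. -/
inductive Dir
  | horizontal
  | vertical

/-- Bonds of the dual lattice. The vertex `(i, j) : ℤ × ℤ` of the dual lattice is the point
`(i - 1/2, j - 1/2)` of the plane; a bond is given by its orientation and by its left
(respectively lower) endpoint. -/
structure Bond where
  /-- the orientation -/
  dir : Dir
  /-- the left or lower endpoint -/
  base : ℤ × ℤ

/-- The first one (below or left of the bond) of the two sites that the bond separates. -/
def Bond.site₁ (b : Bond) : Site :=
  match b.dir with
  | .horizontal => (b.base.1, b.base.2 - 1)
  | .vertical => (b.base.1 - 1, b.base.2)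

/-- The second one (above or right of the bond) of the two sites that the bond separates. -/
def Bond.site₂ (b : Bond) : Site := b.base

/-- The right or upper endpoint of the bond. -/
def Bond.top (b : Bond) : ℤ × ℤ :=
  match b.dir with
  | .horizontal => (b.base.1 + 1, b.base.2)
  | .vertical => (b.base.1, b.base.2 + 1)

/-- The dual vertex `v` is an endpoint of the bond `b`. -/
def Bond.HasEnd (b : Bond) (v : ℤ × ℤ) : Prop := v = b.base ∨ v = b.top

/-- `Γ(Δ)`: the bonds that separate a minus site from a plus site. -/
def boundary (σ : Config) : Set Bond := {b | σ b.site₁ ≠ σ b.site₂}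

/-- The bonds of `Γ(Δ)` that belong to the set `Q` of sites: those whose adjacent minus site
lies in `Q`. -/
def boundaryIn (σ : Config) (Q : Set Site) : Set Bond :=
  {b | b ∈ boundary σ ∧
    ((σ b.site₁ = -1 ∧ b.site₁ ∈ Q) ∨ (σ b.site₂ = -1 ∧ b.site₂ ∈ Q))}

/-- The bonds of `Γ(Δ)` of a given orientation that end at the dual vertex `v`. -/
def boundaryAt (σ : Config) (d : Dir) (v : ℤ × ℤ) : Set Bond :=
  {b | b ∈ boundary σ ∧ b.dir = d ∧ b.HasEnd v}

/-- The contours turn at `v`: a horizontal and a vertical bond of `Γ(Δ)` meet there. (At a vertex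
where four bonds meet, each of the two contour pieces obtained by chopping turns.) -/
def IsCornerVertex (σ : Config) (v : ℤ × ℤ) : Prop :=
  (boundaryAt σ .horizontal v).Nonempty ∧ (boundaryAt σ .vertical v).Nonempty

open Classical in
/-- The number of corners at the dual vertex `v`. Either two or four bonds of `Γ(Δ)` meet at a
corner vertex; every corner joins one horizontal and one vertical bond, so there is one corner in
the former case, and there are two of them in the latter (chopped) case. -/
noncomputable def cornersAt (σ : Config) (v : ℤ × ℤ) : ℕ∞ :=
  if IsCornerVertex σ v then (boundaryAt σ .horizontal v).encard else 0

/-- `N_c`, the total number of corners of the contours. -/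
noncomputable def numCorners (σ : Config) : ℝ≥0∞ :=
  ∑' v : ℤ × ℤ, ((cornersAt σ v : ℕ∞) : ℝ≥0∞)

/-- `n_c(T)`, the number of corners in `T`: each end of a straight contour portion in `T`
that is a corner contributes `1/2`. Such ends are the pairs of a bond in `T` and a corner vertex
at which it ends. -/
noncomputable def numCornersIn (σ : Config) (T : Set Site) : ℝ≥0∞ :=
  (({e : Bond × (ℤ × ℤ) |
      e.1 ∈ boundaryIn σ T ∧ e.1.HasEnd e.2 ∧ IsCornerVertex σ e.2}.encard : ℕ∞) : ℝ≥0∞) / 2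

/-! ### Tiles, bad tiles and good regions -/

/-- The rectangle of sites with lower left site `a`, width `w` and height `t`. -/
def rect (a : Site) (w t : ℕ) : Set Site :=
  {x | a.1 ≤ x.1 ∧ x.1 < a.1 + w ∧ a.2 ≤ x.2 ∧ x.2 < a.2 + t}

/-- All spins of `σ` in `R` are equal: `R` is contained in `Δ` or in its complement. -/
def IsUniformOn (σ : Config) (R : Set Site) : Prop :=
  (∀ x ∈ R, σ x = -1) ∨ (∀ x ∈ R, σ x = 1)

/-- The tile number `k` of the paving by squares of side `ℓ` with origin `o`. -/
def tile (o : Site) (ℓ : ℕ) (k : ℤ × ℤ) : Set Site :=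
  rect (o.1 + ℓ * k.1, o.2 + ℓ * k.2) ℓ ℓ

/-- `T` contains a hole: a square of side at least `ℓ / 5` contained in `Δ` or in `Δᶜ`. -/
def HasHole (σ : Config) (ℓ : ℕ) (T : Set Site) : Prop :=
  ∃ (a : Site) (m : ℕ), (ℓ : ℝ) / 5 ≤ m ∧ rect a m m ⊆ T ∧ IsUniformOn σ (rect a m m)

/-- A tile is bad if it has corners or contains a hole. -/
def IsBad (σ : Config) (ℓ : ℕ) (T : Set Site) : Prop :=
  0 < numCornersIn σ T ∨ HasHole σ ℓ T

/-- `N_B^hole`, the number of bad tiles that contain a hole. -/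
noncomputable def numBadHole (σ : Config) (o : Site) (ℓ : ℕ) : ℝ≥0∞ :=
  (({k : ℤ × ℤ | IsBad σ ℓ (tile o ℓ k) ∧ HasHole σ ℓ (tile o ℓ k)}.encard : ℕ∞) : ℝ≥0∞)

/-- The complement of the union of the bad tiles. -/
def goodSites (σ : Config) (o : Site) (ℓ : ℕ) : Set Site :=
  (⋃ k ∈ {k : ℤ × ℤ | IsBad σ ℓ (tile o ℓ k)}, tile o ℓ k)ᶜ

/-- The (indices of the) good regions: the connected components of the complement of the union of
the bad tiles. -/
abbrev GoodRegion (σ : Config) (o : Site) (ℓ : ℕ) : Type :=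
  (latticeGraph.induce (goodSites σ o ℓ)).ConnectedComponent

/-- The set of sites of a good region. -/
def GoodRegion.sites {σ : Config} {o : Site} {ℓ : ℕ} (G : GoodRegion σ o ℓ) : Set Site :=
  Subtype.val '' (SimpleGraph.ConnectedComponent.supp G)

/-- `G` is vertically striped: all bonds of `Γ(Δ)` in it are vertical. -/
def IsVerticallyStriped (σ : Config) (G : Set Site) : Prop :=
  ∀ b ∈ boundaryIn σ G, b.dir = .vertical

/-- `R` is a rectangular portion of stripe of width `h` in `G`: a uniform rectangle in `G` whose
two boundaries parallel to the stripes consist of bonds of `Γ(Δ)` that belong to `G`. -/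
def IsStripePortion (σ : Config) (G : Set Site) (h : ℕ) (R : Set Site) : Prop :=
  (IsVerticallyStriped σ G ∧ ∃ (a : Site) (t : ℕ), R = rect a h t ∧ R ⊆ G ∧ IsUniformOn σ R ∧
      ∀ y : ℤ, a.2 ≤ y → y < a.2 + t →
        Bond.mk .vertical (a.1, y) ∈ boundaryIn σ G ∧
        Bond.mk .vertical (a.1 + h, y) ∈ boundaryIn σ G) ∨
  (¬ IsVerticallyStriped σ G ∧ ∃ (a : Site) (t : ℕ), R = rect a t h ∧ R ⊆ G ∧ IsUniformOn σ R ∧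
      ∀ x : ℤ, a.1 ≤ x → x < a.1 + t →
        Bond.mk .horizontal (x, a.2) ∈ boundaryIn σ G ∧
        Bond.mk .horizontal (x, a.2 + h) ∈ boundaryIn σ G)

/-- `A_h(G)`, the area (number of sites) of the union of all the rectangular portions of stripes
of width `h` in `G`. -/
noncomputable def stripeArea (σ : Config) (G : Set Site) (h : ℕ) : ℝ≥0∞ :=
  (((⋃₀ {R : Set Site | IsStripePortion σ G h R}).encard : ℕ∞) : ℝ≥0∞)

/-- The configuration equal to `s` on `X` and to `s'` outside `X`. -/
def glue (X : Finset Site) (s s' : Config) : Config := fun x => if x ∈ X then s x else s' x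

end StripeModel

open StripeModel

/-!
The energy difference is a sum over displacements `n = (n₁, n₂)` of the coupling times the excess
number of pairs `x, x + n` with different spins. Joining `x` to `x + n` by a path with a horizontal
and a vertical leg, the spins differ at the ends if and only if they differ along exactly one leg;
as the reference configuration is constant on columns, this splits the energy difference *exactly*
into the energies of the rows, the energies of the columns, and twice the kernel summed against the
number of paths along both legs of which the spin changes (`energy_sub_eq`). The last term is
nonnegative, and every vertex with a corner contributes at least `2 * 2 ^ (-p)` to it
(`card_cornerVertices_le_tsum`).

Each row or column is a one-dimensional system whose interaction `lineKernel p` is the sum of the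
kernel over lines, and `2 * J_c` is the first moment of this interaction. The line kernel is
completely monotone: the factorization `|n + im|⁻ᵖ = (n + im)^(-p/2) (n - im)^(-p/2)` and the Gamma
integral turn the sum over `m` into a limit of Fejér averages of exponentials `x ^ n` with positive
weights. So an inequality between energies follows from its counterpart for all exponential
interactions (`tsum_mul_lineKernel_nonneg`). For an exponential interaction the repulsion of the
kinks is determined by the one-sided fields at the kinks, which obey a one-step recursion along the
runs; a telescoping estimate (`sum_field_le`) bounds the energy of a line from below by the sum over
its sites of the energy per site `e(h)` of periodic stripes, `h` being the length of the run of the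
site (`row_lineEnergy_ge`, `column_lineEnergy_ge`). Altogether (`energy_sub_ge`), with `τ = J_c - J`
and `hWidth x`, `vWidth x` the lengths of the horizontal and vertical runs through `x`, the energy
difference is at least

  `∑ₓ (e(hWidth x) - e(h*) + e(vWidth x)) - 2 τ #{columns that are not constant} + 2 · 2⁻ᵖ #V`,

where `V` is the set of vertices with corners and `e(0) = 0` accounts for infinite runs.

Since the repulsion is nonnegative, `e(h) ≥ -2τ / h`; and `|e(h*)|` is at least of order
`τ ^ ((p - 2) / (p - 3))` while `h* |e(h*)|` is at least of order `τ` (`exists_optimal_bounds`).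
A wall without corners crosses its tile and continues into the next one (`horizontal_line`,
`vertical_line`). Hence walls without corners of both orientations cannot meet the same tile: in
each tile, for one of the two directions, every lattice line in this direction that carries a wall
carries one with a corner at its end (`rowsCornered_or_columnsCornered`), a good tile is striped in one direction only, and neighbouring
good tiles agree. In each tile one of `e(hWidth)`, `e(vWidth)` is kept, so that
with `-e(h*)` it forms a nonnegative gain, and the other one is estimated by `-2τ` times the inverse
width. The sum of the inverse widths counts ends of runs (`sum_inv_vWidth_le`), and since stripes
run straight through the good tiles, these ends can be attributed to bad tiles
(`sum_inv_vWidth_tiles_le`); so can the columns that are not constant (`card_columns_le`). A bad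
tile is therefore charged a cost of order `τ ℓ (1 + number of corners)`. For a tile with corners
this is beaten by the energy of the corners because `τ ℓ` is small, and for a tile with a hole by
the missing energy `ℓ² |e(h*)| / 50` of the hole (`sum_siteGain_of_hasHole`) because
`ℓ |e(h*)| / τ` is large. The gains that remain in the good tiles dominate the sum of the
stripe areas (`tsum_stripeArea_le`).
-/

namespace StripeModel

open Filter Topology

section

open MeasureTheory ProbabilityTheory

/-! ### The long range kernel -/

/-- The antiferromagnetic kernel `|n|⁻ᵖ` as a function of the displacement `n`, equal to `0` at
`n = 0`. -/
noncomputable def kernel (p : ℝ) (n : ℤ × ℤ) : ℝ :=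
  if n = 0 then 0 else 1 / Real.sqrt ((n.1 : ℝ) ^ 2 + (n.2 : ℝ) ^ 2) ^ p

/-- The effective one-dimensional interaction between two parallel lattice lines at distance `n`:
twice the interaction of one site with a whole line. -/
noncomputable def lineKernel (p : ℝ) (n : ℤ) : ℝ := 2 * ∑' m : ℤ, kernel p (n, m)

/-- The measure `t ^ (a - 1) dt` on the positive half-line. -/
noncomputable def gammaWeight (a : ℝ) : Measure ℝ :=
  (volume.restrict (Set.Ioi 0)).withDensity fun t => ENNReal.ofReal (t ^ (a - 1))

instance (a : ℝ) : SFinite (gammaWeight a) := by unfold gammaWeight; infer_instance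

lemma integral_gammaWeight (a : ℝ) {E : Type*} [NormedAddCommGroup E] [NormedSpace ℝ E]
    (f : ℝ → E) :
    ∫ t, f t ∂(gammaWeight a) = ∫ t in Set.Ioi 0, t ^ (a - 1) • f t := by
  unfold gammaWeight
  rw [integral_withDensity_eq_integral_toReal_smul (by fun_prop) (by simp)]
  refine setIntegral_congr_fun measurableSet_Ioi fun t ht => ?_
  rw [ENNReal.toReal_ofReal (Real.rpow_nonneg (le_of_lt ht) _)]

lemma integrable_exp_gammaWeight {a r : ℝ} (ha : 0 < a) (hr : r < 0) :
    Integrable (fun t => Real.exp (r * t)) (gammaWeight a) := by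
  unfold gammaWeight
  rw [integrable_withDensity_iff (by fun_prop) (by simp)]
  have h := (integrableOn_rpow_mul_exp_neg_mul_rpow (s := a - 1) (p := 1) (b := -r)
    (by linarith) one_pos (by linarith))
  refine IntegrableOn.congr_fun h (fun t ht => ?_) measurableSet_Ioi
  simp only [Real.rpow_one, neg_neg]
  rw [ENNReal.toReal_ofReal (Real.rpow_nonneg (le_of_lt ht) _), mul_comm]

lemma mgf_gammaWeight {a r : ℝ} (ha : 0 < a) (hr : r < 0) :
    mgf id (gammaWeight a) r = (-r) ^ (-a) * Real.Gamma a := by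
  unfold mgf
  rw [integral_gammaWeight]
  have := Real.integral_rpow_mul_exp_neg_mul_Ioi ha (neg_pos.2 hr)
  simp only [neg_mul, neg_neg, one_div] at this
  simp only [id, smul_eq_mul]
  rw [this, Real.inv_rpow (by linarith), Real.rpow_neg (by linarith)]

lemma Iio_subset_interior_integrableExpSet {a : ℝ} (ha : 0 < a) :
    Set.Iio 0 ⊆ interior (integrableExpSet id (gammaWeight a)) :=
  interior_maximal (fun _ hr => integrable_exp_gammaWeight ha hr) isOpen_Iio

/-- The Laplace transform of `t ^ (a - 1)` on the right half-plane, obtained from the real axis by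
the identity theorem. -/
lemma complexMGF_gammaWeight {a : ℝ} (ha : 0 < a) {z : ℂ} (hz : z.re < 0) :
    complexMGF id (gammaWeight a) z = (-z) ^ (-a : ℂ) * Real.Gamma a := by
  have hX : AnalyticOnNhd ℂ (complexMGF id (gammaWeight a)) {z | z.re < 0} :=
    analyticOnNhd_complexMGF.mono fun z hz => Iio_subset_interior_integrableExpSet ha hz
  have hY : AnalyticOnNhd ℂ (fun z : ℂ => (-z) ^ (-a : ℂ) * Real.Gamma a) {z | z.re < 0} := by
    intro w hw
    refine AnalyticAt.mul (AnalyticAt.cpow analyticAt_id.neg analyticAt_const ?_) analyticAt_const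
    refine Or.inl ?_
    have : w.re < 0 := hw
    simpa using this
  have hconv : IsPreconnected {z : ℂ | z.re < 0} :=
    (convex_halfSpace_re_lt 0).isPreconnected
  refine AnalyticOnNhd.eqOn_of_preconnected_of_frequently_eq hX hY hconv (z₀ := ((-1 : ℝ) : ℂ))
    (by simp) ?_ hz
  have h_real : ∃ᶠ (x : ℝ) in 𝓝[≠] (-1), complexMGF id (gammaWeight a) x =
      (-(x : ℂ)) ^ (-a : ℂ) * Real.Gamma a := by
    refine Eventually.frequently ?_
    have : ∀ᶠ x : ℝ in 𝓝 (-1), x < 0 := Iio_mem_nhds (by norm_num)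
    filter_upwards [this.filter_mono nhdsWithin_le_nhds] with x hx
    rw [complexMGF_ofReal, mgf_gammaWeight ha hx, Complex.ofReal_mul,
      Complex.ofReal_cpow (by linarith)]
    simp
  rw [frequently_iff_seq_forall] at h_real ⊢
  obtain ⟨xs, hx_tendsto, hx_eq⟩ := h_real
  refine ⟨fun n => xs n, ?_, fun n => hx_eq n⟩
  rw [tendsto_nhdsWithin_iff] at hx_tendsto ⊢
  constructor
  · rw [tendsto_ofReal_iff]
    exact hx_tendsto.1
  · filter_upwards [hx_tendsto.2] with n hn
    have hn' : xs n ≠ -1 := hn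
    change ((xs n : ℝ) : ℂ) ≠ ((-1 : ℝ) : ℂ)
    exact_mod_cast hn'

/-- The factorization of the kernel into two complex conjugate powers. -/
lemma kernel_eq_norm {p : ℝ} {n : ℝ} (hn : 0 < n) (m : ℝ) :
    ((n : ℂ) + m * Complex.I) ^ (-(p / 2 : ℝ) : ℂ) * ((n : ℂ) - m * Complex.I) ^ (-(p / 2 : ℝ) : ℂ) =
      ((1 / Real.sqrt (n ^ 2 + m ^ 2) ^ p : ℝ) : ℂ) := by
  set z : ℂ := (n : ℂ) + m * Complex.I with hz
  have hre : z.re = n := by simp [hz]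
  have him : z.im = m := by simp [hz]
  have hconj : (n : ℂ) - m * Complex.I = (starRingEnd ℂ) z := by
    simp [hz, sub_eq_add_neg]
  have harg : z.arg ≠ Real.pi := by
    intro h
    rw [Complex.arg_eq_pi_iff] at h
    linarith [h.1]
  have hz0 : z ≠ 0 := by
    intro h
    rw [h] at hre
    simp at hre
    linarith
  have hnorm : Real.sqrt (n ^ 2 + m ^ 2) = ‖z‖ := by
    rw [Complex.norm_def, Complex.normSq_apply, hre, him]
    congr 1; ring
  rw [hconj, hnorm, ← Complex.ofReal_neg, Complex.conj_cpow _ _ harg, Complex.conj_ofReal,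
    Complex.mul_conj, Complex.normSq_eq_norm_sq]
  congr 1
  rw [Complex.norm_cpow_real, ← Real.rpow_natCast, ← Real.rpow_mul (norm_nonneg _), one_div,
    ← Real.rpow_neg (norm_nonneg _)]
  congr 1; push_cast; ring

lemma integrable_cexp_gammaWeight {a : ℝ} (ha : 0 < a) {z : ℂ} (hz : z.re < 0) :
    Integrable (fun t : ℝ => Complex.exp (z * t)) (gammaWeight a) := by
  refine (integrable_norm_iff (by fun_prop)).1 ?_
  refine (integrable_exp_gammaWeight ha hz).congr (ae_of_all _ fun t => ?_)
  simp [Complex.norm_exp]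

/-- The integral representation `|n + im|⁻ᵖ` as a superposition of exponentials in `n`. -/
lemma integral_prod_gammaWeight {p : ℝ} (hp : 0 < p) {n : ℝ} (hn : 0 < n) (m : ℝ) :
    Integrable (fun x : ℝ × ℝ => (Real.exp (-(n * (x.1 + x.2))) : ℂ) *
        Complex.exp (-(m * (x.1 - x.2) : ℝ) * Complex.I))
      ((gammaWeight (p / 2)).prod (gammaWeight (p / 2))) ∧
    ∫ x : ℝ × ℝ, (Real.exp (-(n * (x.1 + x.2))) : ℂ) *
        Complex.exp (-(m * (x.1 - x.2) : ℝ) * Complex.I)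
      ∂((gammaWeight (p / 2)).prod (gammaWeight (p / 2))) =
      (Real.Gamma (p / 2) ^ 2 * (1 / Real.sqrt (n ^ 2 + m ^ 2) ^ p) : ℝ) := by
  have hp2 : 0 < p / 2 := by linarith
  have h1 : (-((n : ℂ) + m * Complex.I)).re < 0 := by simp [hn]
  have h2 : (-((n : ℂ) - m * Complex.I)).re < 0 := by simp [hn]
  have hfun : (fun x : ℝ × ℝ => (Real.exp (-(n * (x.1 + x.2))) : ℂ) *
        Complex.exp (-(m * (x.1 - x.2) : ℝ) * Complex.I)) =
      fun x : ℝ × ℝ => Complex.exp (-((n : ℂ) + m * Complex.I) * x.1) *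
        Complex.exp (-((n : ℂ) - m * Complex.I) * x.2) := by
    funext x
    rw [Complex.ofReal_exp, ← Complex.exp_add, ← Complex.exp_add]
    congr 1
    push_cast
    ring
  rw [hfun]
  refine ⟨(integrable_cexp_gammaWeight hp2 h1).mul_prod (integrable_cexp_gammaWeight hp2 h2), ?_⟩
  rw [integral_prod_mul (μ := gammaWeight (p / 2)) (ν := gammaWeight (p / 2))
    (fun t : ℝ => Complex.exp (-((n : ℂ) + m * Complex.I) * t))
    (fun t : ℝ => Complex.exp (-((n : ℂ) - m * Complex.I) * t))]
  have e1 := complexMGF_gammaWeight hp2 h1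
  have e2 := complexMGF_gammaWeight hp2 h2
  simp only [complexMGF, id, neg_neg] at e1 e2
  rw [e1, e2, Complex.ofReal_mul, ← kernel_eq_norm hn m]
  push_cast
  ring

/-! ### Symmetries, bounds and summability of the kernel -/

lemma kernel_nonneg (p : ℝ) (n : ℤ × ℤ) : 0 ≤ kernel p n := by
  unfold kernel; split_ifs <;> positivity

lemma kernel_neg_left (p : ℝ) (a b : ℤ) : kernel p (-a, b) = kernel p (a, b) := by
  simp [kernel]

lemma kernel_swap (p : ℝ) (a b : ℤ) : kernel p (b, a) = kernel p (a, b) := by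
  simp only [kernel, Prod.mk_eq_zero, and_comm, add_comm]

lemma kernel_neg (p : ℝ) (n : ℤ × ℤ) : kernel p (-n) = kernel p n := by
  simp [kernel]

lemma lineKernel_nonneg (p : ℝ) (n : ℤ) : 0 ≤ lineKernel p n :=
  mul_nonneg zero_le_two (tsum_nonneg fun _ => kernel_nonneg _ _)

lemma lineKernel_neg (p : ℝ) (n : ℤ) : lineKernel p (-n) = lineKernel p n := by
  simp [lineKernel, kernel_neg_left]

/-- Tail of the `s`-series, by comparison with the telescoping series of `k ^ (1 - s)`. -/
lemma summable_tail_rpow {s : ℝ} (hs : 2 ≤ s) {a : ℕ} (ha : 1 ≤ a) :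
    Summable (fun k : ℕ => ((a + k : ℕ) : ℝ) ^ (-s)) ∧
      ∑' k : ℕ, ((a + k : ℕ) : ℝ) ^ (-s) ≤ 2 ^ s * (a : ℝ) ^ (1 - s) := by
  have hterm : ∀ k : ℕ, 1 ≤ k → (k : ℝ) ^ (-s) ≤
      2 ^ s * ((k : ℝ) ^ (1 - s) - ((k + 1 : ℕ) : ℝ) ^ (1 - s)) := by
    intro k hk
    have hk0 : (0 : ℝ) < k := by exact_mod_cast hk
    have hk1 : (0 : ℝ) < (k + 1 : ℕ) := by positivity
    have hk1' : ((k + 1 : ℕ) : ℝ) = k + 1 := by push_cast; ring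
    have h1 : ((k + 1 : ℕ) : ℝ) ^ (1 - s) * (1 + 1 / k) ≤ (k : ℝ) ^ (1 - s) := by
      have hb : (1 : ℝ) + 1 / k ≤ (1 + 1 / (k : ℝ)) ^ (s - 1) := by
        have h1k : (1 : ℝ) ≤ 1 + 1 / k := by
          have : (0 : ℝ) ≤ 1 / k := by positivity
          linarith
        calc (1 : ℝ) + 1 / k = (1 + 1 / (k : ℝ)) ^ (1 : ℝ) := (Real.rpow_one _).symm
          _ ≤ _ := Real.rpow_le_rpow_of_exponent_le h1k (by linarith)
      have hmul : ((k + 1 : ℕ) : ℝ) = k * (1 + 1 / k) := by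
        rw [hk1']; field_simp
      calc ((k + 1 : ℕ) : ℝ) ^ (1 - s) * (1 + 1 / k)
          ≤ ((k + 1 : ℕ) : ℝ) ^ (1 - s) * (1 + 1 / (k : ℝ)) ^ (s - 1) := by gcongr
        _ = (k : ℝ) ^ (1 - s) := by
            rw [hmul, Real.mul_rpow hk0.le (by positivity), mul_assoc,
              ← Real.rpow_add (by positivity)]
            simp
    have h2 : ((k + 1 : ℕ) : ℝ) ^ (-s) ≤ ((k + 1 : ℕ) : ℝ) ^ (1 - s) * (1 / k) := by
      have : ((k + 1 : ℕ) : ℝ) ^ (-s) = ((k + 1 : ℕ) : ℝ) ^ (1 - s) * (1 / ((k + 1 : ℕ) : ℝ)) := by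
        rw [show -s = (1 - s) + (-1) by ring, Real.rpow_add hk1, Real.rpow_neg_one, one_div]
      rw [this]
      gcongr
      exact Nat.le_succ k
    have h3 : (k : ℝ) ^ (-s) ≤ 2 ^ s * ((k + 1 : ℕ) : ℝ) ^ (-s) := by
      have h2k : ((k + 1 : ℕ) : ℝ) ≤ 2 * k := by
        rw [hk1']
        have : (1 : ℝ) ≤ k := by exact_mod_cast hk
        linarith
      have : ((2 : ℝ) * k) ^ (-s) ≤ ((k + 1 : ℕ) : ℝ) ^ (-s) :=
        Real.rpow_le_rpow_of_nonpos hk1 h2k (by linarith)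
      calc (k : ℝ) ^ (-s) = 2 ^ s * ((2 : ℝ) * k) ^ (-s) := by
            rw [Real.mul_rpow zero_le_two hk0.le, ← mul_assoc, ← Real.rpow_add zero_lt_two]
            simp
        _ ≤ _ := by gcongr
    calc (k : ℝ) ^ (-s) ≤ 2 ^ s * ((k + 1 : ℕ) : ℝ) ^ (-s) := h3
      _ ≤ 2 ^ s * ((k : ℝ) ^ (1 - s) - ((k + 1 : ℕ) : ℝ) ^ (1 - s)) := by
        gcongr
        linarith
  have hpart : ∀ N : ℕ, ∑ k ∈ Finset.range N, ((a + k : ℕ) : ℝ) ^ (-s) ≤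
      2 ^ s * (a : ℝ) ^ (1 - s) := by
    intro N
    have : ∑ k ∈ Finset.range N, ((a + k : ℕ) : ℝ) ^ (-s) ≤
        2 ^ s * ((a : ℝ) ^ (1 - s) - ((a + N : ℕ) : ℝ) ^ (1 - s)) := by
      induction N with
      | zero => simp
      | succ N ih =>
        rw [Finset.sum_range_succ]
        have := hterm (a + N) (by omega)
        rw [show a + (N + 1) = a + N + 1 by ring]
        linarith
    refine this.trans ?_
    gcongr
    have : (0 : ℝ) ≤ ((a + N : ℕ) : ℝ) ^ (1 - s) := by positivity
    linarith
  have hnn : ∀ k : ℕ, 0 ≤ ((a + k : ℕ) : ℝ) ^ (-s) := fun k => by positivity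
  exact ⟨summable_of_sum_range_le hnn hpart, Real.tsum_le_of_sum_range_le hnn hpart⟩

lemma kernel_le {p : ℝ} (hp : 0 ≤ p) (a b : ℤ) :
    kernel p (a, b) ≤ 4 ^ p * (((max a.natAbs 1) + b.natAbs : ℕ) : ℝ) ^ (-p) := by
  unfold kernel
  split_ifs with h
  · positivity
  have hpos : (0 : ℝ) < ((max a.natAbs 1) + b.natAbs : ℕ) := by
    have : 0 < (max a.natAbs 1) + b.natAbs := by positivity
    exact_mod_cast this
  have hnat : (max a.natAbs 1) + b.natAbs ≤ 2 * (a.natAbs + b.natAbs) := by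
    simp only [Prod.mk_eq_zero, not_and_or] at h
    omega
  have hnat' : (((max a.natAbs 1) + b.natAbs : ℕ) : ℝ) ≤ 2 * (|(a : ℝ)| + |(b : ℝ)|) := by
    have : (((max a.natAbs 1) + b.natAbs : ℕ) : ℝ) ≤ ((2 * (a.natAbs + b.natAbs) : ℕ) : ℝ) := by
      exact_mod_cast hnat
    refine this.trans (le_of_eq ?_)
    push_cast [Nat.cast_natAbs]
    ring
  have hs : |(a : ℝ)| + |(b : ℝ)| ≤ 2 * Real.sqrt ((a : ℝ) ^ 2 + (b : ℝ) ^ 2) := by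
    have h1 : |(a : ℝ)| ≤ Real.sqrt ((a : ℝ) ^ 2 + (b : ℝ) ^ 2) :=
      Real.abs_le_sqrt (by nlinarith [sq_nonneg (b : ℝ)])
    have h2 : |(b : ℝ)| ≤ Real.sqrt ((a : ℝ) ^ 2 + (b : ℝ) ^ 2) :=
      Real.abs_le_sqrt (by nlinarith [sq_nonneg (a : ℝ)])
    linarith
  rw [one_div, ← Real.rpow_neg (Real.sqrt_nonneg _)]
  set x : ℝ := (((max a.natAbs 1) + b.natAbs : ℕ) : ℝ)
  have hx : x / 4 ≤ Real.sqrt ((a : ℝ) ^ 2 + (b : ℝ) ^ 2) := by linarith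
  calc Real.sqrt ((a : ℝ) ^ 2 + (b : ℝ) ^ 2) ^ (-p) ≤ (x / 4) ^ (-p) :=
        Real.rpow_le_rpow_of_nonpos (by positivity) hx (by linarith)
    _ = 4 ^ p * x ^ (-p) := by
        rw [Real.div_rpow hpos.le (by norm_num), Real.rpow_neg (by norm_num : (0 : ℝ) ≤ 4),
          div_inv_eq_mul, mul_comm]

lemma le_kernel {p : ℝ} (hp : 0 ≤ p) {a b : ℤ} (ha : 1 ≤ a) (hb : |b| ≤ a) :
    (2 * (a : ℝ)) ^ (-p) ≤ kernel p (a, b) := by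
  unfold kernel
  have h : ((a, b) : ℤ × ℤ) ≠ 0 := by
    simp only [ne_eq, Prod.mk_eq_zero, not_and_or]; omega
  rw [if_neg h, one_div, ← Real.rpow_neg (Real.sqrt_nonneg _)]
  have ha' : (1 : ℝ) ≤ a := by exact_mod_cast ha
  have hb' : |(b : ℝ)| ≤ a := by exact_mod_cast hb
  have hb2 : (b : ℝ) ^ 2 ≤ a ^ 2 := by
    rw [← sq_abs (b : ℝ)]
    gcongr
  refine Real.rpow_le_rpow_of_nonpos (Real.sqrt_pos.2 (by positivity)) ?_ (by linarith)
  rw [Real.sqrt_le_left (by positivity)]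
  nlinarith

/-- The constant in the bound `lineKernel p n ≤ C n ^ (1 - p)`. -/
noncomputable def lineConst (p : ℝ) : ℝ := 2 * (2 * (4 ^ p * 2 ^ p))

lemma lineConst_pos (p : ℝ) : 0 < lineConst p := by unfold lineConst; positivity

lemma summable_and_tsum_kernel_line_le {p : ℝ} (hp : 2 ≤ p) (a : ℤ) :
    Summable (fun m : ℤ => kernel p (a, m)) ∧
      ∑' m : ℤ, kernel p (a, m) ≤ 2 * (4 ^ p * 2 ^ p) * ((max a.natAbs 1 : ℕ) : ℝ) ^ (1 - p) := by
  set A := max a.natAbs 1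
  obtain ⟨hs, ht⟩ := summable_tail_rpow hp (a := A) (le_max_right _ _)
  set g : ℤ → ℝ := fun m => 4 ^ p * ((A + m.natAbs : ℕ) : ℝ) ^ (-p)
  have hg1 : Summable fun n : ℕ => g n := by
    simpa [g] using hs.mul_left (4 ^ p)
  have hg2 : Summable fun n : ℕ => g (-(n + 1 : ℤ)) := by
    refine ((summable_nat_add_iff 1).2 hg1).congr fun n => ?_
    simp only [g, Int.natAbs_neg]
    norm_cast
  have hg : Summable g := Summable.of_nat_of_neg_add_one hg1 hg2
  have hle : ∀ m : ℤ, kernel p (a, m) ≤ g m := fun m => kernel_le (by linarith) a m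
  have hsum : Summable (fun m : ℤ => kernel p (a, m)) :=
    Summable.of_nonneg_of_le (fun _ => kernel_nonneg _ _) hle hg
  refine ⟨hsum, ?_⟩
  have h1 : ∑' n : ℕ, g n ≤ 4 ^ p * (2 ^ p * (A : ℝ) ^ (1 - p)) := by
    have : ∑' n : ℕ, g n = 4 ^ p * ∑' k : ℕ, ((A + k : ℕ) : ℝ) ^ (-p) := by
      rw [← tsum_mul_left]; simp [g]
    rw [this]
    gcongr
  have h2 : ∑' n : ℕ, g (-(n + 1 : ℤ)) ≤ ∑' n : ℕ, g n := by
    have : ∑' n : ℕ, g (-(n + 1 : ℤ)) = ∑' n : ℕ, g ((n + 1 : ℕ) : ℤ) := by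
      refine tsum_congr fun n => ?_
      simp only [g, Int.natAbs_neg]
      norm_cast
    rw [this, hg1.tsum_eq_zero_add]
    have : 0 ≤ g ((0 : ℕ) : ℤ) := by simp only [g]; positivity
    linarith
  calc ∑' m : ℤ, kernel p (a, m) ≤ ∑' m, g m := hsum.tsum_le_tsum hle hg
    _ = ∑' n : ℕ, g n + ∑' n : ℕ, g (-(n + 1 : ℤ)) := tsum_of_nat_of_neg_add_one hg1 hg2
    _ ≤ 2 * (4 ^ p * 2 ^ p) * (A : ℝ) ^ (1 - p) := by linarith

lemma summable_kernel_line {p : ℝ} (hp : 2 ≤ p) (a : ℤ) :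
    Summable (fun m : ℤ => kernel p (a, m)) := (summable_and_tsum_kernel_line_le hp a).1

lemma lineKernel_le {p : ℝ} (hp : 2 ≤ p) {n : ℕ} (hn : 1 ≤ n) :
    lineKernel p n ≤ lineConst p * (n : ℝ) ^ (1 - p) := by
  have := (summable_and_tsum_kernel_line_le hp n).2
  rw [Int.natAbs_natCast, max_eq_left hn] at this
  unfold lineKernel lineConst
  linarith

lemma le_lineKernel {p : ℝ} (hp : 2 ≤ p) {n : ℕ} (hn : 1 ≤ n) :
    2 ^ (1 - p) * (n : ℝ) ^ (1 - p) ≤ lineKernel p n := by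
  have hn0 : (0 : ℝ) < n := by exact_mod_cast hn
  have h1 : ∑ m ∈ (Finset.Ioc (0 : ℤ) n), kernel p (n, m) ≤ ∑' m : ℤ, kernel p (n, m) :=
    (summable_kernel_line hp n).sum_le_tsum _ fun _ _ => kernel_nonneg _ _
  have h2 : ∑ m ∈ (Finset.Ioc (0 : ℤ) n), (2 * ((n : ℤ) : ℝ)) ^ (-p) ≤
      ∑ m ∈ (Finset.Ioc (0 : ℤ) n), kernel p (n, m) := by
    refine Finset.sum_le_sum fun m hm => ?_
    rw [Finset.mem_Ioc] at hm
    exact le_kernel (by linarith) (by exact_mod_cast hn) (by rw [abs_le]; omega)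
  rw [Finset.sum_const, Int.card_Ioc] at h2
  simp only [sub_zero, Int.toNat_natCast, nsmul_eq_mul, Int.cast_natCast] at h2
  have h3 : (2 : ℝ) ^ (1 - p) * (n : ℝ) ^ (1 - p) = 2 * (n * (2 * (n : ℝ)) ^ (-p)) := by
    rw [Real.mul_rpow zero_le_two hn0.le, sub_eq_add_neg, Real.rpow_add zero_lt_two,
      Real.rpow_add hn0, Real.rpow_one, Real.rpow_one]
    ring
  rw [h3]
  unfold lineKernel
  linarith

lemma summable_weight_mul_kernel {p : ℝ} (hp : 2 ≤ p) {w : ℤ → ℝ} (hw : ∀ a, 0 ≤ w a)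
    (hs : Summable fun a : ℤ => w a * ((max a.natAbs 1 : ℕ) : ℝ) ^ (1 - p)) :
    Summable (fun n : ℤ × ℤ => w n.1 * kernel p n) := by
  have hnn : (0 : ℤ × ℤ → ℝ) ≤ fun n => w n.1 * kernel p n :=
    fun n => mul_nonneg (hw _) (kernel_nonneg p n)
  rw [summable_prod_of_nonneg hnn]
  constructor
  · intro a
    exact (summable_kernel_line hp a).mul_left (w a)
  · have hle : ∀ a : ℤ, ∑' b : ℤ, w a * kernel p (a, b) ≤
        2 * (4 ^ p * 2 ^ p) * (w a * ((max a.natAbs 1 : ℕ) : ℝ) ^ (1 - p)) := by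
      intro a
      rw [tsum_mul_left]
      have := mul_le_mul_of_nonneg_left (summable_and_tsum_kernel_line_le hp a).2 (hw a)
      linarith
    exact Summable.of_nonneg_of_le
      (fun a => tsum_nonneg fun b => mul_nonneg (hw a) (kernel_nonneg p (a, b))) hle
      (hs.mul_left (2 * (4 ^ p * 2 ^ p)))

/-- The first moment of the kernel in the first coordinate is finite for `p > 3`. -/
lemma summable_max_mul_kernel {p : ℝ} (hp : 3 < p) :
    Summable (fun n : ℤ × ℤ => ((max n.1.natAbs 1 : ℕ) : ℝ) * kernel p n) := by
  refine summable_weight_mul_kernel (w := fun a => ((max a.natAbs 1 : ℕ) : ℝ)) (by linarith)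
    (fun a => Nat.cast_nonneg _) ?_
  have h0 : Summable fun n : ℕ => ((n + 1 : ℕ) : ℝ) ^ (2 - p) := by
    rw [summable_nat_add_iff (f := fun n : ℕ => (n : ℝ) ^ (2 - p)) 1]
    exact Real.summable_nat_rpow.2 (by linarith)
  have h1 : Summable fun n : ℕ => ((n + 1 : ℕ) : ℝ) * ((n + 1 : ℕ) : ℝ) ^ (1 - p) := by
    refine h0.congr fun n => ?_
    have : (0 : ℝ) < ((n + 1 : ℕ) : ℝ) := by positivity
    rw [show 2 - p = 1 + (1 - p) by ring, Real.rpow_add this, Real.rpow_one]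
  refine Summable.of_nat_of_neg_add_one ?_ ?_
  · rw [← summable_nat_add_iff 1]
    refine h1.congr fun n => ?_
    rw [show max (((n + 1 : ℕ) : ℤ)).natAbs 1 = n + 1 by omega]
  · refine h1.congr fun n => ?_
    rw [show max (-((n : ℤ) + 1)).natAbs 1 = n + 1 by omega]

lemma summable_kernel {p : ℝ} (hp : 3 < p) : Summable (kernel p) := by
  refine Summable.of_nonneg_of_le (kernel_nonneg p) (fun n => ?_) (summable_max_mul_kernel hp)
  refine le_mul_of_one_le_left (kernel_nonneg _ _) ?_
  exact_mod_cast le_max_right _ _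

lemma summable_fst_mul_kernel {p : ℝ} (hp : 3 < p) :
    Summable (fun n : ℤ × ℤ => |(n.1 : ℝ)| * kernel p n) := by
  refine Summable.of_nonneg_of_le (fun n => mul_nonneg (abs_nonneg _) (kernel_nonneg _ _))
    (fun n => ?_) (summable_max_mul_kernel hp)
  refine mul_le_mul_of_nonneg_right ?_ (kernel_nonneg _ _)
  have h : |n.1| ≤ ((max n.1.natAbs 1 : ℕ) : ℤ) := by
    rw [Int.abs_eq_natAbs]
    exact_mod_cast le_max_left n.1.natAbs 1
  rw [← Int.cast_abs]
  calc ((|n.1| : ℤ) : ℝ) ≤ (((max n.1.natAbs 1 : ℕ) : ℤ) : ℝ) := Int.cast_le.2 h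
    _ = _ := Int.cast_natCast _

lemma summable_natMul_lineKernel {p : ℝ} (hp : 3 < p) :
    Summable (fun n : ℕ => (n : ℝ) * lineKernel p n) := by
  refine Summable.of_nonneg_of_le
    (fun n => mul_nonneg (by positivity) (lineKernel_nonneg _ _)) (fun n => ?_)
    ((Real.summable_nat_rpow.2 (by linarith : 2 - p < -1)).mul_left (lineConst p))
  rcases Nat.eq_zero_or_pos n with rfl | hn
  · simp only [Nat.cast_zero, zero_mul]
    exact mul_nonneg (lineConst_pos p).le (by positivity)
  have hn0 : (0 : ℝ) < n := by exact_mod_cast hn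
  calc (n : ℝ) * lineKernel p n ≤ n * (lineConst p * (n : ℝ) ^ (1 - p)) := by
        gcongr; exact lineKernel_le (by linarith) hn
    _ = lineConst p * (n : ℝ) ^ (2 - p) := by
        rw [show 2 - p = 1 + (1 - p) by ring, Real.rpow_add hn0, Real.rpow_one]
        ring

/-- `2 * J_c` is the first moment of the line kernel: this is the value of `J` at which an isolated
wall has no energy. -/
lemma two_mul_Jc {p : ℝ} (hp : 3 < p) : 2 * Jc p = ∑' n : ℕ, (n : ℝ) * lineKernel p n := by
  have h1 : Jc p = ∑' y : ℤ × ℤ, Set.indicator {y : ℤ × ℤ | 0 < y.1}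
      (fun y => (y.1 : ℝ) * kernel p y) y := by
    rw [← tsum_subtype]
    unfold Jc
    refine tsum_congr fun y => ?_
    have hy : 0 < y.1.1 := y.2
    have hne : y.1 ≠ 0 := fun h => by rw [h] at hy; simp at hy
    rw [kernel, if_neg hne, Real.sqrt_eq_rpow, ← Real.rpow_mul (by positivity)]
    rw [show 1 / 2 * p = p / 2 by ring, mul_one_div]
  have hs : Summable (Set.indicator {y : ℤ × ℤ | 0 < y.1}
      (fun y => (y.1 : ℝ) * kernel p y)) := by
    refine Summable.of_nonneg_of_le (fun y => ?_) (fun y => ?_) (summable_fst_mul_kernel hp)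
    · refine Set.indicator_nonneg (fun y hy => ?_) y
      have : (0 : ℝ) < y.1 := by exact_mod_cast hy
      exact mul_nonneg this.le (kernel_nonneg _ _)
    · rw [Set.indicator_apply]
      split_ifs
      · exact mul_le_mul_of_nonneg_right (le_abs_self _) (kernel_nonneg _ _)
      · exact mul_nonneg (abs_nonneg _) (kernel_nonneg _ _)
  rw [h1, hs.tsum_prod, ← tsum_mul_left]
  have hinj : Function.Injective (fun n : ℕ => (n : ℤ)) := Nat.cast_injective
  rw [← hinj.tsum_eq (f := fun a : ℤ => 2 * ∑' b : ℤ, Set.indicator {y : ℤ × ℤ | 0 < y.1}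
      (fun y => (y.1 : ℝ) * kernel p y) (a, b))]
  · refine tsum_congr fun n => ?_
    rcases Nat.eq_zero_or_pos n with rfl | hn
    · simp
    · have : ∀ m : ℤ, Set.indicator {y : ℤ × ℤ | 0 < y.1}
          (fun y => (y.1 : ℝ) * kernel p y) ((n : ℤ), m) = (n : ℝ) * kernel p (n, m) := by
        intro m
        have hmem : ((n : ℤ), m) ∈ {y : ℤ × ℤ | 0 < y.1} := by
          show (0 : ℤ) < n
          exact_mod_cast hn
        rw [Set.indicator_of_mem hmem]
        simp
      simp only [this, tsum_mul_left, lineKernel]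
      ring
  · intro a ha
    by_contra hcon
    apply ha
    have ha0 : ¬ 0 < a := fun h => hcon ⟨a.toNat, by simp [h.le]⟩
    have : ∀ m : ℤ, Set.indicator {y : ℤ × ℤ | 0 < y.1}
        (fun y => (y.1 : ℝ) * kernel p y) (a, m) = 0 := fun m =>
      Set.indicator_of_notMem (s := {y : ℤ × ℤ | 0 < y.1}) ha0 _
    simp [this]

/-! ### Complete monotonicity of the line kernel -/

lemma integral_prod_gammaWeight_cos {p : ℝ} (hp : 0 < p) {n : ℕ} (hn : 1 ≤ n) (m : ℤ) :
    Integrable (fun x : ℝ × ℝ => Real.exp (-(n * (x.1 + x.2))) * Real.cos (m * (x.1 - x.2)))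
      ((gammaWeight (p / 2)).prod (gammaWeight (p / 2))) ∧
    ∫ x : ℝ × ℝ, Real.exp (-(n * (x.1 + x.2))) * Real.cos (m * (x.1 - x.2))
      ∂((gammaWeight (p / 2)).prod (gammaWeight (p / 2))) =
      Real.Gamma (p / 2) ^ 2 * kernel p (n, m) := by
  obtain ⟨h1, h2⟩ := integral_prod_gammaWeight hp (n := (n : ℝ)) (by exact_mod_cast hn) (m : ℝ)
  have hre : ∀ x : ℝ × ℝ, ((Real.exp (-(n * (x.1 + x.2))) : ℂ) *
      Complex.exp (-((m : ℝ) * (x.1 - x.2) : ℝ) * Complex.I)).re =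
      Real.exp (-(n * (x.1 + x.2))) * Real.cos (m * (x.1 - x.2)) := by
    intro x
    rw [Complex.re_ofReal_mul, ← Complex.ofReal_neg, Complex.exp_ofReal_mul_I_re, Real.cos_neg]
  have hk : kernel p (n, m) = 1 / Real.sqrt ((n : ℝ) ^ 2 + (m : ℝ) ^ 2) ^ p := by
    rw [kernel, if_neg]
    · simp
    · simp only [Prod.mk_eq_zero, not_and_or]; left; exact_mod_cast (by omega : n ≠ 0)
  constructor
  · exact h1.re.congr (ae_of_all _ hre)
  · rw [← integral_congr_ae (ae_of_all _ hre)]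
    have := integral_re h1
    simp only [RCLike.re_to_complex] at this
    rw [this, h2, hk]
    exact Complex.ofReal_re _

lemma ae_gammaWeight_prod_pos (a : ℝ) :
    ∀ᵐ x : ℝ × ℝ ∂((gammaWeight a).prod (gammaWeight a)), 0 < x.1 + x.2 := by
  have h : ∀ᵐ t ∂(gammaWeight a), 0 < t := by
    unfold gammaWeight
    exact (withDensity_absolutelyContinuous _ _).ae_le (ae_restrict_mem measurableSet_Ioi)
  filter_upwards [Measure.quasiMeasurePreserving_fst.ae h,
    Measure.quasiMeasurePreserving_snd.ae h] with x h1 h2 using add_pos h1 h2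

lemma sum_sum_cos (M : ℕ) (θ : ℝ) :
    ∑ i ∈ Finset.range M, ∑ j ∈ Finset.range M, Real.cos ((((i : ℤ) - j : ℤ) : ℝ) * θ) =
      (∑ i ∈ Finset.range M, Real.cos (i * θ)) ^ 2 +
        (∑ i ∈ Finset.range M, Real.sin (i * θ)) ^ 2 := by
  rw [sq, sq, Finset.sum_mul_sum, Finset.sum_mul_sum, ← Finset.sum_add_distrib]
  refine Finset.sum_congr rfl fun i _ => ?_
  rw [← Finset.sum_add_distrib]
  refine Finset.sum_congr rfl fun j _ => ?_
  push_cast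
  rw [sub_mul, Real.cos_sub]

/-- Fejér averages of a summable function on `ℤ` converge to its sum. -/
lemma tendsto_fejer {f : ℤ → ℝ} (hf : Summable f) :
    Tendsto (fun M : ℕ => (M : ℝ)⁻¹ *
      ∑ i ∈ Finset.range M, ∑ j ∈ Finset.range M, f ((i : ℤ) - j)) atTop (𝓝 (∑' d, f d)) := by
  have hmono : Monotone fun k : ℕ => Finset.Icc (-(k : ℤ)) k := by
    intro a b hab
    refine Finset.Icc_subset_Icc ?_ ?_ <;> simpa using hab
  have hlim : Tendsto (fun k : ℕ => ∑ d ∈ Finset.Icc (-(k : ℤ)) k, f d) atTop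
      (𝓝 (∑' d, f d)) := by
    refine hf.hasSum.comp (tendsto_atTop_finset_of_monotone hmono fun d => ⟨d.natAbs, ?_⟩)
    rw [Finset.mem_Icc]; omega
  have hsum : ∀ M : ℕ, ∑ i ∈ Finset.range M, ∑ j ∈ Finset.range M, f ((i : ℤ) - j) =
      ∑ k ∈ Finset.range M, ∑ d ∈ Finset.Icc (-(k : ℤ)) k, f d := by
    intro M
    induction M with
    | zero => simp
    | succ M ih =>
      rw [Finset.sum_range_succ (fun i : ℕ => ∑ j ∈ Finset.range (M + 1), f ((i : ℤ) - j)) M,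
        Finset.sum_range_succ (fun k : ℕ => ∑ d ∈ Finset.Icc (-(k : ℤ)) k, f d) M, ← ih]
      simp only [Finset.sum_range_succ _ M, Finset.sum_add_distrib]
      have hsplit : Finset.Icc (-(M : ℤ)) M = Finset.Ico (-(M : ℤ)) 0 ∪ Finset.Icc (0 : ℤ) M := by
        ext d; simp only [Finset.mem_Icc, Finset.mem_union, Finset.mem_Ico]; omega
      have hdisj : Disjoint (Finset.Ico (-(M : ℤ)) 0) (Finset.Icc (0 : ℤ) M) := by
        rw [Finset.disjoint_left]; intro d; simp only [Finset.mem_Ico, Finset.mem_Icc]; omega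
      rw [hsplit, Finset.sum_union hdisj]
      have e1 : ∑ d ∈ Finset.Ico (-(M : ℤ)) 0, f d = ∑ i ∈ Finset.range M, f ((i : ℤ) - M) := by
        symm
        refine Finset.sum_bij (fun i _ => (i : ℤ) - M) ?_ ?_ ?_ ?_
        · intro i hi; simp only [Finset.mem_range, Finset.mem_Ico] at *; omega
        · intro i _ j _ h; simpa using h
        · intro d hd
          simp only [Finset.mem_Ico] at hd
          exact ⟨(d + M).toNat, by simp only [Finset.mem_range]; omega, by omega⟩
        · intro i _; rfl
      have e2 : ∑ d ∈ Finset.Icc (0 : ℤ) M, f d =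
          ∑ j ∈ Finset.range (M + 1), f ((M : ℤ) - j) := by
        symm
        refine Finset.sum_bij (fun i _ => (M : ℤ) - i) ?_ ?_ ?_ ?_
        · intro i hi; simp only [Finset.mem_range, Finset.mem_Icc] at *; omega
        · intro i _ j _ h; simpa using h
        · intro d hd
          simp only [Finset.mem_Icc] at hd
          exact ⟨(M - d).toNat, by simp only [Finset.mem_range]; omega, by omega⟩
        · intro i _; rfl
      rw [e1, e2, Finset.sum_range_succ _ M]
      ring
  simp only [hsum]
  exact hlim.cesaro

lemma fejer_le {f : ℤ → ℝ} (hf : Summable f) (h0 : ∀ d, 0 ≤ f d) (M : ℕ) :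
    (M : ℝ)⁻¹ * ∑ i ∈ Finset.range M, ∑ j ∈ Finset.range M, f ((i : ℤ) - j) ≤ ∑' d, f d := by
  have hrow : ∀ i ∈ Finset.range M, ∑ j ∈ Finset.range M, f ((i : ℤ) - j) ≤ ∑' d, f d := by
    intro i _
    have hinj : Function.Injective fun j : ℕ => (i : ℤ) - j := by
      intro a b h; simpa using h
    rw [← Finset.sum_image (f := f) (g := fun j : ℕ => (i : ℤ) - j) (hinj.injOn)]
    exact hf.sum_le_tsum _ fun _ _ => h0 _
  have h := Finset.sum_le_sum hrow
  rw [Finset.sum_const, Finset.card_range, nsmul_eq_mul] at h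
  rcases Nat.eq_zero_or_pos M with rfl | hM
  · simpa using tsum_nonneg h0
  · have hM' : (0 : ℝ) < M := by exact_mod_cast hM
    rw [inv_mul_le_iff₀ hM']
    exact h

/-- Positivity of power series coefficients against the Fejér averages of the kernel. -/
lemma tsum_mul_fejer_nonneg {p : ℝ} (hp : 3 < p) {c : ℕ → ℝ} {C : ℝ}
    (hc : ∀ n, |c n| ≤ C * n) (hpos : ∀ x : ℝ, 0 < x → x < 1 → 0 ≤ ∑' n, c n * x ^ n) (M : ℕ) :
    0 ≤ ∑' n : ℕ, c n *
      ∑ i ∈ Finset.range M, ∑ j ∈ Finset.range M, kernel p (n, (i : ℤ) - j) := by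
  set μ := (gammaWeight (p / 2)).prod (gammaWeight (p / 2))
  set Q : ℝ × ℝ → ℝ := fun x => ∑ i ∈ Finset.range M, ∑ j ∈ Finset.range M,
    Real.cos ((((i : ℤ) - j : ℤ) : ℝ) * (x.1 - x.2)) with hQ
  set W : ℕ → ℝ := fun n => ∑ i ∈ Finset.range M, ∑ j ∈ Finset.range M,
    kernel p (n, (i : ℤ) - j) with hW
  have hQ0 : ∀ x, 0 ≤ Q x := fun x => by
    simp only [hQ]; rw [sum_sum_cos]; positivity
  have hc0 : c 0 = 0 := by simpa using hc 0
  have hp0 : 0 < p := by linarith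
  have hexp : ∀ n : ℕ, 1 ≤ n →
      Integrable (fun x : ℝ × ℝ => Real.exp (-(n * (x.1 + x.2))) * Q x) μ ∧
      ∫ x, Real.exp (-(n * (x.1 + x.2))) * Q x ∂μ = Real.Gamma (p / 2) ^ 2 * W n := by
    intro n hn
    have heq : (fun x : ℝ × ℝ => Real.exp (-(n * (x.1 + x.2))) * Q x) =
        fun x => ∑ i ∈ Finset.range M, ∑ j ∈ Finset.range M, Real.exp (-(n * (x.1 + x.2))) *
          Real.cos ((((i : ℤ) - j : ℤ) : ℝ) * (x.1 - x.2)) := by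
      funext x
      simp only [hQ, Finset.mul_sum]
    rw [heq]
    have hint : ∀ i j : ℕ, Integrable (fun x : ℝ × ℝ => Real.exp (-(n * (x.1 + x.2))) *
        Real.cos ((((i : ℤ) - j : ℤ) : ℝ) * (x.1 - x.2))) μ := fun i j =>
      (integral_prod_gammaWeight_cos hp0 hn _).1
    refine ⟨integrable_finsetSum _ fun i _ => integrable_finsetSum _ fun j _ => hint i j, ?_⟩
    rw [integral_finsetSum _ fun i _ => integrable_finsetSum _ fun j _ => hint i j]
    simp only [hW, Finset.mul_sum]
    refine Finset.sum_congr rfl fun i _ => ?_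
    rw [integral_finsetSum _ fun j _ => hint i j]
    refine Finset.sum_congr rfl fun j _ => ?_
    exact (integral_prod_gammaWeight_cos hp0 hn _).2
  set F : ℕ → ℝ × ℝ → ℝ := fun n x => c n * (Real.exp (-(n * (x.1 + x.2))) * Q x) with hF
  have hFint : ∀ n, Integrable (F n) μ := by
    intro n
    rcases Nat.eq_zero_or_pos n with rfl | hn
    · simp [hF, hc0]
    · exact (hexp n hn).1.const_mul _
  have hFval : ∀ n, ∫ x, F n x ∂μ = Real.Gamma (p / 2) ^ 2 * (c n * W n) := by
    intro n
    rcases Nat.eq_zero_or_pos n with rfl | hn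
    · simp [hF, hc0]
    · simp only [hF]
      rw [integral_const_mul, (hexp n hn).2]
      ring
  have hWnn : ∀ n, 0 ≤ W n := fun n =>
    Finset.sum_nonneg fun _ _ => Finset.sum_nonneg fun _ _ => kernel_nonneg _ _
  have hFnorm : ∀ n, ∫ x, ‖F n x‖ ∂μ = Real.Gamma (p / 2) ^ 2 * (|c n| * W n) := by
    intro n
    rcases Nat.eq_zero_or_pos n with rfl | hn
    · simp [hF, hc0]
    · have : ∀ x, ‖F n x‖ = |c n| * (Real.exp (-(n * (x.1 + x.2))) * Q x) := by
        intro x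
        simp only [hF]
        rw [norm_mul, Real.norm_eq_abs, Real.norm_eq_abs,
          abs_of_nonneg (mul_nonneg (Real.exp_pos _).le (hQ0 x))]
      simp only [this]
      rw [integral_const_mul, (hexp n hn).2]
      ring
  have hWle : ∀ n : ℕ, W n ≤ M * lineKernel p n := by
    intro n
    have h := fejer_le (summable_kernel_line (by linarith : 2 ≤ p) n)
      (fun d => kernel_nonneg p (n, d)) M
    have h0 : 0 ≤ ∑' d : ℤ, kernel p (n, d) := tsum_nonneg fun d => kernel_nonneg _ _
    rcases Nat.eq_zero_or_pos M with rfl | hM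
    · simp [hW]
    · have hM' : (0 : ℝ) < M := by exact_mod_cast hM
      rw [inv_mul_le_iff₀ hM'] at h
      refine h.trans ?_
      unfold lineKernel
      nlinarith
  have hC : 0 ≤ C := by
    have := (abs_nonneg _).trans (hc 1)
    simpa using this
  have hsumm : Summable fun n => ∫ x, ‖F n x‖ ∂μ := by
    simp only [hFnorm]
    refine Summable.mul_left _ ?_
    refine Summable.of_nonneg_of_le (fun n => mul_nonneg (abs_nonneg _) (hWnn n)) (fun n => ?_)
      ((summable_natMul_lineKernel hp).mul_left (C * M))
    calc |c n| * W n ≤ (C * n) * (M * lineKernel p n) :=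
          mul_le_mul (hc n) (hWle n) (hWnn n) (by positivity)
      _ = _ := by ring
  have hhas := hasSum_integral_of_summable_integral_norm hFint hsumm
  have hint0 : 0 ≤ ∫ x, ∑' n, F n x ∂μ := by
    refine integral_nonneg_of_ae ?_
    filter_upwards [ae_gammaWeight_prod_pos (p / 2)] with x hx
    have : ∀ n, F n x = (c n * (Real.exp (-(x.1 + x.2))) ^ n) * Q x := by
      intro n
      simp only [hF]
      rw [← Real.exp_nat_mul]
      ring_nf
    simp only [this, Pi.zero_apply]
    rw [tsum_mul_right]
    refine mul_nonneg (hpos _ (Real.exp_pos _) ?_) (hQ0 x)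
    rw [Real.exp_lt_one_iff]
    linarith
  rw [← hhas.tsum_eq] at hint0
  simp only [hFval] at hint0
  rw [tsum_mul_left] at hint0
  have hG : 0 < Real.Gamma (p / 2) ^ 2 := pow_pos (Real.Gamma_pos_of_pos (by linarith)) 2
  exact nonneg_of_mul_nonneg_right hint0 hG

/-- The line kernel is completely monotone: a linear combination of its values is nonnegative as
soon as the same combination of the powers `x ^ n` is nonnegative for all `x ∈ (0, 1)`. -/
theorem tsum_mul_lineKernel_nonneg {p : ℝ} (hp : 3 < p) {c : ℕ → ℝ} {C : ℝ}
    (hc : ∀ n, |c n| ≤ C * n) (hpos : ∀ x : ℝ, 0 < x → x < 1 → 0 ≤ ∑' n, c n * x ^ n) :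
    0 ≤ ∑' n : ℕ, c n * lineKernel p n := by
  have hC : 0 ≤ C := by
    have := (abs_nonneg _).trans (hc 1)
    simpa using this
  have hline : ∀ n : ℕ, Summable fun d : ℤ => kernel p (n, d) := fun n =>
    summable_kernel_line (by linarith) n
  have key : Tendsto (fun M : ℕ => ∑' n : ℕ, c n * ((M : ℝ)⁻¹ *
      ∑ i ∈ Finset.range M, ∑ j ∈ Finset.range M, kernel p (n, (i : ℤ) - j))) atTop
      (𝓝 (∑' n : ℕ, c n * ∑' d : ℤ, kernel p (n, d))) := by
    refine tendsto_tsum_of_dominated_convergence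
      (bound := fun n : ℕ => C * (n * lineKernel p n))
      ((summable_natMul_lineKernel hp).mul_left C) (fun n => ?_) (Eventually.of_forall fun M n => ?_)
    · exact (tendsto_fejer (hline n)).const_mul _
    · have h1 := fejer_le (hline n) (fun d => kernel_nonneg p (n, d)) M
      have h0 : 0 ≤ ∑' d : ℤ, kernel p (n, d) := tsum_nonneg fun d => kernel_nonneg _ _
      have h2 : 0 ≤ (M : ℝ)⁻¹ * ∑ i ∈ Finset.range M, ∑ j ∈ Finset.range M,
          kernel p (n, (i : ℤ) - j) := mul_nonneg (by positivity)
        (Finset.sum_nonneg fun _ _ => Finset.sum_nonneg fun _ _ => kernel_nonneg _ _)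
      rw [norm_mul, Real.norm_eq_abs, Real.norm_eq_abs, abs_of_nonneg h2]
      calc _ ≤ (C * n) * lineKernel p n := by
            refine mul_le_mul (hc n) (h1.trans ?_) h2 (by positivity)
            unfold lineKernel; linarith
        _ = _ := by ring
  have hnn : 0 ≤ ∑' n : ℕ, c n * ∑' d : ℤ, kernel p (n, d) := by
    refine ge_of_tendsto' key fun M => ?_
    have : ∀ n : ℕ, c n * ((M : ℝ)⁻¹ *
        ∑ i ∈ Finset.range M, ∑ j ∈ Finset.range M, kernel p (n, (i : ℤ) - j)) =
        (M : ℝ)⁻¹ * (c n *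
          ∑ i ∈ Finset.range M, ∑ j ∈ Finset.range M, kernel p (n, (i : ℤ) - j)) := by
      intro n; ring
    simp only [this]
    rw [tsum_mul_left]
    exact mul_nonneg (by positivity) (tsum_mul_fejer_nonneg hp hc hpos M)
  have : ∀ n : ℕ, c n * lineKernel p n = 2 * (c n * ∑' d : ℤ, kernel p (n, d)) := by
    intro n; unfold lineKernel; ring
  simp only [this]
  rw [tsum_mul_left]
  linarith

end

/-! ### One-dimensional configurations: runs, kinks and one-sided fields -/

/-- Indicator of the event that `σ` takes different values at `x` and `y`. -/
def differ {α : Type*} (σ : α → ℤˣ) (x y : α) : ℝ := if σ x = σ y then 0 else 1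

/-- The maximal interval around `i` on which the one-dimensional configuration `σ` is constant. -/
def run (σ : ℤ → ℤˣ) (i : ℤ) : Set ℤ := {j | ∀ k ∈ Set.uIcc i j, σ k = σ i}

/-- The length of the run of `σ` through `i`. An infinite run has width `0`: with this convention
the inverse width and the stripe energy at an infinite width vanish, as they should. -/
noncomputable def width (σ : ℤ → ℤˣ) (i : ℤ) : ℕ := (run σ i).ncard

/-- A change of `σ` between `a - 1` and `a`. -/
def IsKink (σ : ℤ → ℤˣ) (a : ℤ) : Prop := σ (a - 1) ≠ σ a

section differ

variable {α : Type*} (σ : α → ℤˣ) (x y z : α)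

lemma differ_nonneg : 0 ≤ differ σ x y := by unfold differ; split_ifs <;> norm_num

lemma differ_le_one : differ σ x y ≤ 1 := by unfold differ; split_ifs <;> norm_num

lemma differ_self : differ σ x x = 0 := by simp [differ]

lemma differ_comm : differ σ x y = differ σ y x := by unfold differ; simp only [eq_comm]

variable {σ x y}

lemma differ_of_eq (h : σ x = σ y) : differ σ x z = differ σ y z := by
  unfold differ; rw [h]

lemma differ_of_ne (h : σ x ≠ σ y) : differ σ x z = 1 - differ σ y z := by
  unfold differ
  rcases Int.units_eq_one_or (σ x) with hx | hx <;> rcases Int.units_eq_one_or (σ y) with hy | hy <;>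
    rcases Int.units_eq_one_or (σ z) with hz | hz <;> simp_all

variable (σ x y)

/-- A path with an intermediate point counts a change along both legs twice too often. -/
lemma differ_eq_add : differ σ x y =
    differ σ x z + differ σ z y - 2 * (differ σ x z * differ σ z y) := by
  by_cases h : σ x = σ z
  · rw [differ_of_eq y h, differ_of_eq z h, differ_self]; ring
  · rw [differ_of_ne y h, differ_of_ne z h, differ_self]; ring

lemma differ_triangle : differ σ x y ≤ differ σ x z + differ σ z y := by
  have := mul_nonneg (differ_nonneg σ x z) (differ_nonneg σ z y)
  rw [differ_eq_add σ x y z]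
  linarith

end differ

lemma sum_Ico_add (f : ℤ → ℝ) {a b c : ℤ} (hab : a ≤ b) (hbc : b ≤ c) :
    ∑ i ∈ Finset.Ico a b, f i + ∑ i ∈ Finset.Ico b c, f i = ∑ i ∈ Finset.Ico a c, f i := by
  rw [← Finset.sum_union (Finset.Ico_disjoint_Ico_consecutive a b c),
    Finset.Ico_union_Ico_eq_Ico hab hbc]

lemma mem_run_self (σ : ℤ → ℤˣ) (i : ℤ) : i ∈ run σ i := by
  intro k hk
  simp only [Set.uIcc_self, Set.mem_singleton_iff] at hk
  rw [hk]

lemma run_eq_of_mem {σ : ℤ → ℤˣ} {i j : ℤ} (h : j ∈ run σ i) : run σ j = run σ i := by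
  have hij : σ j = σ i := h j Set.right_mem_uIcc
  ext k
  constructor
  · intro hk l hl
    rcases Set.uIcc_subset_uIcc_union_uIcc (b := j) hl with h1 | h1
    · exact h l h1
    · rw [hk l h1, hij]
  · intro hk l hl
    rcases Set.uIcc_subset_uIcc_union_uIcc (b := i) hl with h1 | h1
    · rw [Set.uIcc_comm] at h1
      rw [h l h1, hij]
    · rw [hk l h1, hij]

lemma width_eq_of_mem {σ : ℤ → ℤˣ} {i j : ℤ} (h : j ∈ run σ i) : width σ j = width σ i := by
  unfold width; rw [run_eq_of_mem h]

lemma succ_mem_run {σ : ℤ → ℤˣ} {i : ℤ} (h : σ (i + 1) = σ i) : i + 1 ∈ run σ i := by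
  intro k hk
  rw [Set.uIcc_of_le (by omega), Set.mem_Icc] at hk
  rcases (by omega : k = i ∨ k = i + 1) with rfl | rfl
  · rfl
  · exact h

lemma mem_run_of_Icc {σ : ℤ → ℤˣ} {i j a b : ℤ} {u : ℤˣ} (hi : i ∈ Set.Icc a b)
    (hj : j ∈ Set.Icc a b) (h : ∀ k ∈ Set.Icc a b, σ k = u) : j ∈ run σ i := fun k hk => by
  rw [h i hi, h k (Set.uIcc_subset_Icc hi hj hk)]

lemma run_subset_Ici {σ : ℤ → ℤˣ} {i a : ℤ} (ha : IsKink σ a) (hi : a ≤ i) :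
    run σ i ⊆ Set.Ici a := by
  intro j hj
  by_contra hcon
  simp only [Set.mem_Ici, not_le] at hcon
  apply ha
  have h1 := hj a (by rw [Set.mem_uIcc]; omega)
  have h2 := hj (a - 1) (by rw [Set.mem_uIcc]; omega)
  rw [h1, h2]

lemma run_subset_Iio {σ : ℤ → ℤˣ} {i e : ℤ} (he : IsKink σ e) (hi : i < e) :
    run σ i ⊆ Set.Iio e := by
  intro j hj
  by_contra hcon
  simp only [Set.mem_Iio, not_lt] at hcon
  apply he
  have h1 := hj e (by rw [Set.mem_uIcc]; omega)
  have h2 := hj (e - 1) (by rw [Set.mem_uIcc]; omega)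
  rw [h1, h2]

lemma run_eq_Ico {σ : ℤ → ℤˣ} {i a e : ℤ} {u : ℤˣ} (ha : IsKink σ a) (he : IsKink σ e)
    (hi : i ∈ Set.Ico a e) (h : ∀ k ∈ Set.Ico a e, σ k = u) : run σ i = Set.Ico a e := by
  apply Set.Subset.antisymm
  · intro j hj
    exact ⟨run_subset_Ici ha hi.1 hj, run_subset_Iio he hi.2 hj⟩
  · intro j hj
    refine mem_run_of_Icc (a := a) (b := e - 1) (u := u) ⟨hi.1, by have := hi.2; omega⟩
      ⟨hj.1, by have := hj.2; omega⟩ fun k hk => h k ⟨hk.1, by have := hk.2; omega⟩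

lemma width_eq {σ : ℤ → ℤˣ} {i a e : ℤ} {u : ℤˣ} (ha : IsKink σ a) (he : IsKink σ e)
    (hi : i ∈ Set.Ico a e) (h : ∀ k ∈ Set.Ico a e, σ k = u) : width σ i = (e - a).toNat := by
  unfold width
  rw [run_eq_Ico ha he hi h, ← Finset.coe_Ico, Set.ncard_coe_finset, Int.card_Ico]

lemma width_eq_zero_of_infinite {σ : ℤ → ℤˣ} {i : ℤ} (h : (run σ i).Infinite) : width σ i = 0 :=
  h.ncard

lemma width_eq_zero_of_ge {σ : ℤ → ℤˣ} {i : ℤ} (h : ∀ j, i ≤ j → σ j = σ i) : width σ i = 0 := by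
  refine width_eq_zero_of_infinite ((Set.Ici_infinite i).mono fun j hj k hk => h k ?_)
  rw [Set.uIcc_of_le hj] at hk
  exact hk.1

lemma width_eq_zero_of_le {σ : ℤ → ℤˣ} {i : ℤ} (h : ∀ j, j ≤ i → σ j = σ i) : width σ i = 0 := by
  refine width_eq_zero_of_infinite ((Set.Iic_infinite i).mono fun j hj k hk => h k ?_)
  rw [Set.uIcc_of_ge hj] at hk
  exact hk.2

/-- Induction over the runs of `σ` between two kinks, from right to left. -/
lemma kink_induction {σ : ℤ → ℤˣ} {b : ℤ} (hb : IsKink σ b) {motive : ℤ → Prop} (base : motive b)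
    (step : ∀ (a : ℤ) (h : ℕ), 0 < h → a + h ≤ b → IsKink σ a → IsKink σ (a + h) →
      (∀ i ∈ Set.Ico a (a + h), σ i = σ a) → motive (a + h) → motive a) :
    ∀ a ≤ b, IsKink σ a → motive a := by
  suffices H : ∀ (N : ℕ) (a : ℤ), a ≤ b → (b - a).toNat = N → IsKink σ a → motive a from
    fun a hab ha => H _ a hab rfl ha
  intro N
  induction N using Nat.strong_induction_on with
  | _ N ih =>
    intro a hab hN ha
    rcases hab.eq_or_lt with rfl | hlt
    · exact base
    classical
    have hex : ∃ k : ℕ, 0 < k ∧ IsKink σ (a + k) :=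
      ⟨(b - a).toNat, by omega, by rw [show a + ((b - a).toNat : ℤ) = b by omega]; exact hb⟩
    set k := Nat.find hex with hk
    obtain ⟨hk0, hkk⟩ := Nat.find_spec hex
    have hmin : ∀ m : ℕ, 0 < m → m < k → ¬ IsKink σ (a + m) := fun m hm hmk hcon =>
      Nat.find_min hex hmk ⟨hm, hcon⟩
    have hkb : a + (k : ℤ) ≤ b := by
      have := Nat.find_min' hex (m := (b - a).toNat)
        ⟨by omega, by rw [show a + ((b - a).toNat : ℤ) = b by omega]; exact hb⟩
      omega
    have hconst : ∀ m : ℕ, m < k → σ (a + m) = σ a := by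
      intro m
      induction m with
      | zero => simp
      | succ m ihm =>
        intro hm
        have h1 := hmin (m + 1) (by omega) hm
        unfold IsKink at h1
        push Not at h1
        rw [← h1, ← ihm (by omega)]
        congr 1; push_cast; ring
    refine step a k hk0 hkb ha hkk ?_ (ih _ ?_ (a + k) hkb rfl hkk)
    · intro i hi
      have := hconst (i - a).toNat (by have := hi.1; have := hi.2; omega)
      rwa [show a + ((i - a).toNat : ℤ) = i by have := hi.1; omega] at this
    · omega

lemma sum_inv_width {σ : ℤ → ℤˣ} {a b : ℤ} (ha : IsKink σ a) (hb : IsKink σ b) (hab : a ≤ b) :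
    ∑ i ∈ Finset.Ico a b, (1 : ℝ) / width σ i = ∑ i ∈ Finset.Ico a b, differ σ (i - 1) i := by
  refine kink_induction hb (motive := fun a => ∑ i ∈ Finset.Ico a b, (1 : ℝ) / width σ i =
    ∑ i ∈ Finset.Ico a b, differ σ (i - 1) i) (by simp) ?_ a hab ha
  intro a h h0 hle ha he hconst ih
  rw [← sum_Ico_add _ (by omega : a ≤ a + h) hle,
    ← sum_Ico_add _ (by omega : a ≤ a + h) hle, ih]
  congr 1
  have h1 : ∑ i ∈ Finset.Ico a (a + h), (1 : ℝ) / width σ i = 1 := by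
    rw [Finset.sum_congr rfl (g := fun _ => (1 : ℝ) / h)]
    · rw [Finset.sum_const, Int.card_Ico, add_sub_cancel_left, Int.toNat_natCast, nsmul_eq_mul]
      field_simp
    · intro i hi
      rw [width_eq ha he (by simpa using hi) hconst, add_sub_cancel_left, Int.toNat_natCast]
  have h2 : ∑ i ∈ Finset.Ico a (a + h), differ σ (i - 1) i = 1 := by
    rw [Finset.sum_eq_single a]
    · unfold differ; rw [if_neg ha]
    · intro i hi hne
      rw [Finset.mem_Ico] at hi
      unfold differ
      rw [if_pos]
      rw [hconst i ⟨hi.1, hi.2⟩, hconst (i - 1) ⟨by omega, by omega⟩]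
    · intro hcon
      exact absurd (Finset.mem_Ico.2 ⟨le_rfl, by omega⟩) hcon
  rw [h1, h2]

/-- The field `∑ xⁿ 1(σ_i ≠ σ_{i+n})` of the sites to the right of `i` for an exponential
interaction. -/
noncomputable def field (x : ℝ) (σ : ℤ → ℤˣ) (i : ℤ) : ℝ := ∑' n : ℕ, x ^ n * differ σ i (i + n)

lemma summable_field {x : ℝ} (hx0 : 0 < x) (hx1 : x < 1)
    (σ : ℤ → ℤˣ) (i j : ℤ) :
    Summable fun n : ℕ => x ^ n * differ σ i (j + n) := by
  refine Summable.of_nonneg_of_le (fun n => mul_nonneg (by positivity) (differ_nonneg _ _ _))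
    (fun n => ?_) (summable_geometric_of_lt_one hx0.le hx1)
  exact mul_le_of_le_one_right (by positivity) (differ_le_one _ _ _)

lemma field_nonneg {x : ℝ} (hx0 : 0 < x) (σ : ℤ → ℤˣ) (i : ℤ) : 0 ≤ field x σ i :=
  tsum_nonneg fun n => mul_nonneg (by positivity) (differ_nonneg _ _ _)

lemma field_le {x : ℝ} (hx0 : 0 < x) (hx1 : x < 1)
    (σ : ℤ → ℤˣ) (i : ℤ) : field x σ i ≤ (1 - x)⁻¹ := by
  rw [← tsum_geometric_of_lt_one hx0.le hx1]
  refine (summable_field hx0 hx1 σ i i).tsum_le_tsum (fun n => ?_)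
    (summable_geometric_of_lt_one hx0.le hx1)
  exact mul_le_of_le_one_right (by positivity) (differ_le_one _ _ _)

lemma field_eq_tsum_succ {x : ℝ} (hx0 : 0 < x) (hx1 : x < 1)
    (σ : ℤ → ℤˣ) (i : ℤ) :
    field x σ i = x * ∑' n : ℕ, x ^ n * differ σ i (i + 1 + n) := by
  unfold field
  rw [(summable_field hx0 hx1 σ i i).tsum_eq_zero_add, ← tsum_mul_left]
  simp only [Nat.cast_zero, add_zero, differ_self, mul_zero, zero_add]
  refine tsum_congr fun n => ?_
  rw [show i + ((n + 1 : ℕ) : ℤ) = i + 1 + n by push_cast; ring]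
  ring

lemma field_of_eq {x : ℝ} (hx0 : 0 < x) (hx1 : x < 1)
    {σ : ℤ → ℤˣ} {i : ℤ} (h : σ i = σ (i + 1)) :
    field x σ i = x * field x σ (i + 1) := by
  rw [field_eq_tsum_succ hx0 hx1]
  simp only [differ_of_eq _ h]
  rfl

lemma field_of_ne {x : ℝ} (hx0 : 0 < x) (hx1 : x < 1)
    {σ : ℤ → ℤˣ} {i : ℤ} (h : σ i ≠ σ (i + 1)) :
    field x σ i = x * ((1 - x)⁻¹ - field x σ (i + 1)) := by
  rw [field_eq_tsum_succ hx0 hx1, ← tsum_geometric_of_lt_one hx0.le hx1]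
  unfold field
  rw [← (summable_geometric_of_lt_one hx0.le hx1).tsum_sub
    (summable_field hx0 hx1 σ (i + 1) (i + 1))]
  congr 1
  refine tsum_congr fun n => ?_
  rw [differ_of_ne _ h]
  ring

/-- The fields in a run that ends at the kink `e`. -/
lemma field_run {x : ℝ} (hx0 : 0 < x) (hx1 : x < 1)
    {σ : ℤ → ℤˣ} {e : ℤ} (he : IsKink σ e) (h : ℕ)
    (hconst : ∀ i ∈ Set.Ico (e - h) e, σ i = σ (e - 1)) :
    (0 < h → field x σ (e - h) = x ^ h * ((1 - x)⁻¹ - field x σ e)) ∧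
    ∑ i ∈ Finset.Ico (e - h) e, field x σ i =
      x * (1 - x ^ h) * (1 - x)⁻¹ * ((1 - x)⁻¹ - field x σ e) := by
  induction h with
  | zero => simp
  | succ h ih =>
    have hc : ∀ i ∈ Set.Ico (e - h) e, σ i = σ (e - 1) := fun i hi =>
      hconst i ⟨by have := hi.1; push_cast; omega, hi.2⟩
    obtain ⟨ih1, ih2⟩ := ih hc
    have hval : field x σ (e - (h + 1 : ℕ)) = x ^ (h + 1) * ((1 - x)⁻¹ - field x σ e) := by
      have hs : e - ((h + 1 : ℕ) : ℤ) + 1 = e - h := by push_cast; ring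
      rcases Nat.eq_zero_or_pos h with rfl | hpos
      · have hk : σ (e - ((0 + 1 : ℕ) : ℤ)) ≠ σ (e - ((0 + 1 : ℕ) : ℤ) + 1) := by
          simpa [IsKink] using he
        rw [field_of_ne hx0 hx1 hk, hs]
        simp
      · have hk : σ (e - ((h + 1 : ℕ) : ℤ)) = σ (e - ((h + 1 : ℕ) : ℤ) + 1) := by
          rw [hs, hconst _ ⟨le_rfl, by push_cast; omega⟩, hc (e - h) ⟨le_rfl, by omega⟩]
        rw [field_of_eq hx0 hx1 hk, hs, ih1 hpos]
        ring
    refine ⟨fun _ => hval, ?_⟩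
    have hlt : e - ((h + 1 : ℕ) : ℤ) < e := by push_cast; omega
    rw [← sum_Ico_add _ (by push_cast; omega : e - ((h + 1 : ℕ) : ℤ) ≤ e - h)
      (by omega : e - (h : ℤ) ≤ e), ih2]
    have : Finset.Ico (e - ((h + 1 : ℕ) : ℤ)) (e - h) = {e - ((h + 1 : ℕ) : ℤ)} := by
      ext i; simp only [Finset.mem_Ico, Finset.mem_singleton]; push_cast; omega
    rw [this, Finset.sum_singleton, hval]
    have hne : 1 - x ≠ 0 := by linarith
    field_simp
    ring

/-- Mean field per site of the periodic configuration with stripes of width `h`; it vanishes at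
`h = 0`. -/
noncomputable def meanField (x : ℝ) (h : ℕ) : ℝ :=
  x * ((1 - x)⁻¹) ^ 2 * (1 - x ^ h) / (1 + x ^ h) / h

/-- The potential whose increments bound the defect of a run. -/
noncomputable def fieldPotential (x B : ℝ) : ℝ := x * B * ((1 - x)⁻¹ - B)

/-- Between two kinks the total field is at most the sum of the mean fields of periodic
configurations with the same local widths, up to a telescoping term. The defect of one run of width
`h` followed by the field `T - y` is `x (1 - x ^ h) / (1 + x ^ h) * (T - (1 + x ^ h) y) ^ 2`. -/
lemma sum_field_le {x : ℝ} (hx0 : 0 < x) (hx1 : x < 1)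
    {σ : ℤ → ℤˣ} {a b : ℤ} (ha : IsKink σ a) (hb : IsKink σ b) (hab : a ≤ b) :
    ∑ i ∈ Finset.Ico a b, field x σ i ≤ ∑ i ∈ Finset.Ico a b, meanField x (width σ i) +
      fieldPotential x (field x σ a) - fieldPotential x (field x σ b) := by
  refine kink_induction hb (motive := fun a => ∑ i ∈ Finset.Ico a b, field x σ i ≤
    ∑ i ∈ Finset.Ico a b, meanField x (width σ i) +
      fieldPotential x (field x σ a) - fieldPotential x (field x σ b)) (by simp) ?_ a hab ha
  intro a h h0 hle ha he hconst ih
  rw [← sum_Ico_add _ (by omega : a ≤ a + h) hle,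
    ← sum_Ico_add _ (by omega : a ≤ a + h) hle]
  have hG : ∑ i ∈ Finset.Ico a (a + h), meanField x (width σ i) =
      x * ((1 - x)⁻¹) ^ 2 * (1 - x ^ h) / (1 + x ^ h) := by
    rw [Finset.sum_congr rfl (g := fun _ => meanField x h)]
    · rw [Finset.sum_const, Int.card_Ico, add_sub_cancel_left, Int.toNat_natCast, nsmul_eq_mul]
      unfold meanField
      field_simp
    · intro i hi
      rw [width_eq ha he (by simpa using hi) hconst, add_sub_cancel_left, Int.toNat_natCast]
  have hlast : σ (a + h - 1) = σ a := hconst _ ⟨by omega, by omega⟩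
  obtain ⟨hB, hS⟩ := field_run hx0 hx1 he h (by
    intro i hi
    rw [add_sub_cancel_right] at hi
    rw [hlast, hconst i hi])
  rw [add_sub_cancel_right] at hB hS
  rw [hG, hS]
  specialize hB h0
  set T := (1 - x)⁻¹
  set B := field x σ (a + h)
  set q := x ^ h
  have hq0 : 0 < q := by positivity
  have hq1 : q ≤ 1 := pow_le_one₀ hx0.le hx1.le
  have hkey : x * T ^ 2 * (1 - q) / (1 + q) + fieldPotential x (field x σ a) - fieldPotential x B -
      x * (1 - q) * T * (T - B) = x * ((1 - q) / (1 + q)) * (T - (1 + q) * (T - B)) ^ 2 := by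
    rw [hB]
    unfold fieldPotential
    change x * T ^ 2 * (1 - q) / (1 + q) + x * (q * (T - B)) * (T - q * (T - B)) -
      x * B * (T - B) - x * (1 - q) * T * (T - B) = _
    field_simp
    ring
  have hnn : 0 ≤ x * ((1 - q) / (1 + q)) * (T - (1 + q) * (T - B)) ^ 2 := by
    have : 0 ≤ 1 - q := by linarith
    positivity
  linarith

/-! ### Periodic stripes in one dimension -/

/-- The one-dimensional profile of the striped configuration of width `h`. -/
def stripeRow (h : ℕ) : ℤ → ℤˣ := fun i => (i / (h : ℤ)).negOnePow

/-- The fraction of sites `i` of a row of the striped configuration of width `h` such that `i` and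
`i + n` carry different spins; it is `0` for `h = 0`. -/
noncomputable def stripeDensity (h : ℕ) (n : ℤ) : ℝ :=
  (1 / (2 * (h : ℝ))) * ∑ i ∈ Finset.range (2 * h), differ (stripeRow h) (i : ℤ) (i + n)

lemma stripeRow_add {h : ℕ} (hh : 1 ≤ h) (i : ℤ) : stripeRow h (i + h) = -stripeRow h i := by
  unfold stripeRow
  rw [Int.add_ediv_of_dvd_right (dvd_refl _), Int.ediv_self (by omega), Int.negOnePow_succ]

lemma differ_stripeRow_add {h : ℕ} (hh : 1 ≤ h) (i j : ℤ) :
    differ (stripeRow h) (i + h) (j + h) = differ (stripeRow h) i j := by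
  unfold differ
  simp only [stripeRow_add hh, neg_inj]

lemma stripeRow_const {h : ℕ} (k : ℤ) {i : ℤ}
    (hi : i ∈ Set.Ico (k * h) (k * h + h)) : stripeRow h i = stripeRow h (k * h) := by
  have hpos : (0 : ℤ) < h := by have := hi.1; have := hi.2; omega
  unfold stripeRow
  congr 1
  rw [Int.mul_ediv_cancel _ hpos.ne', Int.ediv_eq_iff_of_pos hpos]
  exact ⟨hi.1, by have := hi.2; linarith⟩

lemma isKink_stripeRow {h : ℕ} (hh : 1 ≤ h) (k : ℤ) : IsKink (stripeRow h) (k * h) := by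
  unfold IsKink
  have h1 : stripeRow h (k * h - 1) = stripeRow h ((k - 1) * h) :=
    stripeRow_const (k - 1) ⟨by linarith [(by exact_mod_cast hh : (1 : ℤ) ≤ h)], by linarith⟩
  have h2 : stripeRow h (k * h) = -stripeRow h ((k - 1) * h) := by
    rw [← stripeRow_add hh]; congr 1; ring
  rw [h1, h2]
  intro hcon
  rcases Int.units_eq_one_or (stripeRow h ((k - 1) * h)) with h3 | h3 <;> rw [h3] at hcon <;>
    simp at hcon

lemma mem_stripe_Ico {h : ℕ} (hh : 1 ≤ h) (i : ℤ) :
    i ∈ Set.Ico ((i / h) * h) ((i / h) * h + h) := by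
  have hpos : (0 : ℤ) < h := by omega
  constructor
  · exact Int.ediv_mul_le i hpos.ne'
  · exact Int.lt_ediv_add_one_mul_self i hpos |>.trans_eq (by ring)

lemma width_stripeRow {h : ℕ} (hh : 1 ≤ h) (i : ℤ) : width (stripeRow h) i = h := by
  have he : IsKink (stripeRow h) ((i / h) * h + h) := by
    have := isKink_stripeRow hh (i / h + 1)
    rwa [add_mul, one_mul] at this
  rw [width_eq (isKink_stripeRow hh (i / h)) he (mem_stripe_Ico hh i)
    fun k hk => stripeRow_const (i / h) hk]
  omega

lemma field_stripeRow_add {h : ℕ} (hh : 1 ≤ h) (x : ℝ) (i : ℤ) :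
    field x (stripeRow h) (i + h) = field x (stripeRow h) i := by
  unfold field
  refine tsum_congr fun n => ?_
  rw [show i + (h : ℤ) + n = (i + n) + h by ring, differ_stripeRow_add hh]

lemma field_stripeRow {x : ℝ} (hx0 : 0 < x) (hx1 : x < 1) {h : ℕ} (hh : 1 ≤ h) (k : ℤ) :
    field x (stripeRow h) (k * h) = x ^ h * (1 - x)⁻¹ / (1 + x ^ h) ∧
    ∑ i ∈ Finset.Ico (k * h) (k * h + h : ℤ), field x (stripeRow h) i = h * meanField x h := by
  have he : IsKink (stripeRow h) (k * h + h) := by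
    have := isKink_stripeRow hh (k + 1)
    rwa [add_mul, one_mul] at this
  obtain ⟨h1, h2⟩ := field_run hx0 hx1 he h (by
    intro i hi
    rw [add_sub_cancel_right] at hi
    rw [stripeRow_const k hi]
    exact (stripeRow_const k ⟨by omega, by omega⟩).symm)
  rw [add_sub_cancel_right, field_stripeRow_add hh] at h1
  rw [add_sub_cancel_right, field_stripeRow_add hh] at h2
  specialize h1 hh
  have hq : 0 < x ^ h := by positivity
  have hB : field x (stripeRow h) (k * h) = x ^ h * (1 - x)⁻¹ / (1 + x ^ h) := by
    rw [eq_div_iff (by positivity)]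
    linarith
  refine ⟨hB, ?_⟩
  rw [h2, hB]
  have hne : 1 - x ≠ 0 := by linarith
  have hh' : (h : ℝ) ≠ 0 := by positivity
  unfold meanField
  field_simp
  ring

lemma sum_range_int (f : ℤ → ℝ) (m : ℕ) :
    ∑ i ∈ Finset.range m, f i = ∑ i ∈ Finset.Ico (0 : ℤ) m, f i := by
  induction m with
  | zero => simp
  | succ m ih =>
    rw [Finset.sum_range_succ, ih, ← sum_Ico_add f (by omega : (0 : ℤ) ≤ m)
      (by push_cast; omega : (m : ℤ) ≤ ((m + 1 : ℕ) : ℤ))]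
    congr 1
    have : Finset.Ico (m : ℤ) ((m + 1 : ℕ) : ℤ) = {(m : ℤ)} := by
      ext i; simp only [Finset.mem_Ico, Finset.mem_singleton]; push_cast; omega
    rw [this, Finset.sum_singleton]

/-- The generating function of the stripe densities. -/
lemma tsum_stripeDensity {x : ℝ} (hx0 : 0 < x) (hx1 : x < 1) (h : ℕ) :
    Summable (fun n : ℕ => stripeDensity h n * x ^ n) ∧
    ∑' n : ℕ, stripeDensity h n * x ^ n = meanField x h := by
  rcases Nat.eq_zero_or_pos h with rfl | hh
  · simp [stripeDensity, meanField]
  have hs : ∀ i : ℤ, Summable fun n : ℕ => x ^ n * differ (stripeRow h) i (i + n) := fun i =>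
    summable_field hx0 hx1 _ i i
  have heq : (fun n : ℕ => stripeDensity h n * x ^ n) = fun n : ℕ => (1 / (2 * (h : ℝ))) *
      ∑ i ∈ Finset.range (2 * h), x ^ n * differ (stripeRow h) (i : ℤ) (i + n) := by
    funext n
    unfold stripeDensity
    rw [← Finset.mul_sum]
    ring
  have hA : Summable fun n : ℕ =>
      ∑ i ∈ Finset.range (2 * h), x ^ n * differ (stripeRow h) (i : ℤ) (i + n) :=
    summable_sum fun i _ => hs i
  rw [heq]
  refine ⟨hA.mul_left (1 / (2 * (h : ℝ))), ?_⟩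
  rw [tsum_mul_left, Summable.tsum_finsetSum fun (i : ℕ) _ => hs i]
  have h2 := (field_stripeRow hx0 hx1 hh 0).2
  have h3 := (field_stripeRow hx0 hx1 hh 1).2
  rw [zero_mul, zero_add] at h2
  rw [one_mul] at h3
  have h4 : ∑ i ∈ Finset.range (2 * h), field x (stripeRow h) i =
      h * meanField x h + h * meanField x h := by
    rw [sum_range_int, show (((2 * h : ℕ) : ℤ)) = (h : ℤ) + h by push_cast; ring,
      ← sum_Ico_add _ (by omega : (0 : ℤ) ≤ h) (by omega : (h : ℤ) ≤ (h : ℤ) + h), h2, h3]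
  unfold field at h4
  rw [h4]
  generalize meanField x h = g
  have hh' : (h : ℝ) ≠ 0 := by positivity
  field_simp
  ring

lemma stripeDensity_nonneg (h : ℕ) (n : ℤ) : 0 ≤ stripeDensity h n :=
  mul_nonneg (by positivity) (Finset.sum_nonneg fun _ _ => differ_nonneg _ _ _)

lemma stripeDensity_zero_left (n : ℤ) : stripeDensity 0 n = 0 := by simp [stripeDensity]

lemma stripeDensity_le_one (h : ℕ) (n : ℤ) : stripeDensity h n ≤ 1 := by
  rcases Nat.eq_zero_or_pos h with rfl | hh
  · simp [stripeDensity]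
  unfold stripeDensity
  have : ∑ i ∈ Finset.range (2 * h), differ (stripeRow h) (i : ℤ) (i + n) ≤ 2 * h := by
    refine (Finset.sum_le_sum fun i _ => differ_le_one _ _ _).trans ?_
    simp
  rw [one_div, inv_mul_le_iff₀ (by positivity)]
  linarith

/-- Shifting the starting point does not change a sum over one period. -/
lemma sum_period_shift {h : ℕ} (hh : 1 ≤ h) (n k : ℤ) :
    ∑ i ∈ Finset.range (2 * h), differ (stripeRow h) ((i : ℤ) + k) (i + k + n) =
      ∑ i ∈ Finset.range (2 * h), differ (stripeRow h) (i : ℤ) (i + n) := by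
  set f : ℤ → ℝ := fun i => differ (stripeRow h) i (i + n) with hf
  have hper : ∀ i, f (i + (2 * h : ℕ)) = f i := by
    intro i
    simp only [hf]
    rw [show i + ((2 * h : ℕ) : ℤ) + n = (i + n + h) + h by push_cast; ring,
      show i + ((2 * h : ℕ) : ℤ) = (i + h) + h by push_cast; ring,
      differ_stripeRow_add hh, differ_stripeRow_add hh]
  have hstep : ∀ k, ∑ i ∈ Finset.range (2 * h), f (i + (k + 1)) =
      ∑ i ∈ Finset.range (2 * h), f (i + k) := by
    intro k
    have h1 := Finset.sum_range_succ (fun i : ℕ => f (i + k)) (2 * h)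
    have h2 := Finset.sum_range_succ' (fun i : ℕ => f (i + k)) (2 * h)
    rw [h1] at h2
    have h3 : f (((2 * h : ℕ) : ℤ) + k) = f ((0 : ℕ) + k) := by
      rw [add_comm, hper]; simp
    have h4 : ∀ i : ℕ, f (((i + 1 : ℕ) : ℤ) + k) = f (i + (k + 1)) := by
      intro i; congr 1; push_cast; ring
    simp only [h4] at h2
    linarith
  change ∑ i ∈ Finset.range (2 * h), f (i + k) = ∑ i ∈ Finset.range (2 * h), f i
  induction k using Int.induction_on with
  | zero => simp
  | succ k ih => rw [hstep, ih]
  | pred k ih =>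
    rw [← ih, ← hstep (-(k : ℤ) - 1)]
    simp

lemma stripeDensity_neg {h : ℕ} (n : ℤ) : stripeDensity h (-n) = stripeDensity h n := by
  rcases Nat.eq_zero_or_pos h with rfl | hh
  · simp [stripeDensity]
  unfold stripeDensity
  rw [← sum_period_shift hh (-n) n]
  congr 1
  refine Finset.sum_congr rfl fun i _ => ?_
  rw [add_neg_cancel_right, differ_comm]

lemma stripeDensity_one {h : ℕ} (hh : 1 ≤ h) : stripeDensity h 1 = 1 / h := by
  have h1 := sum_inv_width (isKink_stripeRow hh 0) (isKink_stripeRow hh 2) (by omega)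
  simp only [width_stripeRow hh] at h1
  rw [Finset.sum_const, Int.card_Ico, zero_mul, sub_zero, nsmul_eq_mul] at h1
  unfold stripeDensity
  rw [← sum_period_shift hh 1 (-1), sum_range_int (fun i => differ (stripeRow h) (i + -1) (i + -1 + 1))]
  have h2 : ∑ i ∈ Finset.Ico (0 : ℤ) (2 * h : ℕ), differ (stripeRow h) (i + -1) (i + -1 + 1) =
      ∑ i ∈ Finset.Ico (0 : ℤ) (2 * h), differ (stripeRow h) (i - 1) i := by
    push_cast
    refine Finset.sum_congr rfl fun i _ => ?_
    rw [← sub_eq_add_neg, sub_add_cancel]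
  rw [h2, ← h1]
  have : ((2 * (h : ℤ)).toNat : ℝ) = 2 * h := by
    have : (2 * (h : ℤ)).toNat = 2 * h := by omega
    rw [this]; push_cast; ring
  rw [this]
  field_simp

lemma stripeDensity_le {h : ℕ} (n : ℕ) : stripeDensity h n ≤ n / h := by
  rcases Nat.eq_zero_or_pos h with rfl | hh
  · simp [stripeDensity]
  induction n with
  | zero => simp [stripeDensity, differ_self]
  | succ n ih =>
    have h1 : stripeDensity h ((n + 1 : ℕ) : ℤ) ≤ stripeDensity h n + stripeDensity h 1 := by
      unfold stripeDensity
      rw [← mul_add, ← sum_period_shift hh 1 n, ← Finset.sum_add_distrib]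
      gcongr with i _
      have := differ_triangle (stripeRow h) i (i + ((n + 1 : ℕ) : ℤ)) (i + n)
      rwa [show (i : ℤ) + ((n + 1 : ℕ) : ℤ) = i + n + 1 by push_cast; ring] at this ⊢
    rw [stripeDensity_one hh] at h1
    push_cast at h1 ⊢
    rw [add_div]
    linarith

lemma le_stripeDensity {h n : ℕ} (hh : 1 ≤ h) (hn : n ≤ h) : (n : ℝ) / h ≤ stripeDensity h n := by
  unfold stripeDensity
  have hval : ∀ k : ℕ, ∀ i ∈ Finset.Ico ((k + 1) * h - n) ((k + 1) * h),
      differ (stripeRow h) (i : ℤ) (i + n) = 1 := by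
    intro k i hi
    rw [Finset.mem_Ico] at hi
    have h0 : (k + 1) * h = k * h + h := by ring
    have h1 : stripeRow h (i : ℤ) = stripeRow h ((k : ℤ) * h) :=
      stripeRow_const k ⟨by exact_mod_cast (by omega : k * h ≤ i),
        by exact_mod_cast (by omega : i < k * h + h)⟩
    have h2 : stripeRow h ((i : ℤ) + n) = stripeRow h (((k : ℤ) + 1) * h) := by
      refine stripeRow_const ((k : ℤ) + 1) ⟨?_, ?_⟩
      · have : (k + 1) * h ≤ i + n := by omega
        exact_mod_cast this
      · have : i + n < (k + 1) * h + h := by omega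
        exact_mod_cast this
    have h3 : stripeRow h (((k : ℤ) + 1) * h) = -stripeRow h ((k : ℤ) * h) := by
      rw [← stripeRow_add hh]; congr 1; ring
    unfold differ
    rw [if_neg]
    rw [h1, h2, h3]
    intro hcon
    rcases Int.units_eq_one_or (stripeRow h ((k : ℤ) * h)) with h4 | h4 <;> rw [h4] at hcon <;>
      simp at hcon
  have hsub : Finset.Ico ((0 + 1) * h - n) ((0 + 1) * h) ∪ Finset.Ico ((1 + 1) * h - n) ((1 + 1) * h) ⊆
      Finset.range (2 * h) := by
    intro i hi
    simp only [Finset.mem_union, Finset.mem_Ico, Finset.mem_range] at hi ⊢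
    omega
  have hdisj : Disjoint (Finset.Ico ((0 + 1) * h - n) ((0 + 1) * h))
      (Finset.Ico ((1 + 1) * h - n) ((1 + 1) * h)) := by
    rw [Finset.disjoint_left]
    intro i
    simp only [Finset.mem_Ico]
    omega
  have h1 : (2 * n : ℝ) ≤ ∑ i ∈ Finset.range (2 * h), differ (stripeRow h) (i : ℤ) (i + n) := by
    refine le_trans ?_ (Finset.sum_le_sum_of_subset_of_nonneg hsub fun _ _ _ => differ_nonneg _ _ _)
    rw [Finset.sum_union hdisj, Finset.sum_congr rfl (hval 0), Finset.sum_congr rfl (hval 1)]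
    simp only [Finset.sum_const, Nat.card_Ico, nsmul_eq_mul, mul_one]
    rw [Nat.sub_sub_self (by omega), Nat.sub_sub_self (by omega)]
    linarith
  have hh' : (0 : ℝ) < h := by exact_mod_cast hh
  calc (n : ℝ) / h = 1 / (2 * h) * (2 * n) := by field_simp
    _ ≤ _ := by gcongr

/-! ### Comparison of a one-dimensional configuration with a reference configuration -/

/-- The number of pairs `x, x + n` with different spins in `σ`, minus the same number for the
reference configuration `ρ`. -/
noncomputable def excess {α : Type*} [Add α] (σ ρ : α → ℤˣ) (n : α) : ℝ :=
  ∑' x, (differ σ x (x + n) - differ ρ x (x + n))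

lemma abs_differ_sub_le {α : Type*} [DecidableEq α] {σ ρ : α → ℤˣ} {S : Finset α}
    (hS : ∀ x ∉ S, σ x = ρ x) (x y : α) :
    |differ σ x y - differ ρ x y| ≤ (if x ∈ S then 1 else 0) + (if y ∈ S then 1 else 0) := by
  have h1 : |differ σ x y - differ ρ x y| ≤ 1 := by
    rw [abs_le]
    constructor <;> linarith [differ_nonneg σ x y, differ_le_one σ x y, differ_nonneg ρ x y,
      differ_le_one ρ x y]
  by_cases hx : x ∈ S
  · rw [if_pos hx]
    have : (0 : ℝ) ≤ if y ∈ S then 1 else 0 := by positivity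
    linarith
  by_cases hy : y ∈ S
  · rw [if_pos hy]
    have : (0 : ℝ) ≤ if x ∈ S then 1 else 0 := by positivity
    linarith
  · unfold differ
    rw [hS x hx, hS y hy]
    simp [hx, hy]

lemma excess_zero {α : Type*} [AddCommGroup α] (σ ρ : α → ℤˣ) : excess σ ρ 0 = 0 := by
  simp [excess, differ_self]

lemma excess_neg {α : Type*} [AddCommGroup α] (σ ρ : α → ℤˣ) (n : α) :
    excess σ ρ (-n) = excess σ ρ n := by
  unfold excess
  rw [← (Equiv.addRight n).tsum_eq (fun x => differ σ x (x + -n) - differ ρ x (x + -n))]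
  refine tsum_congr fun x => ?_
  simp only [Equiv.coe_addRight, add_neg_cancel_right]
  rw [differ_comm σ, differ_comm ρ]

section excess

variable {α : Type*} [AddCommGroup α] [DecidableEq α] {σ ρ : α → ℤˣ} {S : Finset α}

lemma hasSum_ind (S : Finset α) (n : α) :
    HasSum (fun x => (if x + n ∈ S then (1 : ℝ) else 0)) S.card := by
  have h : HasSum (fun x => (if x ∈ S then (1 : ℝ) else 0))
      (∑ x ∈ S, if x ∈ S then (1 : ℝ) else 0) :=
    hasSum_sum_of_ne_finset_zero fun x hx => if_neg hx
  have h2 : (∑ x ∈ S, if x ∈ S then (1 : ℝ) else 0) = S.card := by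
    rw [Finset.sum_congr rfl fun x hx => if_pos hx]
    simp
  rw [h2] at h
  exact (Equiv.hasSum_iff (f := fun x => (if x ∈ S then (1 : ℝ) else 0)) (Equiv.addRight n)).2 h

lemma hasSum_ind_add (S : Finset α) (n : α) :
    HasSum (fun x => (if x ∈ S then (1 : ℝ) else 0) + (if x + n ∈ S then (1 : ℝ) else 0))
      (2 * S.card) := by
  have h0 := hasSum_ind S 0
  simp only [add_zero] at h0
  rw [two_mul]
  exact h0.add (hasSum_ind S n)

lemma summable_excess (hS : ∀ x ∉ S, σ x = ρ x) (n : α) :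
    Summable fun x => differ σ x (x + n) - differ ρ x (x + n) :=
  Summable.of_norm_bounded (hasSum_ind_add S n).summable fun _ => abs_differ_sub_le hS _ _

lemma abs_excess_le (hS : ∀ x ∉ S, σ x = ρ x) (n : α) : |excess σ ρ n| ≤ 2 * S.card :=
  tsum_of_norm_bounded (f := fun x => differ σ x (x + n) - differ ρ x (x + n))
    (hasSum_ind_add S n) fun _ => abs_differ_sub_le hS _ _

end excess

/-- The generating function of the excess is the total excess of the fields. -/
lemma tsum_pow_mul_excess {x : ℝ} (hx0 : 0 < x) (hx1 : x < 1) {σ ρ : ℤ → ℤˣ} {S : Finset ℤ}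
    (hS : ∀ i ∉ S, σ i = ρ i) :
    Summable (fun i : ℤ => field x σ i - field x ρ i) ∧
    ∑' n : ℕ, excess σ ρ n * x ^ n = ∑' i : ℤ, (field x σ i - field x ρ i) := by
  set g : ℕ × ℤ → ℝ := fun z => x ^ z.1 *
    ((if z.2 ∈ S then (1 : ℝ) else 0) + (if z.2 + z.1 ∈ S then (1 : ℝ) else 0)) with hg
  have hg0 : 0 ≤ g := by
    intro z
    simp only [hg]
    have h1 : (0 : ℝ) ≤ if z.2 ∈ S then 1 else 0 := by split_ifs <;> norm_num
    have h2 : (0 : ℝ) ≤ if z.2 + z.1 ∈ S then 1 else 0 := by split_ifs <;> norm_num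
    exact mul_nonneg (by positivity) (add_nonneg h1 h2)
  have hgs : Summable g := by
    rw [summable_prod_of_nonneg hg0]
    constructor
    · intro n
      exact (hasSum_ind_add S (n : ℤ)).summable.mul_left (x ^ n)
    · have : (fun n : ℕ => ∑' i : ℤ, g (n, i)) = fun n : ℕ => x ^ n * (2 * S.card) := by
        funext n
        simp only [hg]
        rw [tsum_mul_left, (hasSum_ind_add S (n : ℤ)).tsum_eq]
      rw [this]
      exact (summable_geometric_of_lt_one hx0.le hx1).mul_right (2 * (S.card : ℝ))
  have hF : Summable fun z : ℕ × ℤ =>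
      x ^ z.1 * (differ σ z.2 (z.2 + z.1) - differ ρ z.2 (z.2 + z.1)) := by
    refine Summable.of_norm_bounded hgs fun z => ?_
    rw [norm_mul, norm_pow, Real.norm_of_nonneg hx0.le, Real.norm_eq_abs]
    exact mul_le_mul_of_nonneg_left (abs_differ_sub_le hS _ _) (by positivity)
  have hfield : ∀ i : ℤ, ∑' n : ℕ, x ^ n * (differ σ i (i + n) - differ ρ i (i + n)) =
      field x σ i - field x ρ i := by
    intro i
    simp only [mul_sub]
    exact (summable_field hx0 hx1 σ i i).tsum_sub (summable_field hx0 hx1 ρ i i)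
  have hex : ∀ n : ℕ, ∑' i : ℤ, x ^ n * (differ σ i (i + n) - differ ρ i (i + n)) =
      excess σ ρ n * x ^ n := by
    intro n
    rw [tsum_mul_left, mul_comm]
    rfl
  constructor
  · have := hF.prod_symm.prod
    refine this.congr fun i => ?_
    exact hfield i
  · have h := hF.tsum_comm (f := fun (n : ℕ) (i : ℤ) =>
      x ^ n * (differ σ i (i + n) - differ ρ i (i + n)))
    simp only [hex, hfield] at h
    exact h.symm

lemma tendsto_sum_Ico {f : ℤ → ℝ} (hf : Summable f) {u v : ℕ → ℤ} (hu : ∀ k : ℕ, u k ≤ -k)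
    (hv : ∀ k : ℕ, (k : ℤ) ≤ v k) (hu' : Antitone u) (hv' : Monotone v) :
    Tendsto (fun k => ∑ i ∈ Finset.Ico (u k) (v k), f i) atTop (𝓝 (∑' i, f i)) := by
  refine hf.hasSum.comp (tendsto_atTop_finset_of_monotone
    (fun a b hab => Finset.Ico_subset_Ico (hu' hab) (hv' hab)) fun d => ⟨d.natAbs + 1, ?_⟩)
  rw [Finset.mem_Ico]
  have h1 := hu (d.natAbs + 1)
  have h2 := hv (d.natAbs + 1)
  omega

lemma excess_one_eq_sum {σ ρ : ℤ → ℤˣ} {a b : ℤ} (h : ∀ i, (i < a ∨ b ≤ i + 1) → σ i = ρ i) :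
    excess σ ρ 1 = ∑ i ∈ Finset.Ico a b, (differ σ (i - 1) i - differ ρ (i - 1) i) := by
  unfold excess
  rw [← (Equiv.addRight (-1 : ℤ)).tsum_eq (fun x => differ σ x (x + 1) - differ ρ x (x + 1))]
  simp only [Equiv.coe_addRight, ← sub_eq_add_neg, sub_add_cancel]
  refine tsum_eq_sum fun i hi => ?_
  have h1 : σ i = ρ i := h i (by rw [Finset.mem_Ico] at hi; omega)
  have h2 : σ (i - 1) = ρ (i - 1) := h (i - 1) (by rw [Finset.mem_Ico] at hi; omega)
  unfold differ
  rw [h1, h2, sub_self]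

/-- A finite perturbation of a periodic striped row: outside a finite window all runs have the
reference width, and inside it the numbers of kinks and the fields are controlled by the widths. -/
lemma row_comparison {h : ℕ} (hh : 1 ≤ h) {σ : ℤ → ℤˣ} {S : Finset ℤ}
    (hS : ∀ i ∉ S, σ i = stripeRow h i) :
    ∃ W : Finset ℤ, (∀ i ∉ W, width σ i = h) ∧
      excess σ (stripeRow h) 1 = ∑ i ∈ W, (1 / (width σ i : ℝ) - 1 / h) ∧
      ∀ x : ℝ, 0 < x → x < 1 → ∑' n : ℕ, excess σ (stripeRow h) n * x ^ n ≤
        ∑ i ∈ W, (meanField x (width σ i) - meanField x h) := by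
  set ρ := stripeRow h
  have hhz : (1 : ℤ) ≤ h := by exact_mod_cast hh
  obtain ⟨N, hN⟩ : ∃ N : ℕ, ∀ i ∈ S, |i| + 2 ≤ N := by
    refine ⟨∑ i ∈ S, (i.natAbs + 2), fun i hi => ?_⟩
    have := Finset.single_le_sum (f := fun i : ℤ => i.natAbs + 2) (fun _ _ => Nat.zero_le _) hi
    rw [Int.abs_eq_natAbs]
    exact_mod_cast this
  have hNh : (N : ℤ) ≤ N * h := by nlinarith
  have hout : ∀ i : ℤ, (i ≤ -(N * h : ℤ) + 1 ∨ (N * h : ℤ) - 2 < i) → σ i = ρ i := by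
    intro i hi
    refine hS i fun hmem => ?_
    have := hN i hmem
    rcases abs_cases i with ⟨h1, _⟩ | ⟨h1, _⟩ <;> omega
  have hkink : ∀ k : ℤ, ((k : ℤ) * h ≤ -(N * h : ℤ) ∨ (N * h : ℤ) ≤ k * h) →
      IsKink σ (k * h) := by
    intro k hk
    unfold IsKink
    rw [hout _ (by omega), hout _ (by omega)]
    exact isKink_stripeRow hh k
  have hw : ∀ i ∉ Finset.Ico (-(N * h : ℤ)) (N * h), width σ i = h := by
    intro i hi
    have hmem := mem_stripe_Ico hh i
    rw [Finset.mem_Ico] at hi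
    have hblock : (i / h) * h + h ≤ -(N * h : ℤ) ∨ (N * h : ℤ) ≤ (i / h) * h := by
      rcases not_and_or.1 hi with h1 | h1
      · left
        have : i / (h : ℤ) < -N := by
          rw [Int.ediv_lt_iff_lt_mul (by omega)]; linarith
        nlinarith
      · right
        have : (N : ℤ) ≤ i / (h : ℤ) := by
          rw [Int.le_ediv_iff_mul_le (by omega)]; linarith
        nlinarith
    have h2 : IsKink σ ((i / h) * h + h) := by
      have := hkink (i / h + 1)
      rw [add_mul, one_mul] at this
      exact this (by omega)
    rw [width_eq (hkink (i / h) (by omega)) h2 hmem (u := ρ ((i / h) * h))]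
    · omega
    · intro k hk
      rw [hout k (by have := hk.1; have := hk.2; omega)]
      exact stripeRow_const _ hk
  refine ⟨Finset.Ico (-(N * h : ℤ)) (N * h), hw, ?_, ?_⟩
  · have hle : -(N * h : ℤ) ≤ N * h := by nlinarith
    rw [excess_one_eq_sum (a := -(N * h : ℤ)) (b := N * h) fun i hi => hout i (by omega),
      Finset.sum_sub_distrib, Finset.sum_sub_distrib]
    have e1 := sum_inv_width (hkink (-N) (by left; linarith)) (hkink N (by right; linarith))
      (by linarith)
    have e2 := sum_inv_width (isKink_stripeRow hh (-N)) (isKink_stripeRow hh N) (by linarith)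
    simp only [width_stripeRow hh, neg_mul] at e1 e2
    rw [e1, e2]
  · intro x hx0 hx1
    obtain ⟨hsum, htsum⟩ := tsum_pow_mul_excess hx0 hx1 hS
    rw [htsum]
    set b := x ^ h * (1 - x)⁻¹ / (1 + x ^ h)
    have hρ : ∀ k : ℤ, field x ρ (k * h) = b := fun k => (field_stripeRow hx0 hx1 hh k).1
    have hlim1 : Tendsto (fun k : ℕ => ∑ i ∈ Finset.Ico (-((N + k : ℕ) * h : ℤ)) ((N + k : ℕ) * h),
        (field x σ i - field x ρ i)) atTop (𝓝 (∑' i, (field x σ i - field x ρ i))) := by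
      refine tendsto_sum_Ico hsum ?_ ?_ ?_ ?_
      · intro k; push_cast; nlinarith
      · intro k; push_cast; nlinarith
      · intro a c hac
        have : (a : ℤ) ≤ c := by exact_mod_cast hac
        push_cast; nlinarith
      · intro a c hac
        have : (a : ℤ) ≤ c := by exact_mod_cast hac
        push_cast; nlinarith
    have hinj : Function.Injective fun k : ℕ => (-((N + k : ℕ) : ℤ)) * (h : ℤ) := by
      intro a c hac
      have h1 := mul_right_cancel₀ (by omega : (h : ℤ) ≠ 0) hac
      omega
    have hlim0 : Tendsto (fun k : ℕ => field x σ (-((N + k : ℕ) : ℤ) * h)) atTop (𝓝 b) := by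
      have h1 := (hsum.tendsto_cofinite_zero.comp hinj.tendsto_cofinite)
      rw [Nat.cofinite_eq_atTop] at h1
      have h2 := h1.add_const b
      rw [zero_add] at h2
      refine h2.congr fun k => ?_
      simp only [Function.comp]
      rw [hρ]; ring
    have hlim2 : Tendsto (fun k : ℕ => ∑ i ∈ Finset.Ico (-(N * h : ℤ)) (N * h),
        (meanField x (width σ i) - meanField x h) +
        fieldPotential x (field x σ (-((N + k : ℕ) : ℤ) * h)) - fieldPotential x b) atTop
        (𝓝 (∑ i ∈ Finset.Ico (-(N * h : ℤ)) (N * h),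
        (meanField x (width σ i) - meanField x h) + fieldPotential x b - fieldPotential x b)) := by
      refine Tendsto.sub_const (Tendsto.const_add _ ?_) _
      have hcont : Continuous (fieldPotential x) := by unfold fieldPotential; fun_prop
      exact (hcont.tendsto b).comp hlim0
    rw [add_sub_cancel_right] at hlim2
    refine le_of_tendsto_of_tendsto' hlim1 hlim2 fun k => ?_
    have hk0 : (0 : ℤ) ≤ k := by positivity
    have hNk : (N : ℤ) * h ≤ (N + k : ℕ) * h := by push_cast; nlinarith
    have hka : IsKink σ (-((N + k : ℕ) : ℤ) * h) := hkink _ (by left; linarith)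
    have hkb : IsKink σ (((N + k : ℕ) : ℤ) * h) := hkink _ (by right; linarith)
    have hmain := sum_field_le hx0 hx1 hka hkb (by nlinarith)
    have hend : field x σ (((N + k : ℕ) : ℤ) * h) = b := by
      rw [← hρ]
      unfold field
      refine tsum_congr fun n => ?_
      unfold differ
      rw [hout _ (by omega), hout _ (by omega)]
    rw [hend] at hmain
    have hperiodic : ∀ K : ℕ, ∑ i ∈ Finset.Ico (-((K : ℕ) : ℤ) * h) ((K : ℤ) * h), field x ρ i =
        ∑ i ∈ Finset.Ico (-((K : ℕ) : ℤ) * h) ((K : ℤ) * h), meanField x h := by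
      intro K
      rw [Finset.sum_const, Int.card_Ico, nsmul_eq_mul]
      have hcard : (((K : ℤ) * h - -(K : ℤ) * h).toNat : ℝ) = 2 * (K * h) := by
        have : ((K : ℤ) * h - -(K : ℤ) * h).toNat = 2 * (K * h) := by
          have : (K : ℤ) * h - -(K : ℤ) * h = ((2 * (K * h) : ℕ) : ℤ) := by push_cast; ring
          rw [this, Int.toNat_natCast]
        rw [this]; push_cast; ring
      rw [hcard]
      induction K with
      | zero => simp
      | succ K ih =>
        specialize ih (by
          have : ((K : ℤ) * h - -(K : ℤ) * h).toNat = 2 * (K * h) := by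
            have : (K : ℤ) * h - -(K : ℤ) * h = ((2 * (K * h) : ℕ) : ℤ) := by push_cast; ring
            rw [this, Int.toNat_natCast]
          rw [this]; push_cast; ring)
        have hK : (0 : ℤ) ≤ K * h := by positivity
        have eL : -((K + 1 : ℕ) : ℤ) * h = -(K : ℤ) * h - h := by push_cast; ring
        have eR : ((K + 1 : ℕ) : ℤ) * h = (K : ℤ) * h + h := by push_cast; ring
        have f1 := (field_stripeRow hx0 hx1 hh (-((K + 1 : ℕ) : ℤ))).2
        have f2 := (field_stripeRow hx0 hx1 hh (K : ℤ)).2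
        rw [eL, sub_add_cancel] at f1
        rw [eL, eR, ← sum_Ico_add _ (by linarith : -(K : ℤ) * h - h ≤ -(K : ℤ) * h)
          (by linarith : -(K : ℤ) * h ≤ (K : ℤ) * h + h),
          ← sum_Ico_add _ (by linarith : -(K : ℤ) * h ≤ (K : ℤ) * h)
          (by linarith : (K : ℤ) * h ≤ (K : ℤ) * h + h), f1, f2, ih]
        push_cast; ring
    have hsub : ∑ i ∈ Finset.Ico (-((N + k : ℕ) : ℤ) * h) (((N + k : ℕ) : ℤ) * h),
        (meanField x (width σ i) - meanField x h) =
        ∑ i ∈ Finset.Ico (-(N * h : ℤ)) (N * h), (meanField x (width σ i) - meanField x h) := by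
      symm
      refine Finset.sum_subset (Finset.Ico_subset_Ico (by linarith) hNk) fun i _ hi => ?_
      rw [hw i hi, sub_self]
    rw [Finset.sum_sub_distrib, ← hsub, Finset.sum_sub_distrib, ← neg_mul, hperiodic]
    linarith

/-- A finite perturbation of a constant column. The two infinite runs at its ends cost at most as
much as one kink without repulsion. -/
lemma column_comparison {u : ℤˣ} {σ : ℤ → ℤˣ} {S : Finset ℤ} (hS : ∀ i ∉ S, σ i = u)
    (hne : ∃ i, σ i ≠ u) :
    ∃ W : Finset ℤ, (∀ i ∉ W, width σ i = 0) ∧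
      excess σ (fun _ => u) 1 = ∑ i ∈ W, (1 / (width σ i : ℝ)) + 1 ∧
      ∀ x : ℝ, 0 < x → x < 1 → ∑' n : ℕ, excess σ (fun _ => u) n * x ^ n ≤
        ∑ i ∈ W, meanField x (width σ i) + x * ((1 - x)⁻¹) ^ 2 := by
  classical
  set S' := S.filter fun i => σ i ≠ u
  have hmem : ∀ i, i ∈ S' ↔ σ i ≠ u := by
    intro i
    simp only [S', Finset.mem_filter]
    exact ⟨fun h => h.2, fun h => ⟨by_contra fun hc => h (hS i hc), h⟩⟩
  have hS'ne : S'.Nonempty := by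
    obtain ⟨i, hi⟩ := hne
    exact ⟨i, (hmem i).2 hi⟩
  set a := S'.min' hS'ne
  set b := S'.max' hS'ne + 1 with hb
  have hab : a < b := by
    have := S'.min'_le_max' hS'ne
    omega
  have hlt : ∀ i, i < a → σ i = u := by
    intro i hi
    by_contra hc
    have := S'.min'_le i ((hmem i).2 hc)
    omega
  have hge : ∀ i, b ≤ i → σ i = u := by
    intro i hi
    by_contra hc
    have := S'.le_max' i ((hmem i).2 hc)
    omega
  have hka : IsKink σ a := by
    unfold IsKink
    rw [hlt (a - 1) (by omega)]
    exact ((hmem a).1 (S'.min'_mem hS'ne)).symm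
  have hkb : IsKink σ b := by
    unfold IsKink
    rw [hge b le_rfl, hb, add_sub_cancel_right]
    exact (hmem _).1 (S'.max'_mem hS'ne)
  refine ⟨Finset.Ico a b, ?_, ?_, ?_⟩
  · intro i hi
    rw [Finset.mem_Ico] at hi
    rcases lt_or_ge i a with h1 | h1
    · exact width_eq_zero_of_le fun j hj => by rw [hlt j (by omega), hlt i h1]
    · have h2 : b ≤ i := by omega
      exact width_eq_zero_of_ge fun j hj => by rw [hge j (by omega), hge i h2]
  · rw [excess_one_eq_sum (a := a) (b := b + 1) fun i hi => ?_, sum_inv_width hka hkb hab.le,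
      ← sum_Ico_add _ hab.le (by omega : b ≤ b + 1)]
    · have h0 : ∀ i : ℤ, differ (fun _ : ℤ => u) (i - 1) i = 0 := fun i => by simp [differ]
      have h1 : Finset.Ico b (b + 1) = {b} := by
        ext i; simp only [Finset.mem_Ico, Finset.mem_singleton]; omega
      have h2 : differ σ (b - 1) b = 1 := if_neg hkb
      simp only [h0, sub_zero, h1, Finset.sum_singleton, h2]
    · rcases hi with h1 | h1
      · exact hlt i h1
      · exact hge i (by omega)
  · intro x hx0 hx1
    obtain ⟨hsum, htsum⟩ := tsum_pow_mul_excess hx0 hx1 hS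
    rw [htsum]
    have hfu : ∀ i, field x (fun _ : ℤ => u) i = 0 := by
      intro i; simp [field, differ]
    simp only [hfu, sub_zero] at hsum ⊢
    have hfb : ∀ i, b ≤ i → field x σ i = 0 := by
      intro i hi
      unfold field
      have : ∀ n : ℕ, x ^ n * differ σ i (i + n) = 0 := by
        intro n
        unfold differ
        rw [if_pos, mul_zero]
        rw [hge i hi, hge (i + n) (by omega)]
      simp [this]
    have hlim := tendsto_sum_Ico hsum (u := fun k => -(|a| + k)) (v := fun k => |b| + k)
      (fun k => by simp) (fun k => by simp)
      (fun k l hkl => by have : (k : ℤ) ≤ l := by exact_mod_cast hkl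
                         simp only; omega)
      (fun k l hkl => by have : (k : ℤ) ≤ l := by exact_mod_cast hkl
                         simp only; omega)
    refine le_of_tendsto' hlim fun k => ?_
    have hua : -(|a| + (k : ℤ)) ≤ a := by have := neg_abs_le a; omega
    have hvb : b ≤ |b| + (k : ℤ) := by have := le_abs_self b; omega
    rw [← sum_Ico_add _ hua (by omega : a ≤ |b| + (k : ℤ)), ← sum_Ico_add _ hab.le hvb]
    have e3 : ∑ i ∈ Finset.Ico b (|b| + (k : ℤ)), field x σ i = 0 :=
      Finset.sum_eq_zero fun i hi => hfb i (Finset.mem_Ico.1 hi).1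
    have e2 := sum_field_le hx0 hx1 hka hkb hab.le
    rw [hfb b le_rfl] at e2
    have e1 := (field_run hx0 hx1 hka (a + (|a| + k)).toNat (by
      intro i hi
      rw [hlt i hi.2, hlt (a - 1) (by omega)])).2
    rw [show a - ((a + (|a| + (k : ℤ))).toNat : ℤ) = -(|a| + (k : ℤ)) by omega] at e1
    rw [e1, e3]
    set B := field x σ a
    set T := (1 - x)⁻¹ with hT
    set q := x ^ (a + (|a| + (k : ℤ))).toNat
    have hq0 : 0 ≤ q := by positivity
    have hT0 : 0 < T := by rw [hT]; exact inv_pos.2 (by linarith)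
    have hB0 : 0 ≤ B := field_nonneg hx0 σ a
    have hBT : B ≤ T := field_le hx0 hx1 σ a
    unfold fieldPotential at e2
    have e4 : x * (1 - q) * T * (T - B) ≤ x * T * (T - B) := by
      have : 0 ≤ x * q * T * (T - B) := by
        have : 0 ≤ T - B := by linarith
        positivity
      nlinarith
    have e5 : 0 ≤ x * B ^ 2 := by positivity
    nlinarith

/-! ### Energies of lines -/

/-- The energy, in the one-dimensional model with nearest neighbour coupling `J` and long range
interaction `lineKernel p`, of a configuration with `D n` pairs of different spins at
distance `n`. -/
noncomputable def lineEnergy (p J : ℝ) (D : ℤ → ℝ) : ℝ :=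
  2 * J * D 1 - ∑' n : ℕ, lineKernel p n * D n

lemma summable_lineKernel_mul {p : ℝ} (hp : 3 < p) {D : ℤ → ℝ} {C : ℝ} (hD : ∀ n, |D n| ≤ C) :
    Summable fun n : ℕ => lineKernel p n * D n := by
  have hV : Summable fun n : ℕ => lineKernel p n := by
    rw [← summable_nat_add_iff 1]
    refine Summable.of_nonneg_of_le (fun n => lineKernel_nonneg _ _) (fun n => ?_)
      ((summable_nat_add_iff 1).2 (summable_natMul_lineKernel hp))
    refine le_mul_of_one_le_left (lineKernel_nonneg _ _) ?_
    push_cast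
    linarith [(Nat.cast_nonneg n : (0 : ℝ) ≤ n)]
  refine Summable.of_norm_bounded (hV.mul_left C) fun n => ?_
  rw [norm_mul, Real.norm_of_nonneg (lineKernel_nonneg _ _), Real.norm_eq_abs, mul_comm]
  exact mul_le_mul_of_nonneg_right (hD n) (lineKernel_nonneg _ _)

lemma abs_stripeDensity_le (h : ℕ) (n : ℤ) : |stripeDensity h n| ≤ 1 := by
  rw [abs_of_nonneg (stripeDensity_nonneg h n)]; exact stripeDensity_le_one h n

lemma stripeDensity_zero_right (h : ℕ) : stripeDensity h 0 = 0 := by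
  simp [stripeDensity, differ_self]

lemma stripeDensity_one_right (h : ℕ) : stripeDensity h 1 = 1 / h := by
  rcases Nat.eq_zero_or_pos h with rfl | hh
  · simp [stripeDensity]
  · exact stripeDensity_one hh

/-- Comparison of generating functions implies comparison of energies, by complete monotonicity of
the line kernel. The parameter `d` is the weight of an additional kink without repulsion. -/
lemma le_lineEnergy {p : ℝ} (hp : 3 < p) (J : ℝ) {W : Finset ℤ} {w : ℤ → ℕ} {h : ℕ} {d C : ℝ}
    (hd : 0 ≤ d) {D : ℤ → ℝ} (hD : ∀ n, |D n| ≤ C) (hD0 : D 0 = 0)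
    (hD1 : D 1 = ∑ i ∈ W, (1 / (w i : ℝ) - 1 / h) + d)
    (hgen : ∀ x : ℝ, 0 < x → x < 1 → ∑' n : ℕ, D n * x ^ n ≤
        ∑ i ∈ W, (meanField x (w i) - meanField x h) + d * (x * ((1 - x)⁻¹) ^ 2)) :
    ∑ i ∈ W, (lineEnergy p J (stripeDensity (w i)) - lineEnergy p J (stripeDensity h)) -
      d * (2 * (Jc p - J)) ≤ lineEnergy p J D := by
  have hC : 0 ≤ C := (abs_nonneg _).trans (hD 0)
  set c : ℕ → ℝ := fun n =>
    ∑ i ∈ W, (stripeDensity (w i) n - stripeDensity h n) + d * n - D n with hc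
  have hcb : ∀ n, |c n| ≤ (W.card + d + C) * n := by
    intro n
    rcases Nat.eq_zero_or_pos n with rfl | hn
    · simp [hc, stripeDensity_zero_right, hD0]
    have hn1 : (1 : ℝ) ≤ n := by exact_mod_cast hn
    have h1 : |∑ i ∈ W, (stripeDensity (w i) n - stripeDensity h n)| ≤ W.card := by
      refine (Finset.abs_sum_le_sum_abs _ _).trans ?_
      have : ∀ i ∈ W, |stripeDensity (w i) n - stripeDensity h n| ≤ (1 : ℝ) := by
        intro i _
        rw [abs_le]
        constructor <;> linarith [stripeDensity_nonneg (w i) n, stripeDensity_nonneg h n,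
          stripeDensity_le_one (w i) n, stripeDensity_le_one h n]
      refine (Finset.sum_le_sum this).trans ?_
      simp
    calc |c n| ≤ |∑ i ∈ W, (stripeDensity (w i) n - stripeDensity h n) + d * n| + |D n| :=
          abs_sub _ _
      _ ≤ |∑ i ∈ W, (stripeDensity (w i) n - stripeDensity h n)| + |d * n| + |D n| := by
          gcongr; exact abs_add_le _ _
      _ ≤ W.card + d * n + C := by
          rw [abs_of_nonneg (by positivity : 0 ≤ d * n)]
          gcongr
          exact hD n
      _ ≤ (W.card + d + C) * n := by
          have h2 : (W.card : ℝ) ≤ W.card * n := le_mul_of_one_le_right (by positivity) hn1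
          have h3 : C ≤ C * n := le_mul_of_one_le_right hC hn1
          linarith
  have hpos : ∀ x : ℝ, 0 < x → x < 1 → 0 ≤ ∑' n, c n * x ^ n := by
    intro x hx0 hx1
    have hs1 : Summable fun n : ℕ => (∑ i ∈ W, (stripeDensity (w i) n - stripeDensity h n)) * x ^ n := by
      simp only [Finset.sum_mul, sub_mul]
      exact summable_sum fun i _ =>
        (tsum_stripeDensity hx0 hx1 (w i)).1.sub (tsum_stripeDensity hx0 hx1 h).1
    have ht1 : ∑' n : ℕ, (∑ i ∈ W, (stripeDensity (w i) n - stripeDensity h n)) * x ^ n =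
        ∑ i ∈ W, (meanField x (w i) - meanField x h) := by
      simp only [Finset.sum_mul, sub_mul]
      rw [Summable.tsum_finsetSum fun i _ =>
        (tsum_stripeDensity hx0 hx1 (w i)).1.sub (tsum_stripeDensity hx0 hx1 h).1]
      refine Finset.sum_congr rfl fun i _ => ?_
      rw [(tsum_stripeDensity hx0 hx1 (w i)).1.tsum_sub (tsum_stripeDensity hx0 hx1 h).1,
        (tsum_stripeDensity hx0 hx1 (w i)).2, (tsum_stripeDensity hx0 hx1 h).2]
    have hxn : ‖x‖ < 1 := by rwa [Real.norm_of_nonneg hx0.le]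
    have hgeo := hasSum_coe_mul_geometric_of_norm_lt_one hxn
    have hs2 : Summable fun n : ℕ => d * ((n : ℝ) * x ^ n) := hgeo.summable.mul_left d
    have hs3 : Summable fun n : ℕ => D n * x ^ n := by
      refine Summable.of_norm_bounded ((summable_geometric_of_lt_one hx0.le hx1).mul_left C)
        fun n => ?_
      rw [norm_mul, norm_pow, Real.norm_of_nonneg hx0.le, Real.norm_eq_abs]
      exact mul_le_mul_of_nonneg_right (hD n) (by positivity)
    have heq : ∀ n : ℕ, c n * x ^ n =
        (∑ i ∈ W, (stripeDensity (w i) n - stripeDensity h n)) * x ^ n + d * ((n : ℝ) * x ^ n) -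
          D n * x ^ n := by
      intro n; simp only [hc]; ring
    simp only [heq]
    rw [(hs1.add hs2).tsum_sub hs3, hs1.tsum_add hs2, ht1, tsum_mul_left, hgeo.tsum_eq]
    have := hgen x hx0 hx1
    have h1x : x / (1 - x) ^ 2 = x * ((1 - x)⁻¹) ^ 2 := by
      rw [div_eq_mul_inv, inv_pow]
    rw [h1x]
    linarith
  have hmain := tsum_mul_lineKernel_nonneg hp hcb hpos
  have hsd : ∀ k : ℕ, Summable fun n : ℕ => lineKernel p n * stripeDensity k n := fun k =>
    summable_lineKernel_mul hp (abs_stripeDensity_le k)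
  have hs1 : Summable fun n : ℕ => ∑ i ∈ W,
      (lineKernel p n * stripeDensity (w i) n - lineKernel p n * stripeDensity h n) :=
    summable_sum fun i _ => (hsd (w i)).sub (hsd h)
  have hs2 : Summable fun n : ℕ => d * ((n : ℝ) * lineKernel p n) :=
    (summable_natMul_lineKernel hp).mul_left d
  have hs3 := summable_lineKernel_mul hp hD
  have heq : ∀ n : ℕ, c n * lineKernel p n =
      ∑ i ∈ W, (lineKernel p n * stripeDensity (w i) n - lineKernel p n * stripeDensity h n) +
        d * ((n : ℝ) * lineKernel p n) - lineKernel p n * D n := by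
    intro n
    simp only [hc, ← mul_sub, ← Finset.mul_sum]
    ring
  simp only [heq] at hmain
  rw [(hs1.add hs2).tsum_sub hs3, hs1.tsum_add hs2, tsum_mul_left, ← two_mul_Jc hp,
    Summable.tsum_finsetSum fun i _ => (hsd (w i)).sub (hsd h)] at hmain
  have hsub : ∀ i, ∑' n : ℕ, (lineKernel p n * stripeDensity (w i) n -
      lineKernel p n * stripeDensity h n) = ∑' n : ℕ, lineKernel p n * stripeDensity (w i) n -
      ∑' n : ℕ, lineKernel p n * stripeDensity h n := fun i => (hsd (w i)).tsum_sub (hsd h)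
  simp only [hsub] at hmain
  unfold lineEnergy
  simp only [stripeDensity_one_right, hD1]
  have e1 : ∑ i ∈ W, (2 * J * (1 / (w i : ℝ)) - ∑' n : ℕ, lineKernel p n * stripeDensity (w i) n -
      (2 * J * (1 / h) - ∑' n : ℕ, lineKernel p n * stripeDensity h n)) =
      2 * J * ∑ i ∈ W, (1 / (w i : ℝ) - 1 / h) -
      ∑ i ∈ W, (∑' n : ℕ, lineKernel p n * stripeDensity (w i) n -
      ∑' n : ℕ, lineKernel p n * stripeDensity h n) := by
    rw [Finset.mul_sum, ← Finset.sum_sub_distrib]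
    refine Finset.sum_congr rfl fun i _ => ?_
    ring
  rw [e1]
  linarith

/-- The energy of a finite perturbation of a periodic row. -/
lemma row_lineEnergy_ge {p : ℝ} (hp : 3 < p) (J : ℝ) {h : ℕ} (hh : 1 ≤ h) {σ : ℤ → ℤˣ}
    {S : Finset ℤ} (hS : ∀ i ∉ S, σ i = stripeRow h i) :
    ∃ W : Finset ℤ, (∀ i ∉ W, width σ i = h) ∧
      ∑ i ∈ W, (lineEnergy p J (stripeDensity (width σ i)) - lineEnergy p J (stripeDensity h)) ≤
        lineEnergy p J (excess σ (stripeRow h)) := by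
  obtain ⟨W, hW, h1, h2⟩ := row_comparison hh hS
  refine ⟨W, hW, ?_⟩
  have := le_lineEnergy hp J le_rfl (abs_excess_le hS) (excess_zero _ _) (d := 0) (W := W)
    (w := width σ) (h := h) (by rw [h1, add_zero]) (fun x hx0 hx1 => by
      rw [zero_mul, add_zero]; exact h2 x hx0 hx1)
  rwa [zero_mul, sub_zero] at this

lemma lineEnergy_stripeDensity_zero (p J : ℝ) : lineEnergy p J (stripeDensity 0) = 0 := by
  simp [lineEnergy, stripeDensity_zero_left]

open Classical in
/-- The energy of a finite perturbation of a constant column. -/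
lemma column_lineEnergy_ge {p : ℝ} (hp : 3 < p) (J : ℝ) {u : ℤˣ} {σ : ℤ → ℤˣ}
    {S : Finset ℤ} (hS : ∀ i ∉ S, σ i = u) :
    ∃ W : Finset ℤ, (∀ i ∉ W, width σ i = 0) ∧
      ∑ i ∈ W, lineEnergy p J (stripeDensity (width σ i)) -
        (if ∃ i, σ i ≠ u then 2 * (Jc p - J) else 0) ≤
        lineEnergy p J (excess σ fun _ => u) := by
  split_ifs with hne
  · obtain ⟨W, hW, h1, h2⟩ := column_comparison hS hne
    refine ⟨W, hW, ?_⟩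
    have hg0 : ∀ x : ℝ, meanField x 0 = 0 := fun x => by simp [meanField]
    have := le_lineEnergy hp J zero_le_one (abs_excess_le hS) (excess_zero _ _) (d := 1) (W := W)
      (w := width σ) (h := 0) (by rw [h1]; simp) (fun x hx0 hx1 => by
        simp only [hg0, sub_zero, one_mul]; exact h2 x hx0 hx1)
    simpa only [lineEnergy_stripeDensity_zero, sub_zero, one_mul] using this
  · push Not at hne
    refine ⟨∅, fun i _ => width_eq_zero_of_ge fun j _ => by rw [hne, hne], ?_⟩
    have : σ = fun _ => u := funext hne
    subst this
    simp [lineEnergy, excess]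

/-! ### Splitting the planar interaction into rows, columns and corners -/

/-- The pair coupling as a function of the displacement. -/
noncomputable def planarCoupling (p J : ℝ) (n : ℤ × ℤ) : ℝ :=
  (if |n.1| + |n.2| = 1 then -J else 0) + kernel p n

lemma coupling_eq (p J : ℝ) (x n : Site) : coupling p J x (x + n) = planarCoupling p J n := by
  unfold coupling planarCoupling kernel
  congr 1
  · have : latticeGraph.Adj x (x + n) ↔ |n.1| + |n.2| = 1 := by
      change |x.1 - (x.1 + n.1)| + |x.2 - (x.2 + n.2)| = 1 ↔ _
      rw [sub_add_cancel_left, sub_add_cancel_left, abs_neg, abs_neg]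
    simp only [this]
  · have h0 : (x = x + n) ↔ n = 0 := by simp
    simp only [h0]
    split_ifs
    · rfl
    · congr 2
      unfold siteDist
      congr 1
      simp only [Prod.fst_add, Prod.snd_add]
      push_cast
      ring

lemma pairEnergy_eq (p J : ℝ) (σ : Config) (x n : Site) :
    pairEnergy p J x (x + n) (σ x) (σ (x + n)) =
      -2 * (planarCoupling p J n * differ σ x (x + n)) := by
  unfold pairEnergy
  rw [coupling_eq]
  unfold differ
  rcases Int.units_eq_one_or (σ x) with h1 | h1 <;>
    rcases Int.units_eq_one_or (σ (x + n)) with h2 | h2 <;> rw [h1, h2] <;> norm_num <;> ring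

/-- The four nearest neighbours of the origin. -/
def neighbours : Finset (ℤ × ℤ) := {(1, 0), (-1, 0), (0, 1), (0, -1)}

lemma mem_neighbours (n : ℤ × ℤ) : n ∈ neighbours ↔ |n.1| + |n.2| = 1 := by
  obtain ⟨a, b⟩ := n
  simp only [neighbours, Finset.mem_insert, Finset.mem_singleton, Prod.mk.injEq]
  rcases abs_cases a with ⟨h1, _⟩ | ⟨h1, _⟩ <;> rcases abs_cases b with ⟨h2, _⟩ | ⟨h2, _⟩ <;>
    rw [h1, h2] <;> omega

lemma summable_mul_of_bounded {α : Type*} {f D : α → ℝ} (hf : Summable f) (hf0 : ∀ x, 0 ≤ f x)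
    {C : ℝ} (hD : ∀ x, |D x| ≤ C) : Summable fun x => f x * D x := by
  refine Summable.of_norm_bounded (hf.mul_left C) fun x => ?_
  rw [norm_mul, Real.norm_of_nonneg (hf0 x), Real.norm_eq_abs, mul_comm]
  exact mul_le_mul_of_nonneg_right (hD x) (hf0 x)

/-- Since `f 0 = 0`, the sum over `ℕ` may be written with the term `0` included. -/
lemma tsum_int_even {f : ℤ → ℝ} (hf : Summable f) (heven : ∀ n, f (-n) = f n) (h0 : f 0 = 0) :
    ∑' n, f n = 2 * ∑' n : ℕ, f n := by
  have h1 : Summable fun n : ℕ => f n := hf.comp_injective Nat.cast_injective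
  have h2 : Summable fun n : ℕ => f (-(n + 1 : ℤ)) := by
    refine hf.comp_injective fun a b hab => ?_
    simpa using hab
  rw [tsum_of_nat_of_neg_add_one h1 h2, two_mul]
  congr 1
  rw [h1.tsum_eq_zero_add]
  simp only [heven, Nat.cast_zero, h0, zero_add]
  refine tsum_congr fun n => ?_
  push_cast
  rfl

lemma hasSum_planarCoupling_mul {p : ℝ} (hp : 3 < p) (J : ℝ) {D : ℤ × ℤ → ℝ} {C : ℝ}
    (hD : ∀ n, |D n| ≤ C) :
    HasSum (fun n => planarCoupling p J n * D n)
      (-J * ∑ n ∈ neighbours, D n + ∑' n, kernel p n * D n) := by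
  have h1 : HasSum (fun n : ℤ × ℤ => (if |n.1| + |n.2| = 1 then -J else 0) * D n)
      (∑ n ∈ neighbours, (if |n.1| + |n.2| = 1 then -J else 0) * D n) := by
    refine hasSum_sum_of_ne_finset_zero fun n hn => ?_
    rw [mem_neighbours] at hn
    rw [if_neg hn, zero_mul]
  have h2 : ∑ n ∈ neighbours, (if |n.1| + |n.2| = 1 then -J else 0) * D n =
      -J * ∑ n ∈ neighbours, D n := by
    rw [Finset.mul_sum]
    refine Finset.sum_congr rfl fun n hn => ?_
    rw [mem_neighbours] at hn
    rw [if_pos hn]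
  rw [h2] at h1
  have h3 := (summable_mul_of_bounded (summable_kernel hp) (kernel_nonneg p) hD).hasSum
  have heq : (fun n => planarCoupling p J n * D n) =
      fun n : ℤ × ℤ => (if |n.1| + |n.2| = 1 then -J else 0) * D n + kernel p n * D n := by
    funext n
    unfold planarCoupling
    ring
  rw [heq]
  exact h1.add h3

lemma tsum_kernel_mul_fst {p : ℝ} (hp : 3 < p) {D : ℤ → ℝ} {C : ℝ} (hD : ∀ n, |D n| ≤ C)
    (heven : ∀ n, D (-n) = D n) (h0 : D 0 = 0) :
    ∑' n : ℤ × ℤ, kernel p n * D n.1 = ∑' n : ℕ, lineKernel p n * D n := by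
  have hs : Summable fun n : ℤ × ℤ => kernel p n * D n.1 :=
    summable_mul_of_bounded (summable_kernel hp) (kernel_nonneg p) fun n => hD n.1
  have hinner : ∀ a : ℤ, ∑' b : ℤ, kernel p (a, b) * D a = lineKernel p a * D a / 2 := by
    intro a
    rw [tsum_mul_right]
    unfold lineKernel
    ring
  have hs' := hs.prod
  rw [hs.tsum_prod]
  simp only [hinner] at hs' ⊢
  rw [tsum_int_even hs' (fun n => by rw [lineKernel_neg, heven]) (by simp [h0]), tsum_div_const]
  ring

lemma kernel_prod_swap (p : ℝ) (n : ℤ × ℤ) : kernel p n.swap = kernel p n := kernel_swap p n.1 n.2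

lemma tsum_kernel_mul_snd {p : ℝ} (hp : 3 < p) {D : ℤ → ℝ} {C : ℝ} (hD : ∀ n, |D n| ≤ C)
    (heven : ∀ n, D (-n) = D n) (h0 : D 0 = 0) :
    ∑' n : ℤ × ℤ, kernel p n * D n.2 = ∑' n : ℕ, lineKernel p n * D n := by
  rw [← tsum_kernel_mul_fst hp hD heven h0, ← (Equiv.prodComm ℤ ℤ).tsum_eq]
  refine tsum_congr fun n => ?_
  simp only [Equiv.prodComm_apply, kernel_prod_swap, Prod.snd_swap]

/-- If the number of pairs with displacement `n` splits into changes along the horizontal leg,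
changes along the vertical leg and double changes, then so does the energy. -/
lemma neg_tsum_planarCoupling {p : ℝ} (hp : 3 < p) (J : ℝ) {D c : ℤ × ℤ → ℝ} {D₁ D₂ : ℤ → ℝ}
    {C₁ C₂ C : ℝ} (h1 : ∀ n, |D₁ n| ≤ C₁) (h2 : ∀ n, |D₂ n| ≤ C₂) (hc : ∀ n, |c n| ≤ C)
    (e1 : ∀ n, D₁ (-n) = D₁ n) (e2 : ∀ n, D₂ (-n) = D₂ n) (z1 : D₁ 0 = 0) (z2 : D₂ 0 = 0)
    (zc : ∀ n : ℤ × ℤ, n.1 = 0 ∨ n.2 = 0 → c n = 0)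
    (hD : ∀ n, D n = D₁ n.1 + D₂ n.2 - 2 * c n) :
    -∑' n, planarCoupling p J n * D n =
      lineEnergy p J D₁ + lineEnergy p J D₂ + 2 * ∑' n, kernel p n * c n := by
  have hDb : ∀ n, |D n| ≤ C₁ + C₂ + 2 * C := by
    intro n
    rw [hD]
    calc |D₁ n.1 + D₂ n.2 - 2 * c n| ≤ |D₁ n.1 + D₂ n.2| + |2 * c n| := abs_sub _ _
      _ ≤ |D₁ n.1| + |D₂ n.2| + |2 * c n| := by gcongr; exact abs_add_le _ _
      _ ≤ C₁ + C₂ + 2 * C := by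
          rw [abs_mul, abs_two]
          gcongr
          · exact h1 _
          · exact h2 _
          · exact hc _
  have s1 : Summable fun n : ℤ × ℤ => kernel p n * D₁ n.1 :=
    summable_mul_of_bounded (summable_kernel hp) (kernel_nonneg p) fun n => h1 n.1
  have s2 : Summable fun n : ℤ × ℤ => kernel p n * D₂ n.2 :=
    summable_mul_of_bounded (summable_kernel hp) (kernel_nonneg p) fun n => h2 n.2
  have s3 : Summable fun n : ℤ × ℤ => 2 * (kernel p n * c n) :=
    (summable_mul_of_bounded (summable_kernel hp) (kernel_nonneg p) hc).mul_left 2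
  rw [(hasSum_planarCoupling_mul hp J hDb).tsum_eq]
  have hk : ∀ n, kernel p n * D n = kernel p n * D₁ n.1 + kernel p n * D₂ n.2 -
      2 * (kernel p n * c n) := by
    intro n; rw [hD]; ring
  simp only [hk]
  rw [(s1.add s2).tsum_sub s3, s1.tsum_add s2, tsum_mul_left, tsum_kernel_mul_fst hp h1 e1 z1,
    tsum_kernel_mul_snd hp h2 e2 z2]
  have hnb : ∑ n ∈ neighbours, D n = 2 * D₁ 1 + 2 * D₂ 1 := by
    unfold neighbours
    rw [Finset.sum_insert (by decide), Finset.sum_insert (by decide), Finset.sum_insert (by decide),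
      Finset.sum_singleton]
    simp only [hD, z1, z2, e1, e2, zc (1, 0) (Or.inr rfl), zc (-1, 0) (Or.inr rfl),
      zc (0, 1) (Or.inl rfl), zc (0, -1) (Or.inl rfl)]
    ring
  rw [hnb]
  unfold lineEnergy
  ring

lemma stripe_eq {h : ℕ} (hh : 1 ≤ h) (x : Site) : stripe h x = stripeRow h x.1 := by
  unfold stripe stripeRow
  set k := x.1 / (h : ℤ) with hk
  set r := x.1 % (h : ℤ) with hr
  have hpos : (0 : ℤ) < h := by omega
  have hx : x.1 = h * k + r := (Int.mul_ediv_add_emod x.1 h).symm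
  have hr0 : 0 ≤ r := Int.emod_nonneg _ hpos.ne'
  have hrh : r + 1 ≤ h := Int.emod_lt_of_pos _ hpos
  have hh' : (0 : ℝ) < h := by exact_mod_cast hpos
  have hr0' : (0 : ℝ) ≤ r := by exact_mod_cast hr0
  have hrh' : (r : ℝ) + 1 ≤ h := by exact_mod_cast hrh
  have harg : Real.pi * ((x.1 : ℝ) + 1 / 2) / h = Real.pi * ((r : ℝ) + 1 / 2) / h + k * Real.pi := by
    rw [hx]; push_cast; field_simp; ring
  have hsin : 0 < Real.sin (Real.pi * ((r : ℝ) + 1 / 2) / h) := by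
    refine Real.sin_pos_of_pos_of_lt_pi (by positivity) ?_
    rw [div_lt_iff₀ hh']
    exact mul_lt_mul_of_pos_left (by linarith) Real.pi_pos
  rw [harg, Real.sin_add_int_mul_pi]
  rcases Int.even_or_odd k with he | ho
  · rw [he.neg_one_zpow, one_mul, if_pos hsin, Int.negOnePow_even _ he]
  · rw [ho.neg_one_zpow, if_neg (by linarith), Int.negOnePow_odd _ ho]

/-- The energy per site of the striped configuration is the energy of its row profile. -/
lemma stripeEnergy_eq {p : ℝ} (hp : 3 < p) (J : ℝ) (h : ℕ) :
    stripeEnergy p J h = lineEnergy p J (stripeDensity h) := by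
  rcases Nat.eq_zero_or_pos h with rfl | hh
  · rw [lineEnergy_stripeDensity_zero]
    simp [stripeEnergy]
  have hsite : ∀ i : ℕ, siteEnergy p J (stripe h) ((i : ℤ), 0) =
      -∑' n : ℤ × ℤ, planarCoupling p J n * differ (stripeRow h) (i : ℤ) (i + n.1) := by
    intro i
    unfold siteEnergy
    rw [← (Equiv.addLeft (((i : ℤ), 0) : Site)).tsum_eq]
    simp only [Equiv.coe_addLeft, pairEnergy_eq]
    rw [tsum_mul_left]
    have : ∀ n : ℤ × ℤ, differ (stripe h) ((i : ℤ), 0) (((i : ℤ), 0) + n) =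
        differ (stripeRow h) (i : ℤ) (i + n.1) := by
      intro n
      unfold differ
      simp only [stripe_eq hh, Prod.fst_add]
    simp only [this]
    ring
  have hsum : ∀ i : ℕ, Summable fun n : ℤ × ℤ =>
      planarCoupling p J n * differ (stripeRow h) (i : ℤ) (i + n.1) := fun i =>
    (hasSum_planarCoupling_mul hp J (C := 1) fun n => by
      rw [abs_of_nonneg (differ_nonneg _ _ _)]; exact differ_le_one _ _ _).summable
  unfold stripeEnergy
  simp only [hsite]
  rw [Finset.sum_neg_distrib, ← Summable.tsum_finsetSum fun (i : ℕ) _ => hsum i, mul_neg,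
    ← tsum_mul_left]
  have := neg_tsum_planarCoupling hp J (D := fun n => stripeDensity h n.1) (c := fun _ => 0)
    (D₁ := stripeDensity h) (D₂ := fun _ => 0) (C₁ := 1) (C₂ := 0) (C := 0)
    (abs_stripeDensity_le h) (by simp) (by simp) (fun n => stripeDensity_neg n) (by simp)
    (stripeDensity_zero_right h) rfl (by simp) (by simp)
  have h0 : lineEnergy p J (fun _ => 0) = 0 := by simp [lineEnergy]
  rw [h0] at this
  simp only [mul_zero, tsum_zero, add_zero] at this
  rw [← this]
  congr 1
  refine tsum_congr fun n => ?_
  unfold stripeDensity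
  rw [← Finset.mul_sum]
  ring

/-! ### The energy difference -/

section difference

variable {σ ρ : Config} {X : Finset Site}

lemma excess_eq_sum (hX : ∀ x ∉ X, σ x = ρ x) (n : Site) :
    excess σ ρ n = ∑ x ∈ X, (differ σ x (x + n) - differ ρ x (x + n)) +
      ∑ x ∈ X, (if x - n ∈ X then 0 else differ σ x (x - n) - differ ρ x (x - n)) := by
  classical
  unfold excess
  have h1 : HasSum (fun x => if x ∈ X then differ σ x (x + n) - differ ρ x (x + n) else 0)
      (∑ x ∈ X, (differ σ x (x + n) - differ ρ x (x + n))) := by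
    have := hasSum_sum_of_ne_finset_zero (L := SummationFilter.unconditional Site)
      (f := fun x => if x ∈ X then differ σ x (x + n) - differ ρ x (x + n) else 0) (s := X)
      fun x hx => if_neg hx
    rwa [Finset.sum_congr rfl fun x hx => if_pos hx] at this
  have h2 : HasSum (fun x => if x ∈ X then
      (if x - n ∈ X then 0 else differ σ x (x - n) - differ ρ x (x - n)) else 0)
      (∑ x ∈ X, (if x - n ∈ X then 0 else differ σ x (x - n) - differ ρ x (x - n))) := by
    have := hasSum_sum_of_ne_finset_zero (L := SummationFilter.unconditional Site)
      (f := fun x => if x ∈ X then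
        (if x - n ∈ X then 0 else differ σ x (x - n) - differ ρ x (x - n)) else 0) (s := X)
      fun x hx => if_neg hx
    rwa [Finset.sum_congr rfl fun x hx => if_pos hx] at this
  have h3 := (Equiv.hasSum_iff (f := fun x => if x ∈ X then
      (if x - n ∈ X then 0 else differ σ x (x - n) - differ ρ x (x - n)) else 0)
      (Equiv.addRight n)).2 h2
  rw [← (h1.add h3).tsum_eq]
  refine tsum_congr fun x => ?_
  simp only [Function.comp, Equiv.coe_addRight, add_sub_cancel_right]
  by_cases hx : x ∈ X
  · simp [hx]
  · by_cases hy : x + n ∈ X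
    · simp [hx, hy, differ_comm _ x (x + n)]
    · unfold differ
      simp [hx, hy, hX]

lemma summable_planarCoupling_differ {p : ℝ} (hp : 3 < p) (J : ℝ) (τ : Config) (x : Site) :
    Summable fun n => planarCoupling p J n * differ τ x (x + n) :=
  (hasSum_planarCoupling_mul hp J (C := 1) fun n => by
    rw [abs_of_nonneg (differ_nonneg _ _ _)]; exact differ_le_one _ _ _).summable

lemma planarCoupling_neg (p J : ℝ) (n : ℤ × ℤ) : planarCoupling p J (-n) = planarCoupling p J n := by
  unfold planarCoupling
  rw [kernel_neg]
  simp

lemma energy_congr {p J : ℝ} {s t : Config} (h1 : ∀ x ∈ X, s x = t x) (u : Config) :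
    energy p J X s u = energy p J X t u := by
  unfold energy
  congr 1
  · congr 1
    refine Finset.sum_congr rfl fun x hx => Finset.sum_congr rfl fun y hy => ?_
    rw [h1 x hx, h1 y hy]
  · refine Finset.sum_congr rfl fun x hx => ?_
    rw [h1 x hx]

lemma energy_self {p : ℝ} (hp : 3 < p) (J : ℝ) (τ u : Config) (hu : ∀ x ∉ X, u x = τ x) :
    energy p J X τ u = -(∑ x ∈ X, (∑' n, planarCoupling p J n * differ τ x (x + n) +
      ∑' n, planarCoupling p J n * (if x - n ∈ X then 0 else differ τ x (x - n)))) := by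
  classical
  set P : Site → Site → ℝ := fun x y => planarCoupling p J (y - x) * differ τ x y with hP
  have hPs : ∀ x, Summable (P x) := by
    intro x
    rw [← (Equiv.addLeft x).summable_iff]
    refine (summable_planarCoupling_differ hp J τ x).congr fun n => ?_
    simp [hP]
  have hpair : ∀ x y, pairEnergy p J x y (τ x) (τ y) = -2 * P x y := by
    intro x y
    have := pairEnergy_eq p J τ x (y - x)
    rwa [add_sub_cancel] at this
  have hout : ∀ x, Summable fun y => if y ∈ X then 0 else P x y := by
    intro x
    refine (hPs x).abs.of_norm_bounded fun y => ?_
    split_ifs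
    · simp
    · rfl
  have hfull : ∀ x, ∑' y, P x y = ∑ y ∈ X, P x y + ∑' y, (if y ∈ X then 0 else P x y) := by
    intro x
    have h1 : HasSum (fun y => if y ∈ X then P x y else 0) (∑ y ∈ X, P x y) := by
      have := hasSum_sum_of_ne_finset_zero (L := SummationFilter.unconditional Site)
        (f := fun y => if y ∈ X then P x y else 0) (s := X) fun y hy => if_neg hy
      rwa [Finset.sum_congr rfl fun y hy => if_pos hy] at this
    rw [← (h1.add (hout x).hasSum).tsum_eq]
    refine tsum_congr fun y => ?_
    by_cases hy : y ∈ X <;> simp [hy]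
  have e1 : ∀ x, ∑' n, planarCoupling p J n * differ τ x (x + n) = ∑' y, P x y := by
    intro x
    rw [← (Equiv.addLeft x).tsum_eq (P x)]
    refine tsum_congr fun n => ?_
    simp [hP]
  have e2 : ∀ x, ∑' n, planarCoupling p J n * (if x - n ∈ X then 0 else differ τ x (x - n)) =
      ∑' y, (if y ∈ X then 0 else P x y) := by
    intro x
    rw [← (Equiv.subLeft x).tsum_eq (fun y => if y ∈ X then 0 else P x y)]
    refine tsum_congr fun n => ?_
    simp only [hP, Equiv.subLeft_apply]
    rw [show x - n - x = -n by abel, planarCoupling_neg]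
    split_ifs <;> simp
  have e3 : ∀ x, ∑' y : {y : Site // y ∉ X}, pairEnergy p J x y (τ x) (u y) =
      -2 * ∑' y, (if y ∈ X then 0 else P x y) := by
    intro x
    have : ∀ y : {y : Site // y ∉ X}, pairEnergy p J x y (τ x) (u y) = -2 * P x y := by
      intro y
      rw [hu y y.2, hpair]
    simp only [this]
    rw [tsum_mul_left]
    congr 1
    have h := tsum_subtype {y : Site | y ∉ X} (P x)
    refine h.trans (tsum_congr fun y => ?_)
    rw [Set.indicator_apply]
    by_cases hy : y ∈ X
    · rw [if_pos hy, if_neg]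
      exact fun hc => hc hy
    · rw [if_neg hy, if_pos]
      exact hy
  unfold energy
  simp only [hpair, e1, e2, e3, hfull]
  rw [Finset.sum_add_distrib, Finset.sum_add_distrib, ← Finset.mul_sum]
  simp only [← Finset.mul_sum]
  ring

/-- The energy difference is the coupling summed against the excess. -/
lemma energy_sub {p : ℝ} (hp : 3 < p) (J : ℝ) (hX : ∀ x ∉ X, σ x = ρ x) :
    energy p J X σ ρ - energy p J X ρ ρ = -∑' n, planarCoupling p J n * excess σ ρ n := by
  classical
  rw [energy_self hp J σ ρ fun x hx => (hX x hx).symm, energy_self hp J ρ ρ fun _ _ => rfl]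
  have hb : ∀ (τ : Config) (x n : Site), |if x - n ∈ X then 0 else differ τ x (x - n)| ≤ 1 := by
    intro τ x n
    split_ifs
    · simp
    · rw [abs_of_nonneg (differ_nonneg _ _ _)]; exact differ_le_one _ _ _
  have s1 := fun τ x => summable_planarCoupling_differ hp J τ x
  have s2 := fun (τ : Config) (x : Site) =>
    (hasSum_planarCoupling_mul hp J (hb τ x)).summable
  have key : ∀ n, planarCoupling p J n * excess σ ρ n =
      ∑ x ∈ X, ((planarCoupling p J n * differ σ x (x + n) +
        planarCoupling p J n * (if x - n ∈ X then 0 else differ σ x (x - n))) -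
        (planarCoupling p J n * differ ρ x (x + n) +
        planarCoupling p J n * (if x - n ∈ X then 0 else differ ρ x (x - n)))) := by
    intro n
    rw [excess_eq_sum hX, ← Finset.sum_add_distrib, Finset.mul_sum]
    refine Finset.sum_congr rfl fun x _ => ?_
    split_ifs <;> ring
  simp only [key]
  rw [Summable.tsum_finsetSum fun x _ =>
    ((s1 σ x).add (s2 σ x)).sub ((s1 ρ x).add (s2 ρ x))]
  have : ∀ x, ∑' n, ((planarCoupling p J n * differ σ x (x + n) +
        planarCoupling p J n * (if x - n ∈ X then 0 else differ σ x (x - n))) -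
        (planarCoupling p J n * differ ρ x (x + n) +
        planarCoupling p J n * (if x - n ∈ X then 0 else differ ρ x (x - n)))) =
      (∑' n, planarCoupling p J n * differ σ x (x + n) +
      ∑' n, planarCoupling p J n * (if x - n ∈ X then 0 else differ σ x (x - n))) -
      (∑' n, planarCoupling p J n * differ ρ x (x + n) +
      ∑' n, planarCoupling p J n * (if x - n ∈ X then 0 else differ ρ x (x - n))) := by
    intro x
    rw [((s1 σ x).add (s2 σ x)).tsum_sub ((s1 ρ x).add (s2 ρ x)), (s1 σ x).tsum_add (s2 σ x),
      (s1 ρ x).tsum_add (s2 ρ x)]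
  simp only [this]
  rw [Finset.sum_sub_distrib]
  ring

end difference

/-! ### Decomposition of the energy into rows, columns and corners -/

/-- The row of `σ` at height `r`. -/
def rowOf (σ : Config) (r : ℤ) : ℤ → ℤˣ := fun i => σ (i, r)

/-- The column of `σ` at abscissa `c`. -/
def colOf (σ : Config) (c : ℤ) : ℤ → ℤˣ := fun j => σ (c, j)

/-- The number of sites of the maximal horizontal segment of constant spin through `x`, and `0` if
this segment is infinite. -/
noncomputable def hWidth (σ : Config) (x : Site) : ℕ := width (rowOf σ x.2) x.1

/-- The number of sites of the maximal vertical segment of constant spin through `x`, and `0` if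
this segment is infinite. -/
noncomputable def vWidth (σ : Config) (x : Site) : ℕ := width (colOf σ x.1) x.2

/-- The number of sites `x` such that the spin changes along both legs of the path that goes
horizontally and then vertically from `x` to `x + n`. -/
noncomputable def doubleChanges (σ : Config) (n : ℤ × ℤ) : ℝ :=
  ∑' x : Site, differ σ x (x + (n.1, 0)) * differ σ (x + (n.1, 0)) (x + n)

section doubleChanges

variable {σ ρ : Config} {X : Finset Site}

lemma doubleChanges_nonneg (n : ℤ × ℤ) : 0 ≤ doubleChanges σ n :=
  tsum_nonneg fun _ => mul_nonneg (differ_nonneg _ _ _) (differ_nonneg _ _ _)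

lemma differ_column_le (hX : ∀ x ∉ X, σ x = ρ x) (hρ : ∀ x y : Site, x.1 = y.1 → ρ x = ρ y)
    (x n : Site) : differ σ (x + (n.1, 0)) (x + n) ≤
      (if x + (n.1, 0) ∈ X then 1 else 0) + (if x + n ∈ X then 1 else 0) := by
  have h := abs_differ_sub_le hX (x + (n.1, 0)) (x + n)
  have h0 : differ ρ (x + (n.1, 0)) (x + n) = 0 := by
    unfold differ
    rw [if_pos (hρ _ _ (by simp))]
  rw [h0, sub_zero] at h
  exact (le_abs_self _).trans h

lemma hasSum_column_bound (X : Finset Site) (n : Site) :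
    HasSum (fun x : Site => (if x + (n.1, 0) ∈ X then (1 : ℝ) else 0) +
      (if x + n ∈ X then (1 : ℝ) else 0)) (2 * X.card) := by
  rw [two_mul]
  exact (hasSum_ind X _).add (hasSum_ind X n)

lemma summable_doubleChanges (hX : ∀ x ∉ X, σ x = ρ x)
    (hρ : ∀ x y : Site, x.1 = y.1 → ρ x = ρ y) (n : Site) :
    Summable fun x : Site => differ σ x (x + (n.1, 0)) * differ σ (x + (n.1, 0)) (x + n) := by
  refine Summable.of_nonneg_of_le
    (fun x => mul_nonneg (differ_nonneg _ _ _) (differ_nonneg _ _ _)) (fun x => ?_)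
    (hasSum_column_bound X n).summable
  exact (mul_le_of_le_one_left (differ_nonneg _ _ _) (differ_le_one _ _ _)).trans
    (differ_column_le hX hρ x n)

lemma abs_doubleChanges_le (hX : ∀ x ∉ X, σ x = ρ x)
    (hρ : ∀ x y : Site, x.1 = y.1 → ρ x = ρ y) (n : Site) :
    |doubleChanges σ n| ≤ 2 * X.card := by
  rw [abs_of_nonneg (doubleChanges_nonneg n), ← (hasSum_column_bound X n).tsum_eq]
  refine (summable_doubleChanges hX hρ n).tsum_le_tsum (fun x => ?_)
    (hasSum_column_bound X n).summable
  exact (mul_le_of_le_one_left (differ_nonneg _ _ _) (differ_le_one _ _ _)).trans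
    (differ_column_le hX hρ x n)

/-- The exact decomposition along paths with two legs: a pair differs if the spin changes along
exactly one leg. -/
lemma excess_eq_add_sub (hX : ∀ x ∉ X, σ x = ρ x) (hρ : ∀ x y : Site, x.1 = y.1 → ρ x = ρ y)
    (n : Site) :
    excess σ ρ n = excess σ ρ (n.1, 0) + excess σ ρ (0, n.2) - 2 * doubleChanges σ n := by
  have s1 := summable_excess hX ((n.1, 0) : Site)
  have s2 := summable_excess hX ((0, n.2) : Site)
  have s2' := (Equiv.addRight ((n.1, 0) : Site)).summable_iff.2 s2
  have s3 := (summable_doubleChanges hX hρ n).mul_left 2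
  have e2 : excess σ ρ (0, n.2) = ∑' x : Site, ((fun x => differ σ x (x + (0, n.2)) -
      differ ρ x (x + (0, n.2))) ∘ Equiv.addRight ((n.1, 0) : Site)) x :=
    ((Equiv.addRight ((n.1, 0) : Site)).tsum_eq _).symm
  rw [e2]
  unfold doubleChanges
  rw [← tsum_mul_left]
  unfold excess
  rw [← s1.tsum_add s2', ← (s1.add s2').tsum_sub s3]
  refine tsum_congr fun x => ?_
  simp only [Function.comp, Equiv.coe_addRight]
  have hx : x + ((n.1, 0) : Site) + (0, n.2) = x + n := by
    ext <;> simp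
  rw [hx, differ_eq_add σ x (x + n) (x + (n.1, 0)), differ_eq_add ρ x (x + n) (x + (n.1, 0))]
  have h0 : differ ρ (x + (n.1, 0)) (x + n) = 0 := by
    unfold differ
    rw [if_pos (hρ _ _ (by simp))]
  rw [h0]
  ring

lemma excess_rows (hX : ∀ x ∉ X, σ x = ρ x) (m : ℤ) :
    excess σ ρ (m, 0) = ∑ r ∈ X.image Prod.snd, excess (rowOf σ r) (rowOf ρ r) m := by
  have hs := summable_excess hX ((m, 0) : Site)
  have hs' := (Equiv.prodComm ℤ ℤ).summable_iff.2 hs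
  have h1 : excess σ ρ (m, 0) = ∑' r : ℤ, excess (rowOf σ r) (rowOf ρ r) m := by
    unfold excess
    refine ((Equiv.prodComm ℤ ℤ).tsum_eq _).symm.trans (hs'.tsum_prod.trans ?_)
    refine tsum_congr fun r => tsum_congr fun i => ?_
    have : ((i, r) : Site) + (m, 0) = (i + m, r) := by simp
    simp only [Function.comp, Equiv.prodComm_apply, Prod.swap_prod_mk, this]
    rfl
  rw [h1, tsum_eq_sum (s := X.image Prod.snd)]
  intro r hr
  have : rowOf σ r = rowOf ρ r := by
    funext i
    exact hX _ fun hi => hr (Finset.mem_image_of_mem Prod.snd hi)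
  simp [excess, this]

lemma excess_columns (hX : ∀ x ∉ X, σ x = ρ x) (m : ℤ) :
    excess σ ρ (0, m) = ∑ c ∈ X.image Prod.fst, excess (colOf σ c) (colOf ρ c) m := by
  have hs := summable_excess hX ((0, m) : Site)
  have h1 : excess σ ρ (0, m) = ∑' c : ℤ, excess (colOf σ c) (colOf ρ c) m := by
    unfold excess
    rw [hs.tsum_prod]
    refine tsum_congr fun r => tsum_congr fun i => ?_
    have : ((r, i) : Site) + (0, m) = (r, i + m) := by simp
    rw [this]
    rfl
  rw [h1, tsum_eq_sum (s := X.image Prod.fst)]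
  intro r hr
  have : colOf σ r = colOf ρ r := by
    funext i
    exact hX _ fun hi => hr (Finset.mem_image_of_mem Prod.fst hi)
  simp [excess, this]

lemma lineEnergy_sum {p : ℝ} (hp : 3 < p) (J : ℝ) {ι : Type*} (R : Finset ι) (D : ι → ℤ → ℝ)
    (C : ι → ℝ) (hD : ∀ r n, |D r n| ≤ C r) :
    lineEnergy p J (fun n => ∑ r ∈ R, D r n) = ∑ r ∈ R, lineEnergy p J (D r) := by
  unfold lineEnergy
  rw [Finset.sum_sub_distrib, ← Finset.mul_sum,
    ← Summable.tsum_finsetSum fun r _ => summable_lineKernel_mul hp (hD r)]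
  simp only [Finset.mul_sum]

/-- The energy difference as the sum of the energies of rows and columns and the cost of double
changes. -/
lemma energy_sub_eq {p : ℝ} (hp : 3 < p) (J : ℝ) (hX : ∀ x ∉ X, σ x = ρ x)
    (hρ : ∀ x y : Site, x.1 = y.1 → ρ x = ρ y) :
    energy p J X σ ρ - energy p J X ρ ρ =
      ∑ r ∈ X.image Prod.snd, lineEnergy p J (excess (rowOf σ r) (rowOf ρ r)) +
      ∑ c ∈ X.image Prod.fst, lineEnergy p J (excess (colOf σ c) (colOf ρ c)) +
      2 * ∑' n, kernel p n * doubleChanges σ n := by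
  have hrow : ∀ r i, i ∉ X.image Prod.fst → rowOf σ r i = rowOf ρ r i := fun r i hi =>
    hX _ fun h => hi (Finset.mem_image_of_mem Prod.fst h)
  have hcol : ∀ c j, j ∉ X.image Prod.snd → colOf σ c j = colOf ρ c j := fun c j hj =>
    hX _ fun h => hj (Finset.mem_image_of_mem Prod.snd h)
  rw [energy_sub hp J hX, ← lineEnergy_sum hp J _ _ _ fun r n => abs_excess_le (hrow r) n,
    ← lineEnergy_sum hp J _ _ _ fun c n => abs_excess_le (hcol c) n]
  simp only [← excess_rows hX, ← excess_columns hX]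
  refine neg_tsum_planarCoupling hp J (fun n => abs_excess_le hX ((n, 0) : Site))
    (fun n => abs_excess_le hX ((0, n) : Site)) (abs_doubleChanges_le hX hρ) (fun n => ?_)
    (fun n => ?_) (excess_zero σ ρ) (excess_zero σ ρ) (fun n hn => ?_) (excess_eq_add_sub hX hρ)
  · rw [← excess_neg σ ρ ((n, 0) : Site)]; simp
  · rw [← excess_neg σ ρ ((0, n) : Site)]; simp
  · unfold doubleChanges
    rcases hn with hn | hn
    · have : ((n.1, 0) : Site) = 0 := by rw [hn]; rfl
      simp [this, differ_self]
    · have : ((n.1, 0) : Site) = n := by rw [← hn]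
      rw [this]
      simp [differ_self]

end doubleChanges

/-! ### Corner vertices -/

section corners

variable {σ ρ : Config} {X : Finset Site}

lemma hasEnd_horizontal (v w : ℤ × ℤ) :
    (Bond.mk .horizontal w).HasEnd v ↔ w = v ∨ w = (v.1 - 1, v.2) := by
  unfold Bond.HasEnd Bond.top
  simp only [Prod.ext_iff]
  omega

lemma hasEnd_vertical (v w : ℤ × ℤ) :
    (Bond.mk .vertical w).HasEnd v ↔ w = v ∨ w = (v.1, v.2 - 1) := by
  unfold Bond.HasEnd Bond.top
  simp only [Prod.ext_iff]
  omega

lemma boundaryAt_horizontal_nonempty (σ : Config) (v : ℤ × ℤ) :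
    (boundaryAt σ .horizontal v).Nonempty ↔
      σ (v.1, v.2 - 1) ≠ σ v ∨ σ (v.1 - 1, v.2 - 1) ≠ σ (v.1 - 1, v.2) := by
  constructor
  · rintro ⟨⟨d, w⟩, hb, rfl, he⟩
    rcases (hasEnd_horizontal v w).1 he with rfl | rfl
    · exact Or.inl hb
    · exact Or.inr hb
  · rintro (h | h)
    · exact ⟨⟨.horizontal, v⟩, h, rfl, (hasEnd_horizontal _ _).2 (Or.inl rfl)⟩
    · exact ⟨⟨.horizontal, (v.1 - 1, v.2)⟩, h, rfl, (hasEnd_horizontal _ _).2 (Or.inr rfl)⟩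

lemma boundaryAt_vertical_nonempty (σ : Config) (v : ℤ × ℤ) :
    (boundaryAt σ .vertical v).Nonempty ↔
      σ (v.1 - 1, v.2) ≠ σ v ∨ σ (v.1 - 1, v.2 - 1) ≠ σ (v.1, v.2 - 1) := by
  constructor
  · rintro ⟨⟨d, w⟩, hb, rfl, he⟩
    rcases (hasEnd_vertical v w).1 he with rfl | rfl
    · exact Or.inl hb
    · exact Or.inr hb
  · rintro (h | h)
    · exact ⟨⟨.vertical, v⟩, h, rfl, (hasEnd_vertical _ _).2 (Or.inl rfl)⟩
    · exact ⟨⟨.vertical, (v.1, v.2 - 1)⟩, h, rfl, (hasEnd_vertical _ _).2 (Or.inr rfl)⟩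

lemma isCornerVertex_iff (σ : Config) (v : ℤ × ℤ) : IsCornerVertex σ v ↔
    (σ (v.1, v.2 - 1) ≠ σ v ∨ σ (v.1 - 1, v.2 - 1) ≠ σ (v.1 - 1, v.2)) ∧
    (σ (v.1 - 1, v.2) ≠ σ v ∨ σ (v.1 - 1, v.2 - 1) ≠ σ (v.1, v.2 - 1)) := by
  unfold IsCornerVertex
  rw [boundaryAt_horizontal_nonempty, boundaryAt_vertical_nonempty]

lemma numCorners_le {V : Finset (ℤ × ℤ)} (hV : ∀ v, v ∈ V ↔ IsCornerVertex σ v) :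
    numCorners σ ≤ 2 * V.card := by
  unfold numCorners
  rw [tsum_eq_sum (s := V)]
  · calc ∑ v ∈ V, ((cornersAt σ v : ℕ∞) : ℝ≥0∞) ≤ ∑ v ∈ V, 2 := by
          refine Finset.sum_le_sum fun v _ => ?_
          have : cornersAt σ v ≤ 2 := by
            unfold cornersAt
            split_ifs
            · refine (Set.encard_le_encard (t := {⟨.horizontal, v⟩,
                ⟨.horizontal, (v.1 - 1, v.2)⟩}) ?_).trans
                ((Set.encard_insert_le _ _).trans (by rw [Set.encard_singleton]; norm_num))
              rintro ⟨d, w⟩ ⟨_, rfl, he⟩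
              rcases (hasEnd_horizontal v w).1 he with rfl | rfl
              · exact Or.inl rfl
              · exact Or.inr rfl
            · exact zero_le
          calc ((cornersAt σ v : ℕ∞) : ℝ≥0∞) ≤ ((2 : ℕ∞) : ℝ≥0∞) := ENat.toENNReal_mono this
            _ = 2 := by simp
      _ = 2 * V.card := by rw [Finset.sum_const, nsmul_eq_mul, mul_comm]
  · intro v hv
    rw [hV] at hv
    simp [cornersAt, hv]

lemma finite_cornerVertices (hX : ∀ x ∉ X, σ x = ρ x)
    (hρ : ∀ x y : Site, x.1 = y.1 → ρ x = ρ y) : {v | IsCornerVertex σ v}.Finite := by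
  refine ((X.finite_toSet.union (X.finite_toSet.image fun x => (x.1, x.2 + 1))).union
    ((X.finite_toSet.image fun x => (x.1 + 1, x.2)).union
      (X.finite_toSet.image fun x => (x.1 + 1, x.2 + 1)))).subset ?_
  intro v hv
  have h := ((isCornerVertex_iff σ v).1 hv).1
  by_contra hc
  simp only [Set.mem_union, Set.mem_image, not_or, not_exists, not_and] at hc
  obtain ⟨⟨h1, h2⟩, h3, h4⟩ := hc
  have n1 : v ∉ X := h1
  have n2 : ((v.1, v.2 - 1) : Site) ∉ X := fun h => h2 _ h (by ext <;> simp)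
  have n3 : ((v.1 - 1, v.2) : Site) ∉ X := fun h => h3 _ h (by ext <;> simp)
  have n4 : ((v.1 - 1, v.2 - 1) : Site) ∉ X := fun h => h4 _ h (by ext <;> simp)
  rcases h with h | h
  · exact h (by rw [hX _ n1, hX _ n2]; exact hρ _ _ rfl)
  · exact h (by rw [hX _ n3, hX _ n4]; exact hρ _ _ rfl)

/-- Every corner vertex is the middle of a path with two unit legs along both of which the spin
changes. -/
lemma card_cornerVertices_le (hX : ∀ x ∉ X, σ x = ρ x)
    (hρ : ∀ x y : Site, x.1 = y.1 → ρ x = ρ y) {V : Finset (ℤ × ℤ)}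
    (hV : ∀ v, v ∈ V ↔ IsCornerVertex σ v) :
    (V.card : ℝ) ≤ doubleChanges σ (1, 1) + doubleChanges σ (1, -1) +
      doubleChanges σ (-1, 1) + doubleChanges σ (-1, -1) := by
  have shift : ∀ n d : ℤ × ℤ, HasSum (fun v : Site => differ σ (v + d) (v + d + (n.1, 0)) *
      differ σ (v + d + (n.1, 0)) (v + d + n)) (doubleChanges σ n) := fun n d =>
    (Equiv.hasSum_iff (f := fun x : Site => differ σ x (x + (n.1, 0)) *
      differ σ (x + (n.1, 0)) (x + n)) (Equiv.addRight d)).2 (summable_doubleChanges hX hρ n).hasSum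
  have hsum := (((shift (1, 1) (-1, -1)).add (shift (1, -1) (-1, 0))).add
    (shift (-1, 1) (0, -1))).add (shift (-1, -1) (0, 0))
  have hcard : (V.card : ℝ) = ∑ v ∈ V, 1 := by simp
  rw [hcard, ← hsum.tsum_eq]
  refine le_trans (Finset.sum_le_sum fun v hv => ?_) (hsum.summable.sum_le_tsum V fun v _ => ?_)
  · obtain ⟨h1, h2⟩ := (isCornerVertex_iff σ v).1 ((hV v).1 hv)
    obtain ⟨i, j⟩ := v
    have z : ∀ x y : Site, 0 ≤ differ σ x y := differ_nonneg σ
    have o : ∀ x y : Site, σ x ≠ σ y → differ σ x y = 1 := fun x y h => if_neg h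
    simp only [Prod.mk_add_mk, add_zero, ← sub_eq_add_neg,
      sub_add_cancel] at h1 h2 ⊢
    have t1 := mul_nonneg (z (i - 1, j - 1) (i, j - 1)) (z (i, j - 1) (i, j))
    have t2 := mul_nonneg (z (i - 1, j) (i, j)) (z (i, j) (i, j - 1))
    have t3 := mul_nonneg (z (i, j - 1) (i - 1, j - 1)) (z (i - 1, j - 1) (i - 1, j))
    have t4 := mul_nonneg (z (i, j) (i - 1, j)) (z (i - 1, j) (i - 1, j - 1))
    rcases h1 with h1 | h1 <;> rcases h2 with h2 | h2
    · rw [o _ _ h2, o _ _ h1.symm]; linarith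
    · rw [o _ _ h1, o _ _ h2]; linarith
    · rw [o _ _ h1.symm, o _ _ h2.symm]; linarith
    · rw [o _ _ h1, o _ _ h2.symm]; linarith
  · have z : ∀ x y : Site, 0 ≤ differ σ x y := differ_nonneg σ
    have t : ∀ a b c d : Site, 0 ≤ differ σ a b * differ σ c d := fun a b c d =>
      mul_nonneg (z _ _) (z _ _)
    exact add_nonneg (add_nonneg (add_nonneg (t _ _ _ _) (t _ _ _ _)) (t _ _ _ _)) (t _ _ _ _)

lemma card_cornerVertices_le_tsum {p : ℝ} (hp : 3 < p) (hX : ∀ x ∉ X, σ x = ρ x)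
    (hρ : ∀ x y : Site, x.1 = y.1 → ρ x = ρ y) {V : Finset (ℤ × ℤ)}
    (hV : ∀ v, v ∈ V ↔ IsCornerVertex σ v) :
    2 ^ (-p) * (V.card : ℝ) ≤ ∑' n, kernel p n * doubleChanges σ n := by
  have hs : Summable fun n => kernel p n * doubleChanges σ n :=
    summable_mul_of_bounded (summable_kernel hp) (kernel_nonneg p) (abs_doubleChanges_le hX hρ)
  have h0 : ∀ n, 0 ≤ kernel p n * doubleChanges σ n := fun n =>
    mul_nonneg (kernel_nonneg p n) (doubleChanges_nonneg n)
  have k1 : ∀ b : ℤ, |b| ≤ 1 → (2 : ℝ) ^ (-p) ≤ kernel p (1, b) := by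
    intro b hb
    have := le_kernel (by linarith : 0 ≤ p) le_rfl hb
    simpa using this
  have k2 : ∀ b : ℤ, |b| ≤ 1 → (2 : ℝ) ^ (-p) ≤ kernel p (-1, b) := by
    intro b hb
    have := k1 (-b) (by rwa [abs_neg])
    rw [← kernel_neg] at this
    simpa using this
  refine le_trans ?_ (hs.sum_le_tsum {((1, 1) : ℤ × ℤ), (1, -1), (-1, 1), (-1, -1)} fun n _ => h0 n)
  rw [Finset.sum_insert (by decide), Finset.sum_insert (by decide), Finset.sum_insert (by decide),
    Finset.sum_singleton]
  have hm : ∀ n : ℤ × ℤ, (2 : ℝ) ^ (-p) ≤ kernel p n →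
      2 ^ (-p) * doubleChanges σ n ≤ kernel p n * doubleChanges σ n := fun n h =>
    mul_le_mul_of_nonneg_right h (doubleChanges_nonneg n)
  have a1 := hm (1, 1) (k1 _ (by simp))
  have a2 := hm (1, -1) (k1 _ (by simp))
  have a3 := hm (-1, 1) (k2 _ (by simp))
  have a4 := hm (-1, -1) (k2 _ (by simp))
  have := mul_le_mul_of_nonneg_left (card_cornerVertices_le hX hρ hV)
    (Real.rpow_nonneg zero_le_two (-p))
  linarith

end corners

lemma exists_isKink {τ : ℤ → ℤˣ} {i j : ℤ} (h : τ i ≠ τ j) : ∃ k, IsKink τ k := by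
  by_contra hc
  push Not at hc
  have hc' : ∀ k, τ (k - 1) = τ k := fun k => by_contra (hc k)
  have : ∀ k, τ k = τ i := by
    intro k
    induction k using Int.inductionOn' (b := i) with
    | zero => rfl
    | succ k _ ih => rw [← ih, ← hc' (k + 1), add_sub_cancel_right]
    | pred k _ ih => rw [← ih, hc' k]
  exact h (this j).symm

/-- The energy of a finite perturbation of a striped configuration is bounded from below by a sum
of local stripe energies, up to a cost for each column that is not constant; every corner
costs a positive energy. -/
theorem energy_sub_ge {p : ℝ} (hp : 3 < p) (J : ℝ) {h : ℕ} (hh : 1 ≤ h) {σ : Config}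
    {X : Finset Site} (hX : ∀ x ∉ X, σ x = stripe h x) :
    ∃ (S : Finset Site) (Q : Finset ℤ) (V : Finset (ℤ × ℤ)),
      (∀ c ∈ Q, ∃ j, IsKink (colOf σ c) j) ∧ (∀ v, v ∈ V ↔ IsCornerVertex σ v) ∧
      (∀ x ∉ S, hWidth σ x = h ∧ vWidth σ x = 0) ∧
      ∑ x ∈ S, (stripeEnergy p J (hWidth σ x) - stripeEnergy p J h +
          stripeEnergy p J (vWidth σ x)) -
        2 * (Jc p - J) * Q.card + 2 * 2 ^ (-p) * V.card ≤
      energy p J X σ (stripe h) - energy p J X (stripe h) (stripe h) := by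
  classical
  have hρ : ∀ x y : Site, x.1 = y.1 → stripe h x = stripe h y := fun x y hxy => by
    rw [stripe_eq hh, stripe_eq hh, hxy]
  have hrowρ : ∀ r, rowOf (stripe h) r = stripeRow h := fun r => funext fun i => stripe_eq hh _
  have hcolρ : ∀ c, colOf (stripe h) c = fun _ => stripeRow h c := fun c =>
    funext fun i => stripe_eq hh _
  have hrow : ∀ r i, i ∉ X.image Prod.fst → rowOf σ r i = stripeRow h i := fun r i hi =>
    (hX _ fun h => hi (Finset.mem_image_of_mem Prod.fst h)).trans (stripe_eq hh _)
  have hcol : ∀ c j, j ∉ X.image Prod.snd → colOf σ c j = stripeRow h c := fun c j hj =>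
    (hX _ fun h => hj (Finset.mem_image_of_mem Prod.snd h)).trans (stripe_eq hh _)
  have hE := energy_sub_eq hp J hX hρ
  simp only [hrowρ, hcolρ] at hE
  choose W hW1 hW2 using fun r => row_lineEnergy_ge hp J hh (hrow r)
  choose W' hW1' hW2' using fun c => column_lineEnergy_ge hp J (hcol c)
  set R := X.image Prod.snd with hR
  set K := X.image Prod.fst with hK
  set S : Finset Site := R.biUnion (fun r => (W r).image fun i => (i, r)) ∪
    K.biUnion (fun c => (W' c).image fun j => (c, j)) with hS
  set Q := K.filter fun c => ∃ i, colOf σ c i ≠ stripeRow h c with hQ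
  have hV := finite_cornerVertices hX hρ
  have houtH : ∀ x : Site, (x.2 ∈ R → x.1 ∉ W x.2) → hWidth σ x = h := by
    intro x hx
    unfold hWidth
    by_cases h2 : x.2 ∈ R
    · exact hW1 _ _ (hx h2)
    · have : rowOf σ x.2 = stripeRow h := by
        funext i
        exact (hX (i, x.2) fun hi => h2 (Finset.mem_image.2 ⟨_, hi, rfl⟩)).trans (stripe_eq hh _)
      rw [this, width_stripeRow hh]
  have houtV : ∀ x : Site, (x.1 ∈ K → x.2 ∉ W' x.1) → vWidth σ x = 0 := by
    intro x hx
    unfold vWidth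
    by_cases h2 : x.1 ∈ K
    · exact hW1' _ _ (hx h2)
    · have : ∀ j, colOf σ x.1 j = stripeRow h x.1 := by
        intro i
        exact (hX (x.1, i) fun hi => h2 (Finset.mem_image.2 ⟨_, hi, rfl⟩)).trans (stripe_eq hh _)
      exact width_eq_zero_of_ge fun j _ => by rw [this, this]
  refine ⟨S, Q, hV.toFinset, fun c hc => ?_, fun v => by simp, fun x hx => ?_, ?_⟩
  · obtain ⟨i, hi⟩ := (Finset.mem_filter.1 hc).2
    obtain ⟨j, hj⟩ := Infinite.exists_notMem_finset R
    exact exists_isKink (i := i) (j := j) (by rwa [hcol c j hj])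
  · simp only [hS, Finset.mem_union, Finset.mem_biUnion, Finset.mem_image, not_or, not_exists,
      not_and] at hx
    exact ⟨houtH x fun h2 h1 => hx.1 _ h2 _ h1 rfl, houtV x fun h1 h2 => hx.2 _ h1 _ h2 rfl⟩
  · have hrowsum : ∑ x ∈ S, (stripeEnergy p J (hWidth σ x) - stripeEnergy p J h) =
        ∑ r ∈ R, ∑ i ∈ W r, (stripeEnergy p J (width (rowOf σ r) i) - stripeEnergy p J h) := by
      rw [← Finset.sum_subset (Finset.subset_union_left (s₂ :=
        K.biUnion (fun c => (W' c).image fun j => ((c, j) : Site)))), Finset.sum_biUnion]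
      · refine Finset.sum_congr rfl fun r _ => ?_
        rw [Finset.sum_image]
        · rfl
        · intro a _ b _ hab
          exact (Prod.ext_iff.1 hab).1
      · intro r _ r' _ hrr'
        rw [Function.onFun, Finset.disjoint_left]
        intro x hx hx'
        obtain ⟨i, _, rfl⟩ := Finset.mem_image.1 hx
        obtain ⟨i', _, h'⟩ := Finset.mem_image.1 hx'
        exact hrr' (Prod.ext_iff.1 h').2.symm
      · intro x _ hx
        simp only [Finset.mem_biUnion, Finset.mem_image, not_exists, not_and] at hx
        rw [houtH x fun h2 h1 => hx _ h2 _ h1 rfl, sub_self]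
    have hcolsum : ∑ x ∈ S, stripeEnergy p J (vWidth σ x) =
        ∑ c ∈ K, ∑ j ∈ W' c, stripeEnergy p J (width (colOf σ c) j) := by
      rw [← Finset.sum_subset (Finset.subset_union_right (s₁ :=
        R.biUnion (fun r => (W r).image fun i => ((i, r) : Site)))), Finset.sum_biUnion]
      · refine Finset.sum_congr rfl fun r _ => ?_
        rw [Finset.sum_image]
        · rfl
        · intro a _ b _ hab
          exact (Prod.ext_iff.1 hab).2
      · intro r _ r' _ hrr'
        rw [Function.onFun, Finset.disjoint_left]
        intro x hx hx'
        obtain ⟨i, _, rfl⟩ := Finset.mem_image.1 hx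
        obtain ⟨i', _, h'⟩ := Finset.mem_image.1 hx'
        exact hrr' (Prod.ext_iff.1 h').1.symm
      · intro x _ hx
        simp only [Finset.mem_biUnion, Finset.mem_image, not_exists, not_and] at hx
        rw [houtV x fun h1 h2 => hx _ h1 _ h2 rfl, stripeEnergy_eq hp,
          lineEnergy_stripeDensity_zero]
    have hcost : ∑ c ∈ K, (if ∃ i, colOf σ c i ≠ stripeRow h c then 2 * (Jc p - J) else 0) =
        2 * (Jc p - J) * Q.card := by
      rw [← Finset.sum_filter, Finset.sum_const, nsmul_eq_mul, mul_comm]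
    have hr := Finset.sum_le_sum fun r (_ : r ∈ R) => hW2 r
    have hc := Finset.sum_le_sum fun c (_ : c ∈ K) => hW2' c
    rw [Finset.sum_sub_distrib, hcost] at hc
    have hcorner := card_cornerVertices_le_tsum (V := hV.toFinset) hp hX hρ fun v => by simp
    rw [Finset.sum_add_distrib, hrowsum, hcolsum, hE]
    simp only [stripeEnergy_eq hp]
    linarith

/-! ### Bounds on the energy per site of stripes -/

lemma summable_lineKernel_mul_sub {p : ℝ} (hp : 3 < p) (h : ℕ) :
    Summable fun n : ℕ => lineKernel p n * ((n : ℝ) / h - stripeDensity h n) := by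
  have h1 : Summable fun n : ℕ => (n : ℝ) * lineKernel p n / h :=
    (summable_natMul_lineKernel hp).div_const _
  refine (h1.sub (summable_lineKernel_mul hp (abs_stripeDensity_le h))).congr fun n => ?_
  ring

/-- The energy per site is the energy `-2 (J_c - J)` per unit length of isolated domain walls,
increased by the repulsion between the walls. -/
lemma stripeEnergy_eq_add {p : ℝ} (hp : 3 < p) (J : ℝ) (h : ℕ) :
    stripeEnergy p J h = -(2 * (Jc p - J)) / h +
      ∑' n : ℕ, lineKernel p n * ((n : ℝ) / h - stripeDensity h n) := by
  have h1 : Summable fun n : ℕ => (n : ℝ) * lineKernel p n / h :=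
    (summable_natMul_lineKernel hp).div_const _
  have h2 := summable_lineKernel_mul hp (abs_stripeDensity_le h)
  have h3 : ∑' n : ℕ, lineKernel p n * ((n : ℝ) / h - stripeDensity h n) =
      2 * Jc p / h - ∑' n : ℕ, lineKernel p n * stripeDensity h n := by
    rw [two_mul_Jc hp, ← tsum_div_const, ← h1.tsum_sub h2]
    refine tsum_congr fun n => ?_
    ring
  rw [stripeEnergy_eq hp, h3]
  unfold lineEnergy
  rw [stripeDensity_one_right]
  ring

lemma neg_le_stripeEnergy {p : ℝ} (hp : 3 < p) (J : ℝ) (h : ℕ) :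
    -(2 * (Jc p - J)) / h ≤ stripeEnergy p J h := by
  rw [stripeEnergy_eq_add hp]
  refine le_add_of_nonneg_right (tsum_nonneg fun n => mul_nonneg (lineKernel_nonneg _ _) ?_)
  exact sub_nonneg.2 (stripeDensity_le n)

lemma stripeEnergy_zero {p : ℝ} (hp : 3 < p) (J : ℝ) : stripeEnergy p J 0 = 0 := by
  rw [stripeEnergy_eq hp, lineEnergy_stripeDensity_zero]

lemma stripeEnergy_le {p : ℝ} (hp : 4 ≤ p) (J : ℝ) {h : ℕ} (hh : 1 ≤ h) :
    stripeEnergy p J h ≤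
      (-(2 * (Jc p - J)) + lineConst p * 2 ^ (p - 2) * (h : ℝ) ^ (3 - p)) / h := by
  have hp3 : 3 < p := by linarith
  have hpos : (0 : ℝ) < h := by exact_mod_cast hh
  obtain ⟨ht, htle⟩ := summable_tail_rpow (by linarith : 2 ≤ p - 2) hh
  have hs := summable_lineKernel_mul_sub hp3 h
  rw [stripeEnergy_eq_add hp3, add_div, add_le_add_iff_left]
  rw [← hs.sum_add_tsum_nat_add h]
  have h1 : ∑ n ∈ Finset.range h, lineKernel p n * ((n : ℝ) / h - stripeDensity h n) ≤ 0 := by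
    refine Finset.sum_nonpos fun n hn => ?_
    refine mul_nonpos_of_nonneg_of_nonpos (lineKernel_nonneg _ _) ?_
    exact sub_nonpos.2 (le_stripeDensity hh (Finset.mem_range.1 hn).le)
  have h2 : ∑' n : ℕ, lineKernel p ((n + h : ℕ) : ℤ) *
      (((n + h : ℕ) : ℝ) / h - stripeDensity h ((n + h : ℕ) : ℤ)) ≤
      ∑' k : ℕ, lineConst p / h * ((h + k : ℕ) : ℝ) ^ (-(p - 2)) := by
    refine ((summable_nat_add_iff h).2 hs).tsum_le_tsum (fun k => ?_) (ht.mul_left _)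
    have hk : 1 ≤ k + h := by omega
    have hkpos : (0 : ℝ) < ((k + h : ℕ) : ℝ) := by exact_mod_cast hk
    have a1 : lineKernel p ((k + h : ℕ) : ℤ) ≤ lineConst p * ((k + h : ℕ) : ℝ) ^ (1 - p) :=
      lineKernel_le (by linarith) hk
    have a2 : ((k + h : ℕ) : ℝ) / h - stripeDensity h ((k + h : ℕ) : ℤ) ≤ ((k + h : ℕ) : ℝ) / h := by
      linarith [stripeDensity_nonneg h ((k + h : ℕ) : ℤ)]
    have a3 : 0 ≤ ((k + h : ℕ) : ℝ) / h - stripeDensity h ((k + h : ℕ) : ℤ) :=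
      sub_nonneg.2 (stripeDensity_le _)
    refine (mul_le_mul a1 a2 a3 (by have := lineConst_pos p; positivity)).trans (le_of_eq ?_)
    rw [show -(p - 2) = (1 - p) + 1 by ring, add_comm h k, Real.rpow_add hkpos, Real.rpow_one]
    ring
  rw [tsum_mul_left] at h2
  have h3 : lineConst p / h * ∑' k : ℕ, ((h + k : ℕ) : ℝ) ^ (-(p - 2)) ≤
      lineConst p / h * (2 ^ (p - 2) * (h : ℝ) ^ (1 - (p - 2))) :=
    mul_le_mul_of_nonneg_left htle (div_nonneg (lineConst_pos p).le hpos.le)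
  rw [show 1 - (p - 2) = 3 - p by ring] at h3
  calc _ ≤ 0 + lineConst p / h * (2 ^ (p - 2) * (h : ℝ) ^ (3 - p)) := add_le_add h1 (h2.trans h3)
    _ = _ := by ring

lemma le_stripeEnergy {p : ℝ} (hp : 3 < p) (J : ℝ) {h : ℕ} (hh : 1 ≤ h) :
    -(2 * (Jc p - J)) / h + h * (6 * (h : ℝ)) ^ (1 - p) ≤ stripeEnergy p J h := by
  have hpos : (0 : ℝ) < h := by exact_mod_cast hh
  rw [stripeEnergy_eq_add hp, add_le_add_iff_left]
  refine le_trans ?_ ((summable_lineKernel_mul_sub hp h).sum_le_tsum (Finset.Ico (2 * h) (3 * h))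
    fun n _ => mul_nonneg (lineKernel_nonneg _ _) (sub_nonneg.2 (stripeDensity_le n)))
  have hcard : (h : ℝ) * (6 * (h : ℝ)) ^ (1 - p) =
      ∑ n ∈ Finset.Ico (2 * h) (3 * h), (6 * (h : ℝ)) ^ (1 - p) := by
    rw [Finset.sum_const, Nat.card_Ico, nsmul_eq_mul]
    congr 2
    omega
  rw [hcard]
  refine Finset.sum_le_sum fun n hn => ?_
  obtain ⟨hn1, hn2⟩ := Finset.mem_Ico.1 hn
  have hn1' : (2 : ℝ) * h ≤ n := by exact_mod_cast hn1
  have hn2' : (n : ℝ) ≤ 3 * h := by exact_mod_cast hn2.le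
  have a1 : (2 : ℝ) ^ (1 - p) * (n : ℝ) ^ (1 - p) ≤ lineKernel p n :=
    le_lineKernel (by linarith) (by omega)
  have a2 : (6 * (h : ℝ)) ^ (1 - p) ≤ (2 : ℝ) ^ (1 - p) * (n : ℝ) ^ (1 - p) := by
    rw [← Real.mul_rpow zero_le_two (by linarith)]
    exact Real.rpow_le_rpow_of_nonpos (by linarith) (by linarith) (by linarith)
  have a3 : 1 ≤ (n : ℝ) / h - stripeDensity h n := by
    have : 2 ≤ (n : ℝ) / h := by rwa [le_div_iff₀ hpos]
    linarith [stripeDensity_le_one h n]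
  exact (a2.trans a1).trans (le_mul_of_one_le_right (lineKernel_nonneg _ _) a3)

/-- The minimal energy per site is of order `-(J_c - J) ^ ((p - 2) / (p - 3))`, and the optimal
width is at least of order `(J_c - J) ^ (-1 / (p - 3))`. -/
lemma exists_optimal_bounds {p : ℝ} (hp : 4 ≤ p) : ∃ c : ℝ, 0 < c ∧
    ∀ J : ℝ, Jc p - 1 < J → J < Jc p → ∀ hs : ℕ, IsOptimalWidth p J hs →
      c * (Jc p - J) ^ ((p - 2) / (p - 3)) ≤ -stripeEnergy p J hs ∧
      c * (Jc p - J) ≤ hs * -stripeEnergy p J hs := by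
  set A := lineConst p * 2 ^ (p - 2) with hA
  have hA0 : 0 < A := mul_pos (lineConst_pos p) (by positivity)
  set q := p - 3 with hq
  have hq0 : 0 < q := by linarith
  set K := A ^ q⁻¹ + 1 with hK
  have hK1 : 0 < K := by positivity
  set B := (2 * 6 ^ (p - 1) : ℝ) with hB
  have hB0 : 0 < B := by positivity
  refine ⟨min K⁻¹ (K⁻¹ * B ^ (-q⁻¹)), by positivity, fun J hJ1 hJ2 hs hopt => ?_⟩
  set τ := Jc p - J with hτ
  have hτ0 : 0 < τ := by linarith
  have hτ1 : τ ≤ 1 := by linarith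
  have hτq : 1 ≤ τ ^ (-q⁻¹) := Real.one_le_rpow_of_pos_of_le_one_of_nonpos hτ0 hτ1
    (by rw [neg_nonpos]; positivity)
  have hexp : (p - 2) / q = 1 + q⁻¹ := by
    rw [show p - 2 = q + 1 by rw [hq]; ring]; field_simp
  have hτpow : τ ^ ((p - 2) / q) = τ * τ ^ q⁻¹ := by
    rw [hexp, Real.rpow_add hτ0, Real.rpow_one]
  -- a competitor whose width balances the two terms of the upper bound
  have hcomp : -stripeEnergy p J hs ≥ K⁻¹ * τ ^ ((p - 2) / q) := by
    set k := ⌈A ^ q⁻¹ * τ ^ (-q⁻¹)⌉₊ with hk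
    have hkpos : 0 < A ^ q⁻¹ * τ ^ (-q⁻¹) := by positivity
    have hk1 : 1 ≤ k := Nat.one_le_iff_ne_zero.2 (Nat.ceil_pos.2 hkpos).ne'
    have hklow : A ^ q⁻¹ * τ ^ (-q⁻¹) ≤ k := Nat.le_ceil _
    have hkup : (k : ℝ) ≤ K * τ ^ (-q⁻¹) := by
      have := (Nat.ceil_lt_add_one hkpos.le).le
      rw [hK, add_mul, one_mul]
      linarith
    have hkr : (0 : ℝ) < k := by exact_mod_cast hk1
    have hrep : A * (k : ℝ) ^ (3 - p) ≤ τ := by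
      have h1 : (k : ℝ) ^ (3 - p) ≤ (A ^ q⁻¹ * τ ^ (-q⁻¹)) ^ (3 - p) :=
        Real.rpow_le_rpow_of_nonpos hkpos hklow (by linarith)
      have h2 : (A ^ q⁻¹ * τ ^ (-q⁻¹)) ^ (3 - p) = A⁻¹ * τ := by
        rw [Real.mul_rpow (by positivity) (by positivity), ← Real.rpow_mul hA0.le,
          ← Real.rpow_mul hτ0.le, show q⁻¹ * (3 - p) = -1 by
            rw [show 3 - p = -q by rw [hq]; ring]; field_simp,
          show -q⁻¹ * (3 - p) = 1 by rw [show 3 - p = -q by rw [hq]; ring]; field_simp,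
          Real.rpow_one, Real.rpow_neg_one]
      rw [h2] at h1
      calc A * (k : ℝ) ^ (3 - p) ≤ A * (A⁻¹ * τ) := mul_le_mul_of_nonneg_left h1 hA0.le
        _ = τ := by field_simp
    have h3 : stripeEnergy p J k ≤ -(τ / k) := by
      refine (stripeEnergy_le hp J hk1).trans ?_
      rw [← neg_div]
      refine div_le_div_of_nonneg_right ?_ hkr.le
      linarith
    have h4 : K⁻¹ * τ ^ ((p - 2) / q) ≤ τ / k := by
      rw [le_div_iff₀ hkr, hτpow]
      calc K⁻¹ * (τ * τ ^ q⁻¹) * k ≤ K⁻¹ * (τ * τ ^ q⁻¹) * (K * τ ^ (-q⁻¹)) := by gcongr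
        _ = (K⁻¹ * K) * τ * (τ ^ q⁻¹ * τ ^ (-q⁻¹)) := by ring
        _ = τ := by
            rw [← Real.rpow_add hτ0, add_neg_cancel, Real.rpow_zero, inv_mul_cancel₀ hK1.ne']
            ring
    have := hopt.2 k hk1
    linarith
  have hspos : (0 : ℝ) < hs := by exact_mod_cast hopt.1
  have hneg : 0 ≤ -stripeEnergy p J hs := le_trans (by positivity) hcomp
  have hwidth : B ^ (-q⁻¹) * τ ^ (-q⁻¹) ≤ hs := by
    have h1 := le_stripeEnergy (by linarith : 3 < p) J hopt.1
    have h2 : hs * (6 * (hs : ℝ)) ^ (1 - p) ≤ 2 * τ / hs := by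
      have : -(2 * τ) / (hs : ℝ) = -(2 * τ / hs) := neg_div _ _
      linarith
    rw [le_div_iff₀ hspos, Real.mul_rpow (by norm_num) hspos.le] at h2
    have h3 : (hs : ℝ) ^ (3 - p) ≤ B * τ := by
      have e1 : (hs : ℝ) ^ (3 - p) = hs ^ (1 - p) * hs * hs := by
        rw [show 3 - p = (1 - p) + 1 + 1 by ring, Real.rpow_add hspos, Real.rpow_add hspos,
          Real.rpow_one]
      have e2 : (6 : ℝ) ^ (p - 1) * 6 ^ (1 - p) = 1 := by
        rw [← Real.rpow_add (by norm_num)]; norm_num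
      calc (hs : ℝ) ^ (3 - p) = (6 : ℝ) ^ (p - 1) * 6 ^ (1 - p) * (hs ^ (1 - p) * hs * hs) := by
            rw [e1, e2, one_mul]
        _ = (6 : ℝ) ^ (p - 1) * (hs * (6 ^ (1 - p) * hs ^ (1 - p)) * hs) := by ring
        _ ≤ (6 : ℝ) ^ (p - 1) * (2 * τ) := by gcongr
        _ = B * τ := by rw [hB]; ring
    rw [← Real.mul_rpow hB0.le hτ0.le]
    have h4 := Real.rpow_le_rpow_of_nonpos (Real.rpow_pos_of_pos hspos _) h3
      (by rw [neg_nonpos]; positivity : -q⁻¹ ≤ 0)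
    rwa [← Real.rpow_mul hspos.le, show (3 - p) * -q⁻¹ = 1 by
      rw [show 3 - p = -q by rw [hq]; ring]; field_simp, Real.rpow_one] at h4
  refine ⟨le_trans (by gcongr; exact min_le_left _ _) hcomp, ?_⟩
  calc min K⁻¹ (K⁻¹ * B ^ (-q⁻¹)) * τ ≤ K⁻¹ * B ^ (-q⁻¹) * τ := by
        gcongr
        exact min_le_right _ _
    _ = (B ^ (-q⁻¹) * τ ^ (-q⁻¹)) * (K⁻¹ * (τ * τ ^ q⁻¹)) := by
        have : τ ^ (-q⁻¹) * τ ^ q⁻¹ = 1 := by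
          rw [← Real.rpow_add hτ0, neg_add_cancel, Real.rpow_zero]
        calc K⁻¹ * B ^ (-q⁻¹) * τ = K⁻¹ * B ^ (-q⁻¹) * τ * (τ ^ (-q⁻¹) * τ ^ q⁻¹) := by
              rw [this, mul_one]
          _ = _ := by ring
    _ ≤ hs * -stripeEnergy p J hs := by
        rw [← hτpow]
        exact mul_le_mul hwidth hcomp (by positivity) hspos.le

/-! ### Counting the ends of runs -/

/-- Each run that meets the finite set `A` contributes at most `1` to the sum of the inverse
widths, and it has a highest site in `A`. -/
lemma sum_inv_vWidth_le (σ : Config) (A : Finset Site) :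
    ∑ x ∈ A, 1 / (vWidth σ x : ℝ) ≤
      ((A.filter fun x => (x.1, x.2 + 1) ∉ A ∨ σ (x.1, x.2 + 1) ≠ σ x).card : ℝ) := by
  classical
  have hm : ∀ x : Site, ∃ z : Site, x ∈ A → z ∈ A ∧ z.1 = x.1 ∧ z.2 ∈ run (colOf σ x.1) x.2 ∧
      ∀ y ∈ A, y.1 = x.1 → y.2 ∈ run (colOf σ x.1) x.2 → y.2 ≤ z.2 := by
    intro x
    by_cases hx : x ∈ A
    · obtain ⟨z, hz, hmax⟩ := Finset.exists_max_image
        (A.filter fun y => y.1 = x.1 ∧ y.2 ∈ run (colOf σ x.1) x.2) Prod.snd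
        ⟨x, Finset.mem_filter.2 ⟨hx, rfl, mem_run_self _ _⟩⟩
      obtain ⟨hzA, hz1, hz2⟩ := Finset.mem_filter.1 hz
      exact ⟨z, fun _ => ⟨hzA, hz1, hz2, fun y hy h1 h2 =>
        hmax y (Finset.mem_filter.2 ⟨hy, h1, h2⟩)⟩⟩
    · exact ⟨x, fun h => absurd h hx⟩
  choose m hm using hm
  set D := A.filter fun x => (x.1, x.2 + 1) ∉ A ∨ σ (x.1, x.2 + 1) ≠ σ x with hD
  have hmaps : ∀ x ∈ A, m x ∈ D := by
    intro x hx
    obtain ⟨h1, h2, h3, h4⟩ := hm x hx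
    refine Finset.mem_filter.2 ⟨h1, ?_⟩
    by_contra hc
    push Not at hc
    obtain ⟨c1, c2⟩ := hc
    have h5 : (m x).2 + 1 ∈ run (colOf σ x.1) (m x).2 := succ_mem_run (by
      unfold colOf; rw [← h2]; exact c2)
    rw [run_eq_of_mem h3] at h5
    have := h4 _ c1 h2 h5
    simp at this
  rw [← Finset.sum_fiberwise_of_maps_to hmaps]
  have hcard : (D.card : ℝ) = ∑ z ∈ D, 1 := by simp
  rw [hcard]
  refine Finset.sum_le_sum fun z _ => ?_
  have hw : ∀ x ∈ A.filter (fun x => m x = z), vWidth σ x = vWidth σ z := by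
    intro x hx
    obtain ⟨hxA, rfl⟩ := Finset.mem_filter.1 hx
    obtain ⟨_, h2, h3, _⟩ := hm x hxA
    unfold vWidth
    rw [h2, width_eq_of_mem h3]
  rw [Finset.sum_congr rfl fun x hx => by rw [hw x hx], Finset.sum_const, nsmul_eq_mul]
  rcases Nat.eq_zero_or_pos (vWidth σ z) with h0 | hpos
  · rw [h0]; simp
  · rw [mul_one_div, div_le_one (by exact_mod_cast hpos)]
    have hfin : (run (colOf σ z.1) z.2).Finite := Set.finite_of_ncard_pos hpos
    have hcard : (A.filter fun x => m x = z).card ≤ (run (colOf σ z.1) z.2).ncard := by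
      rw [← Set.ncard_coe_finset]
      refine Set.ncard_le_ncard_of_injOn Prod.snd ?_ ?_ hfin
      · intro x hx
        obtain ⟨hxA, rfl⟩ := Finset.mem_filter.1 hx
        obtain ⟨_, h2, h3, _⟩ := hm x hxA
        rw [h2, run_eq_of_mem h3]
        exact mem_run_self _ _
      · intro x hx y hy hxy
        obtain ⟨hxA, hxz⟩ := Finset.mem_filter.1 hx
        obtain ⟨hyA, hyz⟩ := Finset.mem_filter.1 hy
        have hx1 := (hm x hxA).2.1
        have hy1 := (hm y hyA).2.1
        rw [hxz] at hx1
        rw [hyz] at hy1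
        exact Prod.ext (hx1.symm.trans hy1) hxy
    exact_mod_cast hcard

/-! ### Tiles -/

/-- The index of the tile that contains the site `x`. -/
def tileIndex (o : Site) (ℓ : ℕ) (x : Site) : ℤ × ℤ := ((x.1 - o.1) / ℓ, (x.2 - o.2) / ℓ)

lemma ediv_eq_iff_bounds {ℓ : ℕ} (hℓ : 1 ≤ ℓ) (a k : ℤ) :
    a / (ℓ : ℤ) = k ↔ ℓ * k ≤ a ∧ a < ℓ * k + ℓ := by
  have hpos : (0 : ℤ) < ℓ := by exact_mod_cast hℓ
  constructor
  · rintro rfl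
    have h1 := Int.mul_ediv_add_emod a ℓ
    have h2 := Int.emod_nonneg a hpos.ne'
    have h3 := Int.emod_lt_of_pos a hpos
    constructor <;> linarith
  · rintro ⟨h1, h2⟩
    refine le_antisymm ?_ ?_
    · rw [← Int.lt_add_one_iff]
      exact Int.ediv_lt_of_lt_mul hpos (by linarith)
    · exact Int.le_ediv_of_mul_le hpos (by linarith)

lemma tileIndex_eq_iff {o : Site} {ℓ : ℕ} (hℓ : 1 ≤ ℓ) (x : Site) (k : ℤ × ℤ) :
    tileIndex o ℓ x = k ↔ (o.1 + ℓ * k.1 ≤ x.1 ∧ x.1 < o.1 + ℓ * k.1 + ℓ) ∧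
      (o.2 + ℓ * k.2 ≤ x.2 ∧ x.2 < o.2 + ℓ * k.2 + ℓ) := by
  unfold tileIndex
  rw [Prod.ext_iff, ediv_eq_iff_bounds hℓ, ediv_eq_iff_bounds hℓ]
  constructor
  · rintro ⟨⟨_, _⟩, _, _⟩
    refine ⟨⟨?_, ?_⟩, ?_, ?_⟩ <;> linarith
  · rintro ⟨⟨_, _⟩, _, _⟩
    refine ⟨⟨?_, ?_⟩, ?_, ?_⟩ <;> linarith

lemma mem_tile_iff {o : Site} {ℓ : ℕ} (hℓ : 1 ≤ ℓ) (x : Site) (k : ℤ × ℤ) :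
    x ∈ tile o ℓ k ↔ tileIndex o ℓ x = k := by
  rw [tileIndex_eq_iff hℓ]
  unfold tile rect
  simp only [Set.mem_ofPred_eq, and_assoc]

/-- The sites of a tile as a finite set. -/
noncomputable def tileSites (o : Site) (ℓ : ℕ) (k : ℤ × ℤ) : Finset Site :=
  Finset.Ico (o.1 + ℓ * k.1) (o.1 + ℓ * k.1 + ℓ) ×ˢ Finset.Ico (o.2 + ℓ * k.2) (o.2 + ℓ * k.2 + ℓ)

lemma mem_tileSites {o : Site} {ℓ : ℕ} (hℓ : 1 ≤ ℓ) (x : Site) (k : ℤ × ℤ) :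
    x ∈ tileSites o ℓ k ↔ tileIndex o ℓ x = k := by
  rw [tileIndex_eq_iff hℓ]
  simp [tileSites, and_assoc]

lemma tileIndex_up {o : Site} {ℓ : ℕ} (hℓ : 1 ≤ ℓ) (x : Site) :
    tileIndex o ℓ (x.1, x.2 + 1) = tileIndex o ℓ x ∧
        x.2 + 1 < o.2 + ℓ * (tileIndex o ℓ x).2 + ℓ ∨
      tileIndex o ℓ (x.1, x.2 + 1) = tileIndex o ℓ x + (0, 1) ∧
        x.2 + 1 = o.2 + ℓ * (tileIndex o ℓ x).2 + ℓ := by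
  obtain ⟨⟨h1, h2⟩, h3, h4⟩ := (tileIndex_eq_iff (o := o) hℓ x _).1 rfl
  rcases lt_or_eq_of_le (Int.add_one_le_of_lt h4) with h | h
  · left
    refine ⟨(tileIndex_eq_iff hℓ _ _).2 ⟨⟨h1, h2⟩, ?_, h⟩, h⟩
    show _ ≤ x.2 + 1
    linarith
  · right
    refine ⟨(tileIndex_eq_iff hℓ _ _).2 ⟨⟨?_, ?_⟩, ?_, ?_⟩, h⟩
    · simpa using h1
    · simpa using h2
    · show o.2 + ℓ * ((tileIndex o ℓ x).2 + 1) ≤ x.2 + 1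
      rw [h]; linarith
    · show x.2 + 1 < o.2 + ℓ * ((tileIndex o ℓ x).2 + 1) + ℓ
      have : (1 : ℤ) ≤ ℓ := by exact_mod_cast hℓ
      rw [h]; linarith

/-- The sum of the inverse vertical widths over a family `M` of tiles, when there are no horizontal
walls in the tiles of `M` outside a finite set of bad tiles, and when a tile of `M` lies below
another tile of `M` unless one of them is bad. -/
lemma sum_inv_vWidth_tiles_le {σ : Config} {o : Site} {ℓ : ℕ} (hℓ : 1 ≤ ℓ) {M : ℤ × ℤ → Prop}
    {bad : Finset (ℤ × ℤ)} {P : ℤ × ℤ → ℕ}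
    (hfree : ∀ x, tileIndex o ℓ x ∉ bad → M (tileIndex o ℓ x) → σ x = -1 →
      σ (x.1, x.2 + 1) = -1 ∧ σ (x.1, x.2 - 1) = -1)
    (hup : ∀ k, k ∉ bad → k + (0, 1) ∉ bad → M k → M (k + (0, 1)))
    (hP : ∀ k ∈ bad, M k → ((tileSites o ℓ k).filter fun x =>
      (x.1, x.2 + 1) ∈ tileSites o ℓ k ∧ σ (x.1, x.2 + 1) ≠ σ x).card ≤ ℓ * P k)
    {A : Finset Site} (hA : ∀ x, x ∈ A ↔ M (tileIndex o ℓ x) ∧ vWidth σ x ≠ 0) :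
    ∑ x ∈ A, 1 / (vWidth σ x : ℝ) ≤ ∑ k ∈ bad, (2 * ℓ + ℓ * P k : ℝ) := by
  classical
  refine (sum_inv_vWidth_le σ A).trans ?_
  set E : ℤ × ℤ → Finset Site := fun k =>
    (Finset.Ico (o.1 + ℓ * k.1) (o.1 + ℓ * k.1 + ℓ) ×ˢ
      {o.2 + ℓ * k.2 - 1, o.2 + ℓ * k.2 + ℓ - 1}) ∪
    (if M k then (tileSites o ℓ k).filter fun x =>
      (x.1, x.2 + 1) ∈ tileSites o ℓ k ∧ σ (x.1, x.2 + 1) ≠ σ x else ∅) with hE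
  have hcardE : ∀ k ∈ bad, (E k).card ≤ 2 * ℓ + ℓ * P k := by
    intro k hk
    refine (Finset.card_union_le _ _).trans (add_le_add ?_ ?_)
    · rw [Finset.card_product, Int.card_Ico]
      have : (o.1 + ℓ * k.1 + ℓ - (o.1 + ℓ * k.1)).toNat = ℓ := by
        rw [add_sub_cancel_left]; simp
      rw [this, mul_comm]
      exact Nat.mul_le_mul_right _ Finset.card_le_two
    · split_ifs with hM
      · exact hP k hk hM
      · simp
  have hsub : (A.filter fun x => (x.1, x.2 + 1) ∉ A ∨ σ (x.1, x.2 + 1) ≠ σ x) ⊆ bad.biUnion E := by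
    intro x hx
    obtain ⟨hxA, hx'⟩ := Finset.mem_filter.1 hx
    obtain ⟨hMx, hwx⟩ := (hA x).1 hxA
    -- a site above `x` with the same spin has the same width
    have hx2 : ¬ M (tileIndex o ℓ (x.1, x.2 + 1)) ∨ σ (x.1, x.2 + 1) ≠ σ x := by
      by_contra hc
      push Not at hc
      refine hx'.elim (fun h => h ((hA _).2 ⟨hc.1, ?_⟩)) fun h => h hc.2
      have h5 : x.2 + 1 ∈ run (colOf σ x.1) x.2 := succ_mem_run hc.2
      unfold vWidth at hwx ⊢
      rwa [width_eq_of_mem h5]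
    obtain ⟨hb1, hb2⟩ := (tileIndex_eq_iff (o := o) hℓ x _).1 rfl
    rw [Finset.mem_biUnion]
    by_cases hbad : tileIndex o ℓ x ∈ bad
    · refine ⟨_, hbad, Finset.mem_union.2 ?_⟩
      rcases tileIndex_up hℓ x with ⟨h1, h2⟩ | ⟨h1, h2⟩
      · right
        rw [if_pos hMx, Finset.mem_filter, mem_tileSites hℓ, mem_tileSites hℓ]
        refine ⟨rfl, h1, hx2.resolve_left ?_⟩
        rw [h1]
        exact not_not.2 hMx
      · left
        simp only [Finset.mem_product, Finset.mem_Ico, Finset.mem_insert, Finset.mem_singleton]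
        exact ⟨hb1, Or.inr (by linarith)⟩
    · -- no wall above `x` belongs to a good tile of the family
      have hwall : tileIndex o ℓ (x.1, x.2 + 1) ∈ bad := by
        by_contra hbad'
        have hM' : M (tileIndex o ℓ (x.1, x.2 + 1)) := by
          rcases tileIndex_up hℓ x with ⟨h1, _⟩ | ⟨h1, _⟩
          · rwa [h1]
          · rw [h1] at hbad' ⊢
            exact hup _ hbad hbad' hMx
        have hne := hx2.resolve_left (not_not.2 hM')
        rcases Int.units_eq_one_or (σ x) with h | h
        · rcases Int.units_eq_one_or (σ (x.1, x.2 + 1)) with h' | h'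
          · exact hne (h'.trans h.symm)
          · have := (hfree (x.1, x.2 + 1) hbad' hM' h').2
            simp only [add_sub_cancel_right] at this
            exact hne (h'.trans this.symm)
        · exact hne ((hfree x hbad hMx h).1.trans h.symm)
      refine ⟨_, hwall, Finset.mem_union.2 (Or.inl ?_)⟩
      rcases tileIndex_up hℓ x with ⟨h1, h2⟩ | ⟨h1, h2⟩
      · rw [h1] at hwall; exact absurd hwall hbad
      · rw [h1]
        simp only [Finset.mem_product, Finset.mem_Ico, Finset.mem_insert, Finset.mem_singleton,
          Prod.fst_add, Prod.snd_add, add_zero]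
        exact ⟨hb1, Or.inl (by linarith)⟩
  have h1 : (A.filter fun x => (x.1, x.2 + 1) ∉ A ∨ σ (x.1, x.2 + 1) ≠ σ x).card ≤
      ∑ k ∈ bad, (2 * ℓ + ℓ * P k) :=
    (Finset.card_le_card hsub).trans (Finset.card_biUnion_le.trans (Finset.sum_le_sum hcardE))
  exact_mod_cast h1

/-! ### Walls and corners in a tile -/

section walls

variable {σ : Config} {o : Site} {ℓ : ℕ} {k : ℤ × ℤ}

lemma unit_ne_iff (u v : ℤˣ) : u ≠ v ↔ (u = -1 ∧ v = 1) ∨ (v = -1 ∧ u = 1) := by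
  rcases Int.units_eq_one_or u with rfl | rfl <;> rcases Int.units_eq_one_or v with rfl | rfl <;>
    decide

lemma mem_boundaryIn_horizontal (σ : Config) (Q : Set Site) (i j : ℤ) :
    Bond.mk .horizontal (i, j) ∈ boundaryIn σ Q ↔
      (σ (i, j - 1) = -1 ∧ σ (i, j) = 1 ∧ (i, j - 1) ∈ Q) ∨
      (σ (i, j) = -1 ∧ σ (i, j - 1) = 1 ∧ (i, j) ∈ Q) := by
  show (σ (i, j - 1) ≠ σ (i, j) ∧ ((σ (i, j - 1) = -1 ∧ (i, j - 1) ∈ Q) ∨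
    (σ (i, j) = -1 ∧ (i, j) ∈ Q))) ↔ _
  rw [unit_ne_iff]
  have h : (1 : ℤˣ) ≠ -1 := by decide
  constructor
  · rintro ⟨⟨h1, h2⟩ | ⟨h1, h2⟩, ⟨h3, h4⟩ | ⟨h3, h4⟩⟩
    · exact Or.inl ⟨h1, h2, h4⟩
    · exact absurd (h2.symm.trans h3) h
    · exact absurd (h2.symm.trans h3) h
    · exact Or.inr ⟨h1, h2, h4⟩
  · rintro (⟨h1, h2, h3⟩ | ⟨h1, h2, h3⟩)
    · exact ⟨Or.inl ⟨h1, h2⟩, Or.inl ⟨h1, h3⟩⟩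
    · exact ⟨Or.inr ⟨h1, h2⟩, Or.inr ⟨h1, h3⟩⟩

lemma mem_boundaryIn_vertical (σ : Config) (Q : Set Site) (i j : ℤ) :
    Bond.mk .vertical (i, j) ∈ boundaryIn σ Q ↔
      (σ (i - 1, j) = -1 ∧ σ (i, j) = 1 ∧ (i - 1, j) ∈ Q) ∨
      (σ (i, j) = -1 ∧ σ (i - 1, j) = 1 ∧ (i, j) ∈ Q) := by
  show (σ (i - 1, j) ≠ σ (i, j) ∧ ((σ (i - 1, j) = -1 ∧ (i - 1, j) ∈ Q) ∨
    (σ (i, j) = -1 ∧ (i, j) ∈ Q))) ↔ _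
  rw [unit_ne_iff]
  have h : (1 : ℤˣ) ≠ -1 := by decide
  constructor
  · rintro ⟨⟨h1, h2⟩ | ⟨h1, h2⟩, ⟨h3, h4⟩ | ⟨h3, h4⟩⟩
    · exact Or.inl ⟨h1, h2, h4⟩
    · exact absurd (h2.symm.trans h3) h
    · exact absurd (h2.symm.trans h3) h
    · exact Or.inr ⟨h1, h2, h4⟩
  · rintro (⟨h1, h2, h3⟩ | ⟨h1, h2, h3⟩)
    · exact ⟨Or.inl ⟨h1, h2⟩, Or.inl ⟨h1, h3⟩⟩
    · exact ⟨Or.inr ⟨h1, h2⟩, Or.inr ⟨h1, h3⟩⟩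

/-- The pairs of a bond of the contours in `T` and a corner vertex at which it ends. -/
def cornerEnds (σ : Config) (T : Set Site) : Set (Bond × (ℤ × ℤ)) :=
  {e | e.1 ∈ boundaryIn σ T ∧ e.1.HasEnd e.2 ∧ IsCornerVertex σ e.2}

/-- The set `Q` contains a bond of the contours of orientation `d`. -/
def HasBond (σ : Config) (Q : Set Site) (d : Dir) : Prop := ∃ v, Bond.mk d v ∈ boundaryIn σ Q

/-- Every lattice line between two rows that carries a bond in `T` carries one that ends at a
corner. -/
def RowsCornered (σ : Config) (T : Set Site) : Prop :=
  ∀ j, (∃ i, Bond.mk .horizontal (i, j) ∈ boundaryIn σ T) →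
    ∃ i v, (Bond.mk .horizontal (i, j), v) ∈ cornerEnds σ T

/-- Every lattice line between two columns that carries a bond in `T` carries one that ends at a
corner. -/
def ColumnsCornered (σ : Config) (T : Set Site) : Prop :=
  ∀ i, (∃ j, Bond.mk .vertical (i, j) ∈ boundaryIn σ T) →
    ∃ j v, (Bond.mk .vertical (i, j), v) ∈ cornerEnds σ T

lemma mem_tile (x : Site) : x ∈ tile o ℓ k ↔ (o.1 + ℓ * k.1 ≤ x.1 ∧ x.1 < o.1 + ℓ * k.1 + ℓ) ∧
    (o.2 + ℓ * k.2 ≤ x.2 ∧ x.2 < o.2 + ℓ * k.2 + ℓ) := by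
  unfold tile rect
  simp only [Set.mem_ofPred_eq, and_assoc]

/-- A property of adjacent lines that passes from each site to both neighbours holds on the whole
interval, and one step beyond it. -/
lemma propagate {f g : ℤ → ℤˣ} {a b i₀ : ℤ} (ha : a ≤ i₀) (hb : i₀ < b) (hf : f i₀ = -1)
    (hg : g i₀ = 1) (step : ∀ i, a ≤ i → i < b → f i = -1 → g i = 1 →
      (f (i - 1) = -1 ∧ g (i - 1) = 1) ∧ f (i + 1) = -1 ∧ g (i + 1) = 1)
    (i : ℤ) (h1 : a - 1 ≤ i) (h2 : i ≤ b) : f i = -1 ∧ g i = 1 := by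
  rcases le_total i₀ i with h | h
  · induction i, h using Int.leInduction with
    | base => exact ⟨hf, hg⟩
    | succ n hn ih =>
      obtain ⟨ih1, ih2⟩ := ih (by omega) (by omega)
      exact (step n (by omega) (by omega) ih1 ih2).2
  · induction i, h using Int.leInductionDown with
    | base => exact ⟨hf, hg⟩
    | pred n hn ih =>
      obtain ⟨ih1, ih2⟩ := ih (by omega) (by omega)
      exact (step n (by omega) (by omega) ih1 ih2).1

/-- A horizontal wall without corners crosses the tile and continues on both sides of it. -/
lemma horizontal_line {j : ℤ}
    (hc : ∀ i v, (Bond.mk .horizontal (i, j), v) ∉ cornerEnds σ (tile o ℓ k)) {i₀ : ℤ}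
    (h : Bond.mk .horizontal (i₀, j) ∈ boundaryIn σ (tile o ℓ k)) :
    ∃ y y', ((y = j - 1 ∧ y' = j) ∨ (y = j ∧ y' = j - 1)) ∧
      (o.2 + ℓ * k.2 ≤ y ∧ y < o.2 + ℓ * k.2 + ℓ) ∧
      ∀ i, o.1 + ℓ * k.1 - 1 ≤ i → i ≤ o.1 + ℓ * k.1 + ℓ → σ (i, y) = -1 ∧ σ (i, y') = 1 := by
  have hstep : ∀ i, Bond.mk .horizontal (i, j) ∈ boundaryIn σ (tile o ℓ k) →
      (σ (i - 1, j) = σ (i, j) ∧ σ (i - 1, j - 1) = σ (i, j - 1)) ∧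
      (σ (i + 1, j) = σ (i, j) ∧ σ (i + 1, j - 1) = σ (i, j - 1)) := by
    intro i hi
    have hne : σ (i, j - 1) ≠ σ (i, j) := hi.1
    have c1 : ¬ IsCornerVertex σ (i, j) := fun hv =>
      hc i (i, j) ⟨hi, (hasEnd_horizontal _ _).2 (Or.inl rfl), hv⟩
    have c2 : ¬ IsCornerVertex σ (i + 1, j) := fun hv =>
      hc i (i + 1, j) ⟨hi, (hasEnd_horizontal _ _).2 (Or.inr (by simp)), hv⟩
    rw [isCornerVertex_iff] at c1 c2
    simp only [add_sub_cancel_right] at c1 c2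
    constructor
    · by_contra hcc
      refine c1 ⟨Or.inl hne, ?_⟩
      by_contra h'
      push Not at h'
      exact hcc h'
    · by_contra hcc
      refine c2 ⟨Or.inr hne, ?_⟩
      by_contra h'
      push Not at h'
      exact hcc ⟨h'.1.symm, h'.2.symm⟩
  rcases (mem_boundaryIn_horizontal σ _ i₀ j).1 h with ⟨h1, h2, h3⟩ | ⟨h1, h2, h3⟩
  · obtain ⟨hx, hy⟩ := (mem_tile _).1 h3
    refine ⟨j - 1, j, Or.inl ⟨rfl, rfl⟩, hy, propagate (f := fun i => σ (i, j - 1))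
      (g := fun i => σ (i, j)) hx.1 hx.2 h1 h2 fun i hi1 hi2 hf hg => ?_⟩
    obtain ⟨⟨s1, s2⟩, s3, s4⟩ := hstep i ((mem_boundaryIn_horizontal σ _ i j).2
      (Or.inl ⟨hf, hg, (mem_tile _).2 ⟨⟨hi1, hi2⟩, hy⟩⟩))
    simp only [s1, s2, s3, s4]
    exact ⟨⟨hf, hg⟩, hf, hg⟩
  · obtain ⟨hx, hy⟩ := (mem_tile _).1 h3
    refine ⟨j, j - 1, Or.inr ⟨rfl, rfl⟩, hy, propagate (f := fun i => σ (i, j))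
      (g := fun i => σ (i, j - 1)) hx.1 hx.2 h1 h2 fun i hi1 hi2 hf hg => ?_⟩
    obtain ⟨⟨s1, s2⟩, s3, s4⟩ := hstep i ((mem_boundaryIn_horizontal σ _ i j).2
      (Or.inr ⟨hf, hg, (mem_tile _).2 ⟨⟨hi1, hi2⟩, hy⟩⟩))
    simp only [s1, s2, s3, s4]
    exact ⟨⟨hf, hg⟩, hf, hg⟩

/-- A vertical wall without corners crosses the tile and continues on both sides of it. -/
lemma vertical_line {i : ℤ}
    (hc : ∀ j v, (Bond.mk .vertical (i, j), v) ∉ cornerEnds σ (tile o ℓ k)) {j₀ : ℤ}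
    (h : Bond.mk .vertical (i, j₀) ∈ boundaryIn σ (tile o ℓ k)) :
    ∃ x x', ((x = i - 1 ∧ x' = i) ∨ (x = i ∧ x' = i - 1)) ∧
      (o.1 + ℓ * k.1 ≤ x ∧ x < o.1 + ℓ * k.1 + ℓ) ∧
      ∀ j, o.2 + ℓ * k.2 - 1 ≤ j → j ≤ o.2 + ℓ * k.2 + ℓ → σ (x, j) = -1 ∧ σ (x', j) = 1 := by
  have hstep : ∀ j, Bond.mk .vertical (i, j) ∈ boundaryIn σ (tile o ℓ k) →
      (σ (i, j - 1) = σ (i, j) ∧ σ (i - 1, j - 1) = σ (i - 1, j)) ∧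
      (σ (i, j + 1) = σ (i, j) ∧ σ (i - 1, j + 1) = σ (i - 1, j)) := by
    intro j hj
    have hne : σ (i - 1, j) ≠ σ (i, j) := hj.1
    have c1 : ¬ IsCornerVertex σ (i, j) := fun hv =>
      hc j (i, j) ⟨hj, (hasEnd_vertical _ _).2 (Or.inl rfl), hv⟩
    have c2 : ¬ IsCornerVertex σ (i, j + 1) := fun hv =>
      hc j (i, j + 1) ⟨hj, (hasEnd_vertical _ _).2 (Or.inr (by simp)), hv⟩
    rw [isCornerVertex_iff] at c1 c2
    simp only [add_sub_cancel_right] at c1 c2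
    constructor
    · by_contra hcc
      refine c1 ⟨?_, Or.inl hne⟩
      by_contra h'
      push Not at h'
      exact hcc h'
    · by_contra hcc
      refine c2 ⟨?_, Or.inr hne⟩
      by_contra h'
      push Not at h'
      exact hcc ⟨h'.1.symm, h'.2.symm⟩
  rcases (mem_boundaryIn_vertical σ _ i j₀).1 h with ⟨h1, h2, h3⟩ | ⟨h1, h2, h3⟩
  · obtain ⟨hx, hy⟩ := (mem_tile _).1 h3
    refine ⟨i - 1, i, Or.inl ⟨rfl, rfl⟩, hx, propagate (f := fun j => σ (i - 1, j))
      (g := fun j => σ (i, j)) hy.1 hy.2 h1 h2 fun j hj1 hj2 hf hg => ?_⟩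
    obtain ⟨⟨s1, s2⟩, s3, s4⟩ := hstep j ((mem_boundaryIn_vertical σ _ i j).2
      (Or.inl ⟨hf, hg, (mem_tile _).2 ⟨hx, ⟨hj1, hj2⟩⟩⟩))
    simp only [s1, s2, s3, s4]
    exact ⟨⟨hf, hg⟩, hf, hg⟩
  · obtain ⟨hx, hy⟩ := (mem_tile _).1 h3
    refine ⟨i, i - 1, Or.inr ⟨rfl, rfl⟩, hx, propagate (f := fun j => σ (i, j))
      (g := fun j => σ (i - 1, j)) hy.1 hy.2 h1 h2 fun j hj1 hj2 hf hg => ?_⟩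
    obtain ⟨⟨s1, s2⟩, s3, s4⟩ := hstep j ((mem_boundaryIn_vertical σ _ i j).2
      (Or.inr ⟨hf, hg, (mem_tile _).2 ⟨hx, ⟨hj1, hj2⟩⟩⟩))
    simp only [s1, s2, s3, s4]
    exact ⟨⟨hf, hg⟩, hf, hg⟩

/-- Walls without corners of both orientations would cross each other in the tile. -/
lemma rowsCornered_or_columnsCornered (σ : Config) (o : Site) (ℓ : ℕ) (k : ℤ × ℤ) :
    RowsCornered σ (tile o ℓ k) ∨ ColumnsCornered σ (tile o ℓ k) := by
  by_contra hcon
  unfold RowsCornered ColumnsCornered at hcon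
  push Not at hcon
  obtain ⟨⟨j, ⟨i₀, hi⟩, hj⟩, ⟨i, ⟨j₀, hj₀⟩, hi'⟩⟩ := hcon
  obtain ⟨y, y', hyy, hy, hline⟩ := horizontal_line hj hi
  obtain ⟨x, x', hxx, hx, hline'⟩ := vertical_line hi' hj₀
  have h1 := (hline x (by omega) (by omega)).2
  have h2 := (hline' y' (by omega) (by omega)).1
  rw [h1] at h2
  exact absurd h2 (by decide)

/-! ### Good tiles -/

lemma numCornersIn_pos_iff (σ : Config) (T : Set Site) :
    0 < numCornersIn σ T ↔ (cornerEnds σ T).Nonempty := by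
  unfold numCornersIn
  rw [ENNReal.div_pos_iff]
  constructor
  · rintro ⟨h, _⟩
    rw [Set.nonempty_iff_ne_empty]
    intro h0
    apply h
    change (((cornerEnds σ T).encard : ℕ∞) : ℝ≥0∞) = 0
    rw [h0]
    simp
  · intro h
    refine ⟨?_, by simp⟩
    change (((cornerEnds σ T).encard : ℕ∞) : ℝ≥0∞) ≠ 0
    rw [ne_eq, ENat.toENNReal_eq_zero, Set.encard_eq_zero]
    exact h.ne_empty

lemma cornerEnds_eq_empty {T : Set Site} (h : ¬ IsBad σ ℓ T) : cornerEnds σ T = ∅ := by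
  by_contra hc
  exact h (Or.inl ((numCornersIn_pos_iff σ T).2 (Set.nonempty_iff_ne_empty.2 hc)))

lemma rowsCornered_iff_of_good {T : Set Site} (h : ¬ IsBad σ ℓ T) :
    RowsCornered σ T ↔ ¬ HasBond σ T .horizontal := by
  constructor
  · rintro hr ⟨⟨i, j⟩, hv⟩
    obtain ⟨i', v, h'⟩ := hr j ⟨i, hv⟩
    rw [cornerEnds_eq_empty h] at h'
    exact h'
  · rintro hn j ⟨i, hi⟩
    exact absurd ⟨_, hi⟩ hn

lemma not_both_of_good (h : ¬ IsBad σ ℓ (tile o ℓ k)) :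
    ¬ (HasBond σ (tile o ℓ k) .horizontal ∧ HasBond σ (tile o ℓ k) .vertical) := by
  rintro ⟨h1, ⟨i, j⟩, h2⟩
  rcases rowsCornered_or_columnsCornered σ o ℓ k with hr | hc
  · exact (rowsCornered_iff_of_good h).1 hr h1
  · obtain ⟨j', v, h'⟩ := hc i ⟨j, h2⟩
    rw [cornerEnds_eq_empty h] at h'
    exact h'

lemma boundaryIn_of_ne_vertical {Q : Set Site} {i j : ℤ} (h1 : (i, j) ∈ Q) (h2 : (i, j + 1) ∈ Q)
    (h : σ (i, j + 1) ≠ σ (i, j)) : Bond.mk .horizontal (i, j + 1) ∈ boundaryIn σ Q := by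
  rw [mem_boundaryIn_horizontal, add_sub_cancel_right]
  rcases (unit_ne_iff _ _).1 h with ⟨a, b⟩ | ⟨a, b⟩
  · exact Or.inr ⟨a, b, h2⟩
  · exact Or.inl ⟨a, b, h1⟩

lemma boundaryIn_of_ne_horizontal {Q : Set Site} {i j : ℤ} (h1 : (i, j) ∈ Q) (h2 : (i + 1, j) ∈ Q)
    (h : σ (i + 1, j) ≠ σ (i, j)) : Bond.mk .vertical (i + 1, j) ∈ boundaryIn σ Q := by
  rw [mem_boundaryIn_vertical, add_sub_cancel_right]
  rcases (unit_ne_iff _ _).1 h with ⟨a, b⟩ | ⟨a, b⟩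
  · exact Or.inr ⟨a, b, h2⟩
  · exact Or.inl ⟨a, b, h1⟩

/-- A tile without walls is a hole itself. -/
lemma hasBond_of_not_hasHole (h : ¬ HasHole σ ℓ (tile o ℓ k)) :
    HasBond σ (tile o ℓ k) .horizontal ∨ HasBond σ (tile o ℓ k) .vertical := by
  by_contra hcon
  push Not at hcon
  obtain ⟨hH, hV⟩ := hcon
  set a := o.1 + ℓ * k.1 with ha
  set b := o.2 + ℓ * k.2 with hb
  have hv : ∀ i j, a ≤ i → i < a + ℓ → b ≤ j → j < b + ℓ → σ (i, j) = σ (i, b) := by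
    intro i j hi1 hi2 hj1
    induction j, hj1 using Int.leInduction with
    | base => intro _; rfl
    | succ j hj ih =>
      intro hj2
      rw [← ih (by omega)]
      by_contra hne
      exact hH ⟨_, boundaryIn_of_ne_vertical ((mem_tile _).2 ⟨⟨hi1, hi2⟩, hj, by show j < _; omega⟩)
        ((mem_tile _).2 ⟨⟨hi1, hi2⟩, by show _ ≤ j + 1; omega, hj2⟩) hne⟩
  have hh : ∀ i, a ≤ i → i < a + ℓ → σ (i, b) = σ (a, b) := by
    intro i hi1
    induction i, hi1 using Int.leInduction with
    | base => intro _; rfl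
    | succ i hi ih =>
      intro hi2
      rw [← ih (by omega)]
      by_contra hne
      exact hV ⟨_, boundaryIn_of_ne_horizontal
        ((mem_tile _).2 ⟨⟨hi, by show i < _; omega⟩, le_rfl, by show b < b + ℓ; omega⟩)
        ((mem_tile _).2 ⟨⟨by show _ ≤ i + 1; omega, hi2⟩, le_rfl, by show b < b + ℓ; omega⟩) hne⟩
  have hconst : ∀ x ∈ tile o ℓ k, σ x = σ (a, b) := by
    intro x hx
    obtain ⟨⟨h1, h2⟩, h3, h4⟩ := (mem_tile x).1 hx
    exact (hv x.1 x.2 h1 h2 h3 h4).trans (hh x.1 h1 h2)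
  refine h ⟨(a, b), ℓ, ?_, subset_rfl, ?_⟩
  · have : (0 : ℝ) ≤ ℓ := Nat.cast_nonneg ℓ
    linarith
  · rcases Int.units_eq_one_or (σ (a, b)) with h' | h'
    · exact Or.inr fun x hx => (hconst x hx).trans h'
    · exact Or.inl fun x hx => (hconst x hx).trans h'

lemma hasBond_horizontal_neighbour (hℓ : 1 ≤ ℓ) (h : ¬ IsBad σ ℓ (tile o ℓ k))
    (hH : HasBond σ (tile o ℓ k) .horizontal) {d : ℤ} (hd : d = 1 ∨ d = -1) :
    HasBond σ (tile o ℓ (k + (d, 0))) .horizontal := by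
  obtain ⟨⟨i, j⟩, hij⟩ := hH
  obtain ⟨y, y', hyy, hy, hline⟩ := horizontal_line
    (fun i v => by rw [cornerEnds_eq_empty h]; exact fun h => h) hij
  have key : ∀ i', o.1 + ℓ * k.1 - 1 ≤ i' → i' ≤ o.1 + ℓ * k.1 + ℓ →
      o.1 + ℓ * (k.1 + d) ≤ i' → i' < o.1 + ℓ * (k.1 + d) + ℓ →
      HasBond σ (tile o ℓ (k + (d, 0))) .horizontal := by
    intro i' h1 h2 h3 h4
    obtain ⟨s1, s2⟩ := hline i' h1 h2
    refine ⟨(i', j), (mem_boundaryIn_horizontal _ _ _ _).2 ?_⟩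
    have hmem : ((i', y) : Site) ∈ tile o ℓ (k + (d, 0)) := by
      rw [mem_tile]
      refine ⟨⟨h3, h4⟩, ?_⟩
      simpa using hy
    rcases hyy with ⟨rfl, rfl⟩ | ⟨rfl, rfl⟩
    · exact Or.inl ⟨s1, s2, hmem⟩
    · exact Or.inr ⟨s1, s2, hmem⟩
  rcases hd with rfl | rfl
  · exact key (o.1 + ℓ * k.1 + ℓ) (by omega) le_rfl (by linarith) (by rw [mul_add]; omega)
  · exact key (o.1 + ℓ * k.1 - 1) le_rfl (by omega) (by rw [mul_add]; omega)
      (by rw [mul_add]; omega)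

lemma hasBond_vertical_neighbour (hℓ : 1 ≤ ℓ) (h : ¬ IsBad σ ℓ (tile o ℓ k))
    (hV : HasBond σ (tile o ℓ k) .vertical) {d : ℤ} (hd : d = 1 ∨ d = -1) :
    HasBond σ (tile o ℓ (k + (0, d))) .vertical := by
  obtain ⟨⟨i, j⟩, hij⟩ := hV
  obtain ⟨x, x', hxx, hx, hline⟩ := vertical_line
    (fun i v => by rw [cornerEnds_eq_empty h]; exact fun h => h) hij
  have key : ∀ j', o.2 + ℓ * k.2 - 1 ≤ j' → j' ≤ o.2 + ℓ * k.2 + ℓ →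
      o.2 + ℓ * (k.2 + d) ≤ j' → j' < o.2 + ℓ * (k.2 + d) + ℓ →
      HasBond σ (tile o ℓ (k + (0, d))) .vertical := by
    intro j' h1 h2 h3 h4
    obtain ⟨s1, s2⟩ := hline j' h1 h2
    refine ⟨(i, j'), (mem_boundaryIn_vertical _ _ _ _).2 ?_⟩
    have hmem : ((x, j') : Site) ∈ tile o ℓ (k + (0, d)) := by
      rw [mem_tile]
      refine ⟨?_, ⟨h3, h4⟩⟩
      simpa using hx
    rcases hxx with ⟨rfl, rfl⟩ | ⟨rfl, rfl⟩
    · exact Or.inl ⟨s1, s2, hmem⟩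
    · exact Or.inr ⟨s1, s2, hmem⟩
  rcases hd with rfl | rfl
  · exact key (o.2 + ℓ * k.2 + ℓ) (by omega) le_rfl (by linarith) (by rw [mul_add]; omega)
  · exact key (o.2 + ℓ * k.2 - 1) le_rfl (by omega) (by rw [mul_add]; omega)
      (by rw [mul_add]; omega)

/-- Neighbouring good tiles are striped in the same direction. -/
lemma hasBond_horizontal_iff (hℓ : 1 ≤ ℓ) {k' : ℤ × ℤ} (h : ¬ IsBad σ ℓ (tile o ℓ k))
    (h' : ¬ IsBad σ ℓ (tile o ℓ k')) {d : ℤ} (hd : d = 1 ∨ d = -1)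
    (hk : k' = k + (d, 0) ∨ k' = k + (0, d)) :
    HasBond σ (tile o ℓ k) .horizontal ↔ HasBond σ (tile o ℓ k') .horizontal := by
  have hd' : -d = 1 ∨ -d = -1 := by omega
  rcases hk with rfl | rfl
  · refine ⟨fun hH => hasBond_horizontal_neighbour hℓ h hH hd, fun hH => ?_⟩
    have := hasBond_horizontal_neighbour hℓ h' hH hd'
    rwa [show k + (d, 0) + (-d, 0) = k by ext <;> simp] at this
  · have hor : ∀ {k : ℤ × ℤ}, ¬ IsBad σ ℓ (tile o ℓ k) →
        (HasBond σ (tile o ℓ k) .horizontal ↔ ¬ HasBond σ (tile o ℓ k) .vertical) := fun hb =>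
      ⟨fun h1 h2 => not_both_of_good hb ⟨h1, h2⟩, fun h1 =>
        (hasBond_of_not_hasHole fun h => hb (Or.inr h)).resolve_right h1⟩
    rw [hor h, hor h', not_iff_not]
    refine ⟨fun hV => hasBond_vertical_neighbour hℓ h hV hd, fun hV => ?_⟩
    have := hasBond_vertical_neighbour hℓ h' hV hd'
    rwa [show k + (0, d) + (0, -d) = k by ext <;> simp] at this

end walls

/-! ### Counting walls by corners -/

section counting

variable {σ : Config} {V : Finset (ℤ × ℤ)}

/-- The four bonds that end at the vertex `v`, labelled by orientation and side, each paired with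
`v`. -/
def endAt (v : ℤ × ℤ) : Bool × Bool → Bond × (ℤ × ℤ)
  | (true, true) => (⟨.horizontal, v⟩, v)
  | (true, false) => (⟨.horizontal, (v.1 - 1, v.2)⟩, v)
  | (false, true) => (⟨.vertical, v⟩, v)
  | (false, false) => (⟨.vertical, (v.1, v.2 - 1)⟩, v)

open Classical in
lemma cornerEnds_subset (hV : ∀ v, v ∈ V ↔ IsCornerVertex σ v) (T : Set Site) :
    cornerEnds σ T ⊆ ((V ×ˢ Finset.univ).image fun q : (ℤ × ℤ) × Bool × Bool => endAt q.1 q.2 :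
      Finset (Bond × (ℤ × ℤ))) := by
  rintro ⟨⟨d, w⟩, v⟩ ⟨_, he, hv⟩
  simp only [Finset.coe_image, Set.mem_image, Finset.mem_coe, Finset.mem_product, Finset.mem_univ,
    and_true]
  have hv' := (hV v).2 hv
  cases d
  · rcases (hasEnd_horizontal v w).1 he with rfl | rfl
    · exact ⟨(w, true, true), hv', rfl⟩
    · exact ⟨(v, true, false), hv', rfl⟩
  · rcases (hasEnd_vertical v w).1 he with rfl | rfl
    · exact ⟨(w, false, true), hv', rfl⟩
    · exact ⟨(v, false, false), hv', rfl⟩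

lemma finite_cornerEnds (hV : ∀ v, v ∈ V ↔ IsCornerVertex σ v) (T : Set Site) :
    (cornerEnds σ T).Finite := by
  classical
  exact (Finset.finite_toSet _).subset (cornerEnds_subset hV T)

/-- At most four bonds end at each corner vertex, and each of them belongs to at most one tile. -/
lemma sum_ncard_cornerEnds_le {o : Site} {ℓ : ℕ} (hℓ : 1 ≤ ℓ)
    (hV : ∀ v, v ∈ V ↔ IsCornerVertex σ v) (F : Finset (ℤ × ℤ)) :
    ∑ k ∈ F, (cornerEnds σ (tile o ℓ k)).ncard ≤ 4 * V.card := by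
  classical
  have hfin : ∀ k, (cornerEnds σ (tile o ℓ k)).Finite := fun k => finite_cornerEnds hV _
  have h1 : ∀ k, (cornerEnds σ (tile o ℓ k)).ncard = (hfin k).toFinset.card := fun k =>
    Set.ncard_eq_toFinset_card _ _
  simp only [h1]
  rw [← Finset.card_biUnion]
  · refine (Finset.card_le_card (t := (V ×ˢ Finset.univ).image
      fun q : (ℤ × ℤ) × Bool × Bool => endAt q.1 q.2)
      (Finset.biUnion_subset.2 fun k _ => ?_)).trans (Finset.card_image_le.trans (le_of_eq ?_))
    · intro e he
      exact_mod_cast cornerEnds_subset hV _ ((hfin k).mem_toFinset.1 he)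
    · rw [Finset.card_product, mul_comm]
      rfl
  · intro k _ k' _ hkk
    rw [Function.onFun, Finset.disjoint_left]
    intro e he he'
    obtain ⟨⟨hb, hs⟩, _⟩ := (hfin k).mem_toFinset.1 he
    obtain ⟨⟨_, hs'⟩, _⟩ := (hfin k').mem_toFinset.1 he'
    have hne : σ e.1.site₁ ≠ σ e.1.site₂ := hb
    refine hkk ?_
    rcases hs with ⟨a, b⟩ | ⟨a, b⟩ <;> rcases hs' with ⟨a', b'⟩ | ⟨a', b'⟩
    · exact ((mem_tile_iff hℓ _ _).1 b).symm.trans ((mem_tile_iff hℓ _ _).1 b')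
    · exact absurd (a.trans a'.symm) hne
    · exact absurd (a'.trans a.symm) hne
    · exact ((mem_tile_iff hℓ _ _).1 b).symm.trans ((mem_tile_iff hℓ _ _).1 b')

/-- Each line between two rows has at most `ℓ` bonds in the tile, and one of them ends at a
corner. -/
lemma card_horizontal_walls_le {o : Site} {ℓ : ℕ} (hℓ : 1 ≤ ℓ)
    (hV : ∀ v, v ∈ V ↔ IsCornerVertex σ v) {k : ℤ × ℤ} (h : RowsCornered σ (tile o ℓ k)) :
    ((tileSites o ℓ k).filter fun x =>
      (x.1, x.2 + 1) ∈ tileSites o ℓ k ∧ σ (x.1, x.2 + 1) ≠ σ x).card ≤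
      ℓ * (cornerEnds σ (tile o ℓ k)).ncard := by
  classical
  set D := (tileSites o ℓ k).filter fun x =>
      (x.1, x.2 + 1) ∈ tileSites o ℓ k ∧ σ (x.1, x.2 + 1) ≠ σ x with hD
  have hbond : ∀ x ∈ D, Bond.mk .horizontal (x.1, x.2 + 1) ∈ boundaryIn σ (tile o ℓ k) := by
    intro x hx
    obtain ⟨h1, h2, h3⟩ := Finset.mem_filter.1 hx
    rw [mem_tileSites hℓ, ← mem_tile_iff hℓ] at h1 h2
    exact boundaryIn_of_ne_vertical h1 h2 h3
  have hsub : D ⊆ Finset.Ico (o.1 + ℓ * k.1) (o.1 + ℓ * k.1 + ℓ) ×ˢ D.image Prod.snd := by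
    intro x hx
    have h1 := (Finset.mem_filter.1 hx).1
    exact Finset.mem_product.2 ⟨(Finset.mem_product.1 h1).1, Finset.mem_image_of_mem _ hx⟩
  have hlev : (D.image Prod.snd).card ≤ (cornerEnds σ (tile o ℓ k)).ncard := by
    have hex : ∀ j, ∃ e : Bond × (ℤ × ℤ), j ∈ D.image Prod.snd →
        e ∈ cornerEnds σ (tile o ℓ k) ∧ e.1.base.2 = j + 1 := by
      intro j
      by_cases hj : j ∈ D.image Prod.snd
      · obtain ⟨x, hx, rfl⟩ := Finset.mem_image.1 hj
        obtain ⟨i, v, hiv⟩ := h _ ⟨_, hbond x hx⟩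
        exact ⟨_, fun _ => ⟨hiv, rfl⟩⟩
      · exact ⟨(⟨.horizontal, 0⟩, 0), fun h => absurd h hj⟩
    choose f hf using hex
    rw [← Set.ncard_coe_finset]
    refine Set.ncard_le_ncard_of_injOn f (fun j hj => (hf j hj).1) (fun j hj j' hj' hjj => ?_)
      (finite_cornerEnds hV _)
    have h1 := (hf j hj).2
    have h2 := (hf j' hj').2
    rw [hjj] at h1
    omega
  refine (Finset.card_le_card hsub).trans ?_
  rw [Finset.card_product, Int.card_Ico, add_sub_cancel_left, Int.toNat_natCast]
  exact Nat.mul_le_mul_left _ hlev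

lemma card_vertical_walls_le {o : Site} {ℓ : ℕ} (hℓ : 1 ≤ ℓ)
    (hV : ∀ v, v ∈ V ↔ IsCornerVertex σ v) {k : ℤ × ℤ} (h : ColumnsCornered σ (tile o ℓ k)) :
    ((tileSites o ℓ k).filter fun x =>
      (x.1 + 1, x.2) ∈ tileSites o ℓ k ∧ σ (x.1 + 1, x.2) ≠ σ x).card ≤
      ℓ * (cornerEnds σ (tile o ℓ k)).ncard := by
  classical
  set D := (tileSites o ℓ k).filter fun x =>
      (x.1 + 1, x.2) ∈ tileSites o ℓ k ∧ σ (x.1 + 1, x.2) ≠ σ x with hD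
  have hbond : ∀ x ∈ D, Bond.mk .vertical (x.1 + 1, x.2) ∈ boundaryIn σ (tile o ℓ k) := by
    intro x hx
    obtain ⟨h1, h2, h3⟩ := Finset.mem_filter.1 hx
    rw [mem_tileSites hℓ, ← mem_tile_iff hℓ] at h1 h2
    exact boundaryIn_of_ne_horizontal h1 h2 h3
  have hsub : D ⊆ D.image Prod.fst ×ˢ Finset.Ico (o.2 + ℓ * k.2) (o.2 + ℓ * k.2 + ℓ) := by
    intro x hx
    have h1 := (Finset.mem_filter.1 hx).1
    exact Finset.mem_product.2 ⟨Finset.mem_image_of_mem _ hx, (Finset.mem_product.1 h1).2⟩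
  have hlev : (D.image Prod.fst).card ≤ (cornerEnds σ (tile o ℓ k)).ncard := by
    have hex : ∀ i, ∃ e : Bond × (ℤ × ℤ), i ∈ D.image Prod.fst →
        e ∈ cornerEnds σ (tile o ℓ k) ∧ e.1.base.1 = i + 1 := by
      intro i
      by_cases hi : i ∈ D.image Prod.fst
      · obtain ⟨x, hx, rfl⟩ := Finset.mem_image.1 hi
        obtain ⟨j, v, hjv⟩ := h _ ⟨_, hbond x hx⟩
        exact ⟨_, fun _ => ⟨hjv, rfl⟩⟩
      · exact ⟨(⟨.horizontal, 0⟩, 0), fun h => absurd h hi⟩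
    choose f hf using hex
    rw [← Set.ncard_coe_finset]
    refine Set.ncard_le_ncard_of_injOn f (fun j hj => (hf j hj).1) (fun j hj j' hj' hjj => ?_)
      (finite_cornerEnds hV _)
    have h1 := (hf j hj).2
    have h2 := (hf j' hj').2
    rw [hjj] at h1
    omega
  refine (Finset.card_le_card hsub).trans ?_
  rw [Finset.card_product, Int.card_Ico, add_sub_cancel_left, Int.toNat_natCast, mul_comm]
  exact Nat.mul_le_mul_left _ hlev

end counting

/-- The counterpart of `sum_inv_vWidth_tiles_le` for horizontal widths. -/
lemma sum_inv_hWidth_tiles_le {σ : Config} {o : Site} {ℓ : ℕ} (hℓ : 1 ≤ ℓ) {M : ℤ × ℤ → Prop}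
    {bad : Finset (ℤ × ℤ)} {P : ℤ × ℤ → ℕ}
    (hfree : ∀ x, tileIndex o ℓ x ∉ bad → M (tileIndex o ℓ x) → σ x = -1 →
      σ (x.1 + 1, x.2) = -1 ∧ σ (x.1 - 1, x.2) = -1)
    (hright : ∀ k, k ∉ bad → k + (1, 0) ∉ bad → M k → M (k + (1, 0)))
    (hP : ∀ k ∈ bad, M k → ((tileSites o ℓ k).filter fun x =>
      (x.1 + 1, x.2) ∈ tileSites o ℓ k ∧ σ (x.1 + 1, x.2) ≠ σ x).card ≤ ℓ * P k)
    {A : Finset Site} (hA : ∀ x, x ∈ A ↔ M (tileIndex o ℓ x) ∧ hWidth σ x ≠ 0) :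
    ∑ x ∈ A, 1 / (hWidth σ x : ℝ) ≤ ∑ k ∈ bad, (2 * ℓ + ℓ * P k : ℝ) := by
  have key := sum_inv_vWidth_tiles_le (σ := fun x => σ x.swap) (o := o.swap) hℓ
    (M := fun k => M k.swap) (bad := bad.map (Equiv.prodComm ℤ ℤ).toEmbedding)
    (P := fun k => P k.swap) (A := A.map (Equiv.prodComm ℤ ℤ).toEmbedding) ?_ ?_ ?_ ?_
  · rw [Finset.sum_map, Finset.sum_map] at key
    exact key
  · intro x hx hM h
    rw [Finset.mem_map_equiv] at hx
    exact hfree x.swap hx hM h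
  · intro k hk hk' hM
    rw [Finset.mem_map_equiv] at hk hk'
    exact hright k.swap hk hk' hM
  · intro k hk hM
    rw [Finset.mem_map_equiv] at hk
    refine le_trans ?_ (hP k.swap hk hM)
    refine Finset.card_le_card_of_injOn Prod.swap ?_ Prod.swap_injective.injOn
    intro x hx
    have hx := Finset.mem_filter.1 hx
    rw [mem_tileSites hℓ, mem_tileSites hℓ] at hx
    refine Finset.mem_filter.2 ?_
    rw [mem_tileSites hℓ, mem_tileSites hℓ]
    exact ⟨congrArg Prod.swap hx.1, congrArg Prod.swap hx.2.1, hx.2.2⟩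
  · intro x
    rw [Finset.mem_map_equiv]
    exact hA x.swap

/-! ### Bad tiles -/

section bad

variable {σ : Config} {X : Finset Site} {o : Site} {ℓ h : ℕ}

/-- Far away all walls are vertical. -/
lemma finite_hasBond_horizontal (hℓ : 1 ≤ ℓ) (hh : 1 ≤ h) (hX : ∀ x ∉ X, σ x = stripe h x) :
    {k | HasBond σ (tile o ℓ k) .horizontal}.Finite := by
  refine ((X.finite_toSet.image (tileIndex o ℓ)).union
    ((X.finite_toSet.image fun x => tileIndex o ℓ (x.1, x.2 + 1)).union
      (X.finite_toSet.image fun x => tileIndex o ℓ (x.1, x.2 - 1)))).subset ?_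
  rintro k ⟨⟨i, j⟩, hb⟩
  have hne : σ (i, j - 1) ≠ σ (i, j) := hb.1
  have hmem : ((i, j - 1) : Site) ∈ X ∨ ((i, j) : Site) ∈ X := by
    by_contra hc
    push Not at hc
    exact hne (by rw [hX _ hc.1, hX _ hc.2, stripe_eq hh, stripe_eq hh])
  rcases (mem_boundaryIn_horizontal _ _ _ _).1 hb with ⟨_, _, h3⟩ | ⟨_, _, h3⟩ <;>
    rw [mem_tile_iff hℓ] at h3 <;> rcases hmem with hm | hm
  · exact Or.inl ⟨_, hm, h3⟩
  · exact Or.inr (Or.inr ⟨_, hm, h3⟩)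
  · exact Or.inr (Or.inl ⟨_, hm, by simpa using h3⟩)
  · exact Or.inl ⟨_, hm, h3⟩

/-- A stripe is too narrow to contain a hole. -/
lemma exists_mem_of_hasHole (hh : 1 ≤ h) (hX : ∀ x ∉ X, σ x = stripe h x) (hlarge : 5 * h < ℓ)
    {T : Set Site} (hT : HasHole σ ℓ T) : ∃ x ∈ X, x ∈ T := by
  by_contra hc
  push Not at hc
  obtain ⟨a, m, hm, hsub, hu⟩ := hT
  have hmh : h < m := by
    have h1 : (5 * h : ℝ) < ℓ := by exact_mod_cast hlarge
    have : (h : ℝ) < m := by linarith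
    exact_mod_cast this
  have hval : ∀ i : ℤ, 0 ≤ i → i < m → (a.1 + i, a.2) ∈ rect a m m ∧
      σ (a.1 + i, a.2) = stripeRow h (a.1 + i) := by
    intro i h0 h1
    have hmem : (a.1 + i, a.2) ∈ rect a m m := by
      unfold rect
      simp only [Set.mem_ofPred_eq]
      omega
    exact ⟨hmem, (hX _ fun hx => hc _ hx (hsub hmem)).trans (stripe_eq hh _)⟩
  obtain ⟨m1, v1⟩ := hval 0 le_rfl (by omega)
  obtain ⟨m2, v2⟩ := hval h (by omega) (by omega)
  rw [stripeRow_add hh] at v2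
  rw [add_zero] at v1 m1
  have heq : σ (a.1 + h, a.2) = σ (a.1, a.2) := by
    rcases hu with hu | hu <;> rw [hu _ m1, hu _ m2]
  rw [v1, v2] at heq
  exact absurd heq (by
    rcases Int.units_eq_one_or (stripeRow h a.1) with h' | h' <;> rw [h'] <;> decide)

lemma finite_isBad (hℓ : 1 ≤ ℓ) (hh : 1 ≤ h) (hX : ∀ x ∉ X, σ x = stripe h x)
    (hlarge : 5 * h < ℓ) {V : Finset (ℤ × ℤ)} (hV : ∀ v, v ∈ V ↔ IsCornerVertex σ v) :
    {k | IsBad σ ℓ (tile o ℓ k)}.Finite := by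
  have hE : (cornerEnds σ Set.univ).Finite := finite_cornerEnds hV _
  refine ((X.finite_toSet.image (tileIndex o ℓ)).union
    ((hE.image fun e => tileIndex o ℓ e.1.site₁).union
      (hE.image fun e => tileIndex o ℓ e.1.site₂))).subset ?_
  rintro k (hk | hk)
  · obtain ⟨e, ⟨hb, hs⟩, he⟩ := (numCornersIn_pos_iff _ _).1 hk
    rcases hs with ⟨h1, h2⟩ | ⟨h1, h2⟩
    · exact Or.inr (Or.inl ⟨e, ⟨⟨hb, Or.inl ⟨h1, trivial⟩⟩, he⟩, (mem_tile_iff hℓ _ _).1 h2⟩)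
    · exact Or.inr (Or.inr ⟨e, ⟨⟨hb, Or.inr ⟨h1, trivial⟩⟩, he⟩, (mem_tile_iff hℓ _ _).1 h2⟩)
  · obtain ⟨x, hx, hxT⟩ := exists_mem_of_hasHole hh hX hlarge hk
    exact Or.inl ⟨x, hx, (mem_tile_iff hℓ _ _).1 hxT⟩

/-- Each column that is not constant meets a bad tile: a column of good tiles with a horizontal wall
would be horizontally striped up to infinity. -/
lemma card_columns_le (hℓ : 1 ≤ ℓ) (hh : 1 ≤ h) (hX : ∀ x ∉ X, σ x = stripe h x)
    {bad : Finset (ℤ × ℤ)} (hbad : ∀ k, k ∈ bad ↔ IsBad σ ℓ (tile o ℓ k)) {Q : Finset ℤ}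
    (hQ : ∀ c ∈ Q, ∃ j, IsKink (colOf σ c) j) : Q.card ≤ bad.card * ℓ := by
  classical
  have hsub : Q ⊆ bad.biUnion fun k => Finset.Ico (o.1 + ℓ * k.1) (o.1 + ℓ * k.1 + ℓ) := by
    intro c hc
    by_contra hcon
    simp only [Finset.mem_biUnion, Finset.mem_Ico, not_exists, not_and] at hcon
    obtain ⟨j, hj⟩ := hQ c hc
    have hne : σ (c, j - 1) ≠ σ (c, j) := hj
    have hgood : ∀ y : ℤ, tileIndex o ℓ (c, y) ∉ bad := by
      intro y hy
      obtain ⟨⟨h1, h2⟩, _⟩ := (tileIndex_eq_iff (o := o) hℓ (c, y) _).1 rfl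
      exact hcon _ hy h1 h2
    obtain ⟨y, hy⟩ : ∃ y, HasBond σ (tile o ℓ (tileIndex o ℓ (c, y))) .horizontal := by
      rcases (unit_ne_iff _ _).1 hne with ⟨h1, h2⟩ | ⟨h1, h2⟩
      · exact ⟨j - 1, (c, j), (mem_boundaryIn_horizontal _ _ _ _).2
          (Or.inl ⟨h1, h2, (mem_tile_iff hℓ _ _).2 rfl⟩)⟩
      · exact ⟨j, (c, j), (mem_boundaryIn_horizontal _ _ _ _).2
          (Or.inr ⟨h1, h2, (mem_tile_iff hℓ _ _).2 rfl⟩)⟩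
    set k₀ := tileIndex o ℓ (c, y) with hk₀
    have hgood' : ∀ n : ℕ, k₀ + (0, (n : ℤ)) ∉ bad := by
      intro n
      have := hgood (y + ℓ * n)
      have h1 : tileIndex o ℓ (c, y + ℓ * n) = k₀ + (0, (n : ℤ)) := by
        rw [hk₀]
        unfold tileIndex
        have h0 : (ℓ : ℤ) ≠ 0 := by omega
        simp only [Prod.mk_add_mk, add_zero]
        rw [show y + ℓ * (n : ℤ) - o.2 = y - o.2 + ℓ * n by ring, Int.add_mul_ediv_left _ _ h0]
      rwa [h1] at this
    have hall : ∀ n : ℕ, HasBond σ (tile o ℓ (k₀ + (0, (n : ℤ)))) .horizontal := by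
      intro n
      induction n with
      | zero =>
        have h0 : k₀ + (0, ((0 : ℕ) : ℤ)) = k₀ := by ext <;> simp
        rwa [h0]
      | succ n ih =>
        have g1 := hgood' n
        have g2 := hgood' (n + 1)
        rw [hbad] at g1 g2
        refine (hasBond_horizontal_iff hℓ g1 g2 (Or.inl rfl) (Or.inr ?_)).1 ih
        push_cast
        rw [add_assoc]
        simp
    refine (Set.infinite_of_injective_forall_mem (f := fun n : ℕ => k₀ + (0, (n : ℤ))) ?_ hall)
      (finite_hasBond_horizontal hℓ hh hX)
    intro a b hab
    simpa using hab
  refine (Finset.card_le_card hsub).trans (Finset.card_biUnion_le.trans (le_of_eq ?_))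
  simp [Int.card_Ico]

end bad

lemma width_of_subset_run {τ : ℤ → ℤˣ} {i a : ℤ} {m : ℕ} (h : Set.Ico a (a + m) ⊆ run τ i) :
    width τ i = 0 ∨ m ≤ width τ i := by
  rcases (run τ i).finite_or_infinite with hf | hi
  · right
    have := Set.ncard_le_ncard h hf
    rwa [← Finset.coe_Ico, Set.ncard_coe_finset, Int.card_Ico, add_sub_cancel_left,
      Int.toNat_natCast] at this
  · exact Or.inl (width_eq_zero_of_infinite hi)

lemma widths_in_hole {σ : Config} {a : Site} {m : ℕ} (hu : IsUniformOn σ (rect a m m)) {x : Site}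
    (hx : x ∈ rect a m m) :
    (hWidth σ x = 0 ∨ m ≤ hWidth σ x) ∧ (vWidth σ x = 0 ∨ m ≤ vWidth σ x) := by
  obtain ⟨u, hu⟩ : ∃ u, ∀ x ∈ rect a m m, σ x = u := by
    rcases hu with hu | hu
    · exact ⟨_, hu⟩
    · exact ⟨_, hu⟩
  unfold rect at hu hx
  simp only [Set.mem_ofPred_eq] at hu hx
  constructor
  · refine width_of_subset_run (a := a.1) fun j hj => ?_
    refine mem_run_of_Icc (a := a.1) (b := a.1 + m - 1) (u := u) (Set.mem_Icc.2 (by omega))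
      (Set.mem_Icc.2 (by have := Set.mem_Ico.1 hj; omega)) fun i hi => hu (i, x.2) ?_
    have := Set.mem_Icc.1 hi
    exact ⟨this.1, by show i < _; omega, hx.2.2.1, hx.2.2.2⟩
  · refine width_of_subset_run (a := a.2) fun j hj => ?_
    refine mem_run_of_Icc (a := a.2) (b := a.2 + m - 1) (u := u) (Set.mem_Icc.2 (by omega))
      (Set.mem_Icc.2 (by have := Set.mem_Ico.1 hj; omega)) fun i hi => hu (x.1, i) ?_
    have := Set.mem_Icc.1 hi
    exact ⟨hx.1, hx.2.1, this.1, by show i < _; omega⟩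

/-! ### Balancing gains and costs -/

open Classical in
/-- The gain at the site `x`: the energy, in excess of the optimal one, of a stripe whose width is
that of `σ` at `x`, measured across the stripes. In tiles that are not clearly striped, the
direction is chosen so that the walls in the other direction are few. -/
noncomputable def siteGain (p J : ℝ) (hs : ℕ) (σ : Config) (o : Site) (ℓ : ℕ) (x : Site) : ℝ :=
  stripeEnergy p J (if RowsCornered σ (tile o ℓ (tileIndex o ℓ x)) then hWidth σ x
    else vWidth σ x) - stripeEnergy p J hs

open Classical in
lemma siteGain_nonneg {p : ℝ} (hp : 3 < p) {J : ℝ} {hs : ℕ} (hopt : IsOptimalWidth p J hs)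
    (hneg : stripeEnergy p J hs ≤ 0) (σ : Config) (o : Site) (ℓ : ℕ) (x : Site) :
    0 ≤ siteGain p J hs σ o ℓ x := by
  unfold siteGain
  set w := if RowsCornered σ (tile o ℓ (tileIndex o ℓ x)) then hWidth σ x else vWidth σ x
  rcases Nat.eq_zero_or_pos w with h0 | h1
  · rw [h0, stripeEnergy_zero hp]
    linarith
  · exact sub_nonneg.2 (hopt.2 w h1)

open Classical in
/-- A hole contains no walls, so a positive fraction of the optimal energy is lost there. -/
lemma sum_siteGain_of_hasHole {p : ℝ} (hp : 3 < p) {J : ℝ} {hs : ℕ}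
    (hopt : IsOptimalWidth p J hs) (hneg : stripeEnergy p J hs ≤ 0) {σ : Config} {o : Site} {ℓ : ℕ}
    (hℓ : 1 ≤ ℓ) (hlarge : 20 * (Jc p - J) ≤ ℓ * -stripeEnergy p J hs) {k : ℤ × ℤ}
    (hhole : HasHole σ ℓ (tile o ℓ k)) :
    (ℓ : ℝ) ^ 2 * -stripeEnergy p J hs / 50 ≤ ∑ x ∈ tileSites o ℓ k, siteGain p J hs σ o ℓ x := by
  obtain ⟨a, m, hm, hsub, hu⟩ := hhole
  have hℓ0 : (0 : ℝ) < ℓ := by exact_mod_cast hℓ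
  have hm0 : (0 : ℝ) < m := by linarith
  set R : Finset Site := Finset.Ico a.1 (a.1 + m) ×ˢ Finset.Ico a.2 (a.2 + m) with hR
  have hmemR : ∀ x, x ∈ R ↔ x ∈ rect a m m := by
    intro x
    unfold rect
    simp [hR, and_assoc]
  have hRsub : R ⊆ tileSites o ℓ k := fun x hx =>
    (mem_tileSites hℓ _ _).2 ((mem_tile_iff hℓ _ _).1 (hsub ((hmemR x).1 hx)))
  have hgain : ∀ x ∈ R, -stripeEnergy p J hs / 2 ≤ siteGain p J hs σ o ℓ x := by
    intro x hx
    obtain ⟨w1, w2⟩ := widths_in_hole hu ((hmemR x).1 hx)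
    unfold siteGain
    set w := if RowsCornered σ (tile o ℓ (tileIndex o ℓ x)) then hWidth σ x else vWidth σ x with hw
    have hw' : w = 0 ∨ m ≤ w := by
      rw [hw]
      split_ifs
      · exact w1
      · exact w2
    rcases hw' with h0 | h1
    · rw [h0, stripeEnergy_zero hp]
      linarith
    · have h2 := neg_le_stripeEnergy hp J w
      have h1' : (m : ℝ) ≤ w := by exact_mod_cast h1
      have hw0 : (0 : ℝ) < w := by linarith
      have h3 : 2 * (Jc p - J) / w ≤ -stripeEnergy p J hs / 2 := by
        rw [div_le_iff₀ hw0]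
        have h4 : (ℓ : ℝ) / 5 ≤ w := hm.trans h1'
        have h5 : -stripeEnergy p J hs / 2 * (ℓ / 5) ≤ -stripeEnergy p J hs / 2 * w :=
          mul_le_mul_of_nonneg_left h4 (by linarith)
        linarith
      rw [neg_div] at h2
      linarith
  have hcard : (R.card : ℝ) = (m : ℝ) ^ 2 := by
    rw [hR, Finset.card_product, Int.card_Ico, Int.card_Ico, add_sub_cancel_left,
      add_sub_cancel_left, Int.toNat_natCast]
    push_cast
    ring
  calc (ℓ : ℝ) ^ 2 * -stripeEnergy p J hs / 50 = (ℓ / 5) ^ 2 * (-stripeEnergy p J hs / 2) := by ring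
    _ ≤ (m : ℝ) ^ 2 * (-stripeEnergy p J hs / 2) := by gcongr; linarith
    _ = ∑ x ∈ R, (-stripeEnergy p J hs / 2) := by rw [Finset.sum_const, nsmul_eq_mul, hcard]
    _ ≤ ∑ x ∈ R, siteGain p J hs σ o ℓ x := Finset.sum_le_sum hgain
    _ ≤ ∑ x ∈ tileSites o ℓ k, siteGain p J hs σ o ℓ x :=
        Finset.sum_le_sum_of_subset_of_nonneg hRsub fun x _ _ =>
          siteGain_nonneg hp hopt hneg σ o ℓ x

open Classical in
/-- The energy difference bounds the gains in the good tiles, the number of corners and the number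
of holes. -/
theorem energy_sub_ge_gain {p : ℝ} (hp : 3 < p) {J : ℝ} (hJ : J < Jc p) {hs : ℕ}
    (hopt : IsOptimalWidth p J hs) (hneg : stripeEnergy p J hs ≤ 0) {σ : Config} {X : Finset Site}
    (hX : ∀ x ∉ X, σ x = stripe hs x) {o : Site} {ℓ : ℕ} (hℓ5 : 5 * hs < ℓ)
    (hlarge : 1000 * (Jc p - J) ≤ ℓ * -stripeEnergy p J hs)
    (hsmall : 56 * ((Jc p - J) * ℓ) ≤ 2 ^ (-p)) :
    ∃ (B : Finset Site) (bad V : Finset (ℤ × ℤ)),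
      (∀ v, v ∈ V ↔ IsCornerVertex σ v) ∧ (∀ k, k ∈ bad ↔ IsBad σ ℓ (tile o ℓ k)) ∧
      (∀ x ∉ B, siteGain p J hs σ o ℓ x = 0) ∧
      ∑ x ∈ B.filter (fun x => tileIndex o ℓ x ∉ bad), siteGain p J hs σ o ℓ x +
        2 ^ (-p) * V.card + (ℓ : ℝ) ^ 2 * -stripeEnergy p J hs / 100 *
          (bad.filter fun k => HasHole σ ℓ (tile o ℓ k)).card ≤
      energy p J X σ (stripe hs) - energy p J X (stripe hs) (stripe hs) := by
  have hh : 1 ≤ hs := hopt.1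
  have hℓ : 1 ≤ ℓ := by omega
  obtain ⟨S, Q, V, hQ, hV, hS, hE⟩ := energy_sub_ge hp J hh hX
  have hbadfin : {k | IsBad σ ℓ (tile o ℓ k)}.Finite := finite_isBad hℓ hh hX hℓ5 hV
  set bad := hbadfin.toFinset with hbaddef
  have hbad : ∀ k, k ∈ bad ↔ IsBad σ ℓ (tile o ℓ k) := fun k => by
    rw [hbaddef, Set.Finite.mem_toFinset]; rfl
  set M : ℤ × ℤ → Prop := fun k => RowsCornered σ (tile o ℓ k) with hM
  have hMfin : {k | ¬ M k}.Finite := by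
    refine (finite_hasBond_horizontal (o := o) hℓ hh hX).subset fun k hk => ?_
    have hk' : ¬ RowsCornered σ (tile o ℓ k) := hk
    unfold RowsCornered at hk'
    push Not at hk'
    obtain ⟨j, ⟨i, hi⟩, _⟩ := hk'
    exact ⟨(i, j), hi⟩
  set P : ℤ × ℤ → ℕ := fun k => (cornerEnds σ (tile o ℓ k)).ncard with hP
  set τ := Jc p - J with hτ
  have hτ0 : 0 < τ := sub_pos.2 hJ
  set B : Finset Site := S ∪ (bad ∪ hMfin.toFinset).biUnion (tileSites o ℓ) with hB
  have hSB : S ⊆ B := Finset.subset_union_left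
  have hmemB : ∀ x, tileIndex o ℓ x ∈ bad ∨ ¬ M (tileIndex o ℓ x) → x ∈ B := by
    intro x hx
    refine Finset.mem_union_right _ (Finset.mem_biUnion.2 ⟨tileIndex o ℓ x, ?_,
      (mem_tileSites hℓ _ _).2 rfl⟩)
    rcases hx with hx | hx
    · exact Finset.mem_union_left _ hx
    · exact Finset.mem_union_right _ (hMfin.mem_toFinset.2 hx)
  refine ⟨B, bad, V, hV, hbad, fun x hx => ?_, ?_⟩
  · have h1 : M (tileIndex o ℓ x) := by
      by_contra hc
      exact hx (hmemB x (Or.inr hc))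
    unfold siteGain
    rw [if_pos h1, (hS x fun h => hx (hSB h)).1, sub_self]
  -- the sum of the local energies over `B`
  have hsumB : ∑ x ∈ S, (stripeEnergy p J (hWidth σ x) - stripeEnergy p J hs +
      stripeEnergy p J (vWidth σ x)) = ∑ x ∈ B, (stripeEnergy p J (hWidth σ x) -
        stripeEnergy p J hs + stripeEnergy p J (vWidth σ x)) := by
    refine Finset.sum_subset hSB fun x _ hx => ?_
    obtain ⟨h1, h2⟩ := hS x hx
    rw [h1, h2, stripeEnergy_zero hp]
    ring
  have hlocal : ∀ x, siteGain p J hs σ o ℓ x -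
      2 * τ * ((if M (tileIndex o ℓ x) then 1 / (vWidth σ x : ℝ) else 0) +
        (if ¬ M (tileIndex o ℓ x) then 1 / (hWidth σ x : ℝ) else 0)) ≤
      stripeEnergy p J (hWidth σ x) - stripeEnergy p J hs + stripeEnergy p J (vWidth σ x) := by
    intro x
    have e1 := neg_le_stripeEnergy hp J (vWidth σ x)
    have e2 := neg_le_stripeEnergy hp J (hWidth σ x)
    rw [← hτ, div_eq_mul_one_div] at e1 e2
    unfold siteGain
    by_cases hx : M (tileIndex o ℓ x)
    · rw [if_pos hx, if_pos hx, if_neg (not_not.2 hx)]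
      linarith
    · rw [if_neg hx, if_neg hx, if_pos hx]
      linarith
  have hgoodV : ∀ k, k ∉ bad → (M k ↔ ¬ HasBond σ (tile o ℓ k) .horizontal) := fun k hk =>
    rowsCornered_iff_of_good fun h => hk ((hbad k).2 h)
  have hgoodH : ∀ k, k ∉ bad → ¬ M k → ¬ HasBond σ (tile o ℓ k) .vertical := by
    intro k hk hMk hv
    have hk' : ¬ IsBad σ ℓ (tile o ℓ k) := fun h => hk ((hbad k).2 h)
    exact not_both_of_good hk' ⟨by_contra fun h => hMk ((hgoodV k hk).2 h), hv⟩
  have hVcost : ∑ x ∈ B, (if M (tileIndex o ℓ x) then 1 / (vWidth σ x : ℝ) else 0) ≤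
      ∑ k ∈ bad, (2 * ℓ + ℓ * P k : ℝ) := by
    have := sum_inv_vWidth_tiles_le (σ := σ) (o := o) hℓ (M := M) (bad := bad) (P := P)
      (A := B.filter fun x => M (tileIndex o ℓ x) ∧ vWidth σ x ≠ 0) ?_ ?_ ?_ ?_
    · refine le_trans (le_of_eq ?_) this
      rw [← Finset.sum_filter, ← Finset.filter_filter]
      refine (Finset.sum_subset (Finset.filter_subset _ _) fun x hx hx' => ?_).symm
      rw [Finset.mem_filter, not_and, not_not] at hx'
      rw [hx' hx]
      simp
    · intro x hx hMx h
      have hno := (hgoodV _ hx).1 hMx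
      have hxT : x ∈ tile o ℓ (tileIndex o ℓ x) := (mem_tile_iff hℓ _ _).2 rfl
      constructor
      · by_contra hc
        refine hno ⟨(x.1, x.2 + 1), (mem_boundaryIn_horizontal _ _ _ _).2 (Or.inl ?_)⟩
        rw [add_sub_cancel_right]
        exact ⟨h, (Int.units_eq_one_or _).resolve_right hc, hxT⟩
      · by_contra hc
        exact hno ⟨(x.1, x.2), (mem_boundaryIn_horizontal _ _ _ _).2
          (Or.inr ⟨h, (Int.units_eq_one_or _).resolve_right hc, hxT⟩)⟩
    · intro k hk hk' hMk
      rw [hgoodV k hk] at hMk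
      rw [hgoodV _ hk']
      rw [hbad] at hk hk'
      rwa [← hasBond_horizontal_iff hℓ hk hk' (Or.inl rfl) (Or.inr rfl)]
    · intro k _ hMk
      exact card_horizontal_walls_le hℓ hV hMk
    · intro x
      rw [Finset.mem_filter]
      refine ⟨fun h => h.2, fun h => ⟨hSB (by_contra fun hx => h.2 (hS x hx).2), h⟩⟩
  have hHcost : ∑ x ∈ B, (if ¬ M (tileIndex o ℓ x) then 1 / (hWidth σ x : ℝ) else 0) ≤
      ∑ k ∈ bad, (2 * ℓ + ℓ * P k : ℝ) := by
    have := sum_inv_hWidth_tiles_le (σ := σ) (o := o) hℓ (M := fun k => ¬ M k) (bad := bad) (P := P)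
      (A := B.filter fun x => ¬ M (tileIndex o ℓ x) ∧ hWidth σ x ≠ 0) ?_ ?_ ?_ ?_
    · refine le_trans (le_of_eq ?_) this
      rw [← Finset.sum_filter, ← Finset.filter_filter]
      refine (Finset.sum_subset (Finset.filter_subset _ _) fun x hx hx' => ?_).symm
      rw [Finset.mem_filter, not_and, not_not] at hx'
      rw [hx' hx]
      simp
    · intro x hx hMx h
      have hno := hgoodH _ hx hMx
      have hxT : x ∈ tile o ℓ (tileIndex o ℓ x) := (mem_tile_iff hℓ _ _).2 rfl
      constructor
      · by_contra hc
        refine hno ⟨(x.1 + 1, x.2), (mem_boundaryIn_vertical _ _ _ _).2 (Or.inl ?_)⟩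
        rw [add_sub_cancel_right]
        exact ⟨h, (Int.units_eq_one_or _).resolve_right hc, hxT⟩
      · by_contra hc
        exact hno ⟨(x.1, x.2), (mem_boundaryIn_vertical _ _ _ _).2
          (Or.inr ⟨h, (Int.units_eq_one_or _).resolve_right hc, hxT⟩)⟩
    · intro k hk hk' hMk
      rw [hgoodV k hk, not_not] at hMk
      rw [hgoodV _ hk', not_not]
      rw [hbad] at hk hk'
      rwa [← hasBond_horizontal_iff hℓ hk hk' (Or.inl rfl) (Or.inl rfl)]
    · intro k _ hMk
      exact card_vertical_walls_le hℓ hV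
        ((rowsCornered_or_columnsCornered σ o ℓ k).resolve_left hMk)
    · intro x
      rw [Finset.mem_filter]
      exact ⟨fun h => h.2, fun h => ⟨hmemB x (Or.inr h.1), h⟩⟩
  have hQcard : (Q.card : ℝ) ≤ bad.card * ℓ := by
    exact_mod_cast card_columns_le hℓ hh hX hbad hQ
  -- the gains in the bad tiles
  have hsplit : ∑ x ∈ B, siteGain p J hs σ o ℓ x =
      ∑ x ∈ B.filter (fun x => tileIndex o ℓ x ∉ bad), siteGain p J hs σ o ℓ x +
      ∑ k ∈ bad, ∑ x ∈ tileSites o ℓ k, siteGain p J hs σ o ℓ x := by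
    rw [← Finset.sum_filter_not_add_sum_filter B fun x => tileIndex o ℓ x ∈ bad]
    congr 1
    rw [← Finset.sum_fiberwise_of_maps_to (g := tileIndex o ℓ) (t := bad)
      fun x hx => (Finset.mem_filter.1 hx).2]
    refine Finset.sum_congr rfl fun k hk => Finset.sum_congr ?_ fun _ _ => rfl
    ext x
    rw [Finset.mem_filter, Finset.mem_filter, mem_tileSites hℓ]
    constructor
    · exact fun h => h.2
    · rintro rfl
      exact ⟨⟨hmemB x (Or.inl hk), hk⟩, rfl⟩
  have htile : ∀ k ∈ bad, (if HasHole σ ℓ (tile o ℓ k) then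
      (ℓ : ℝ) ^ 2 * -stripeEnergy p J hs / 100 else 0) + 2 * τ * ℓ * 5 ≤
      ∑ x ∈ tileSites o ℓ k, siteGain p J hs σ o ℓ x + 2 * τ * ℓ * (5 * P k) := by
    intro k hk
    have hℓ0 : (0 : ℝ) < ℓ := by exact_mod_cast hℓ
    have hcost : 0 < 2 * τ * ℓ := by positivity
    split_ifs with hhole
    · have h1 := sum_siteGain_of_hasHole hp hopt hneg hℓ (by linarith) hhole
      have h2 : (0 : ℝ) ≤ 2 * τ * ℓ * (5 * P k) := by positivity
      have h3 : 1000 * τ * ℓ ≤ ℓ * -stripeEnergy p J hs * ℓ :=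
        mul_le_mul_of_nonneg_right hlarge hℓ0.le
      linarith
    · have h1 : 0 ≤ ∑ x ∈ tileSites o ℓ k, siteGain p J hs σ o ℓ x :=
        Finset.sum_nonneg fun x _ => siteGain_nonneg hp hopt hneg σ o ℓ x
      have h2 : 1 ≤ P k := by
        have hne := (numCornersIn_pos_iff _ _).1 (((hbad k).1 hk).resolve_right hhole)
        exact Nat.one_le_iff_ne_zero.2
          ((Set.ncard_pos (finite_cornerEnds hV _)).2 hne).ne'
      have h3 : (1 : ℝ) ≤ P k := by exact_mod_cast h2
      have h4 := mul_le_mul_of_nonneg_left h3 hcost.le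
      linarith
  have hsumtile := Finset.sum_le_sum htile
  rw [Finset.sum_add_distrib, Finset.sum_add_distrib, ← Finset.sum_filter, Finset.sum_const,
    Finset.sum_const, nsmul_eq_mul, nsmul_eq_mul, ← Finset.mul_sum, ← Finset.mul_sum] at hsumtile
  have hPsum : ∑ k ∈ bad, (P k : ℝ) ≤ 4 * V.card := by
    exact_mod_cast sum_ncard_cornerEnds_le (o := o) hℓ hV bad
  have hcosts : ∑ k ∈ bad, (2 * ℓ + ℓ * P k : ℝ) = bad.card * (2 * ℓ) + ℓ * ∑ k ∈ bad, (P k : ℝ) := by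
    rw [Finset.sum_add_distrib, Finset.sum_const, nsmul_eq_mul, Finset.mul_sum]
  rw [hcosts] at hVcost hHcost
  have hsum := Finset.sum_le_sum fun x (_ : x ∈ B) => hlocal x
  rw [Finset.sum_sub_distrib, ← Finset.mul_sum, Finset.sum_add_distrib, hsplit, ← hsumB] at hsum
  have c1 : 2 * τ * (∑ x ∈ B, (if M (tileIndex o ℓ x) then 1 / (vWidth σ x : ℝ) else 0) +
      ∑ x ∈ B, (if ¬ M (tileIndex o ℓ x) then 1 / (hWidth σ x : ℝ) else 0)) ≤
      2 * τ * (2 * (bad.card * (2 * ℓ) + ℓ * ∑ k ∈ bad, (P k : ℝ))) :=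
    mul_le_mul_of_nonneg_left (by linarith) (by linarith)
  have c2 : 2 * τ * Q.card ≤ 2 * τ * (bad.card * ℓ) :=
    mul_le_mul_of_nonneg_left hQcard (by linarith)
  have c3 : 14 * (τ * ℓ) * ∑ k ∈ bad, (P k : ℝ) ≤ 14 * (τ * ℓ) * (4 * V.card) :=
    mul_le_mul_of_nonneg_left hPsum (by positivity)
  have c4 : 56 * (τ * ℓ) * V.card ≤ 2 ^ (-p) * V.card :=
    mul_le_mul_of_nonneg_right hsmall (Nat.cast_nonneg _)
  linarith

/-! ### Good regions -/

section regions

variable {σ : Config} {o : Site} {ℓ : ℕ}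

lemma mem_goodSites (hℓ : 1 ≤ ℓ) (x : Site) :
    x ∈ goodSites σ o ℓ ↔ ¬ IsBad σ ℓ (tile o ℓ (tileIndex o ℓ x)) := by
  unfold goodSites
  simp only [Set.mem_compl_iff, Set.mem_iUnion, Set.mem_ofPred_eq, exists_prop, not_exists, not_and,
    mem_tile_iff hℓ]
  constructor
  · intro h hb
    exact h _ hb rfl
  · rintro h k hk rfl
    exact h hk

lemma GoodRegion.mem_sites (G : GoodRegion σ o ℓ) (x : Site) :
    x ∈ G.sites ↔ ∃ hx : x ∈ goodSites σ o ℓ,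
      (latticeGraph.induce (goodSites σ o ℓ)).connectedComponentMk ⟨x, hx⟩ = G := by
  unfold GoodRegion.sites
  simp only [Set.mem_image, SimpleGraph.ConnectedComponent.mem_supp_iff, Subtype.exists,
    exists_and_right, exists_eq_right]

lemma ediv_sub_of_abs_eq_one (hℓ : 1 ≤ ℓ) {a b : ℤ} (h : |a - b| = 1) :
    b / ℓ = a / ℓ ∨ ∃ d : ℤ, (d = 1 ∨ d = -1) ∧ b / ℓ = a / ℓ + d := by
  obtain ⟨h1, h2⟩ := (ediv_eq_iff_bounds hℓ a _).1 rfl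
  set q := a / (ℓ : ℤ)
  rcases (abs_eq zero_le_one).1 h with h | h
  · by_cases hb : ℓ * q ≤ b
    · exact Or.inl ((ediv_eq_iff_bounds hℓ _ _).2 ⟨hb, by linarith⟩)
    · refine Or.inr ⟨-1, Or.inr rfl, (ediv_eq_iff_bounds hℓ _ _).2 ?_⟩
      rw [mul_add]
      constructor <;> omega
  · by_cases hb : b < ℓ * q + ℓ
    · exact Or.inl ((ediv_eq_iff_bounds hℓ _ _).2 ⟨by linarith, hb⟩)
    · refine Or.inr ⟨1, Or.inl rfl, (ediv_eq_iff_bounds hℓ _ _).2 ?_⟩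
      rw [mul_add]
      constructor <;> omega

/-- Neighbouring sites lie in the same tile or in neighbouring tiles. -/
lemma tileIndex_of_adj (hℓ : 1 ≤ ℓ) {x y : Site} (h : latticeGraph.Adj x y) :
    tileIndex o ℓ y = tileIndex o ℓ x ∨ ∃ d : ℤ, (d = 1 ∨ d = -1) ∧
      (tileIndex o ℓ y = tileIndex o ℓ x + (d, 0) ∨
        tileIndex o ℓ y = tileIndex o ℓ x + (0, d)) := by
  have h' : |x.1 - y.1| + |x.2 - y.2| = 1 := h
  have n1 := abs_nonneg (x.1 - y.1)
  have n2 := abs_nonneg (x.2 - y.2)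
  unfold tileIndex
  rcases (by omega : (|x.1 - y.1| = 1 ∧ |x.2 - y.2| = 0) ∨ (|x.1 - y.1| = 0 ∧ |x.2 - y.2| = 1)) with
    ⟨a, b⟩ | ⟨a, b⟩
  · rw [abs_eq_zero, sub_eq_zero] at b
    rcases ediv_sub_of_abs_eq_one (a := x.1 - o.1) (b := y.1 - o.1) hℓ (by simpa using a) with
      e | ⟨d, hd, e⟩
    · exact Or.inl (by rw [e, b])
    · exact Or.inr ⟨d, hd, Or.inl (by rw [e, b]; simp)⟩
  · rw [abs_eq_zero, sub_eq_zero] at a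
    rcases ediv_sub_of_abs_eq_one (a := x.2 - o.2) (b := y.2 - o.2) hℓ (by simpa using b) with
      e | ⟨d, hd, e⟩
    · exact Or.inl (by rw [e, a])
    · exact Or.inr ⟨d, hd, Or.inr (by rw [e, a]; simp)⟩

lemma hasBond_iff_of_walk (hℓ : 1 ≤ ℓ) {u v : goodSites σ o ℓ}
    (w : (latticeGraph.induce (goodSites σ o ℓ)).Walk u v) :
    HasBond σ (tile o ℓ (tileIndex o ℓ u.1)) .horizontal ↔
      HasBond σ (tile o ℓ (tileIndex o ℓ v.1)) .horizontal := by
  induction w with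
  | nil => rfl
  | @cons u v w hadj _ ih =>
    refine Iff.trans ?_ ih
    have hadj' : latticeGraph.Adj u.1 v.1 := hadj
    rcases tileIndex_of_adj (o := o) hℓ hadj' with e | ⟨d, hd, e⟩
    · rw [e]
    · exact hasBond_horizontal_iff hℓ ((mem_goodSites hℓ _).1 u.2) ((mem_goodSites hℓ _).1 v.2) hd e

/-- All tiles of a good region are striped in the same direction. -/
lemma hasBond_iff_of_mem_sites (hℓ : 1 ≤ ℓ) {G : GoodRegion σ o ℓ} {x y : Site}
    (hx : x ∈ G.sites) (hy : y ∈ G.sites) :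
    HasBond σ (tile o ℓ (tileIndex o ℓ x)) .horizontal ↔
      HasBond σ (tile o ℓ (tileIndex o ℓ y)) .horizontal := by
  obtain ⟨hxg, hxG⟩ := (G.mem_sites x).1 hx
  obtain ⟨hyg, hyG⟩ := (G.mem_sites y).1 hy
  have h : (latticeGraph.induce (goodSites σ o ℓ)).Reachable ⟨x, hxg⟩ ⟨y, hyg⟩ :=
    SimpleGraph.ConnectedComponent.exact (hxG.trans hyG.symm)
  exact h.elim fun w => hasBond_iff_of_walk (u := ⟨x, hxg⟩) (v := ⟨y, hyg⟩) hℓ w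

/-- A good region is a union of tiles. -/
lemma mem_sites_of_tileIndex_eq (hℓ : 1 ≤ ℓ) {G : GoodRegion σ o ℓ} {x y : Site}
    (hx : x ∈ G.sites) (hxy : tileIndex o ℓ y = tileIndex o ℓ x) : y ∈ G.sites := by
  obtain ⟨hxg, hxG⟩ := (G.mem_sites x).1 hx
  set k := tileIndex o ℓ x with hk
  have hgood : ∀ z : Site, tileIndex o ℓ z = k → z ∈ goodSites σ o ℓ := fun z hz => by
    rw [mem_goodSites hℓ, hz, hk]
    exact (mem_goodSites hℓ _).1 hxg
  have hstep : ∀ z w : Site, latticeGraph.Adj z w → tileIndex o ℓ w = k → z ∈ G.sites →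
      w ∈ G.sites := by
    intro z w hzw hwk hz
    obtain ⟨hzg, hzG⟩ := (G.mem_sites z).1 hz
    refine (G.mem_sites w).2 ⟨hgood w hwk, ?_⟩
    rw [← hzG]
    refine (SimpleGraph.ConnectedComponent.sound (SimpleGraph.Adj.reachable ?_)).symm
    exact hzw
  obtain ⟨⟨x1, x2⟩, x3, x4⟩ := (tileIndex_eq_iff (o := o) hℓ x k).1 rfl
  obtain ⟨⟨y1, y2⟩, y3, y4⟩ := (tileIndex_eq_iff (o := o) hℓ y k).1 hxy
  have hidx : ∀ i j : ℤ, o.1 + ℓ * k.1 ≤ i → i < o.1 + ℓ * k.1 + ℓ → o.2 + ℓ * k.2 ≤ j →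
      j < o.2 + ℓ * k.2 + ℓ → tileIndex o ℓ (i, j) = k := fun i j a b c d =>
    (tileIndex_eq_iff hℓ _ _).2 ⟨⟨a, b⟩, c, d⟩
  have h1 : (y.1, x.2) ∈ G.sites := by
    have key : ∀ i, o.1 + ℓ * k.1 ≤ i → i < o.1 + ℓ * k.1 + ℓ → (i, x.2) ∈ G.sites := by
      intro i
      induction i using Int.inductionOn' (b := x.1) with
      | zero => exact fun _ _ => hx
      | succ i hi ih =>
        intro a b
        exact hstep _ _ (by show |i - (i + 1)| + |x.2 - x.2| = 1; simp) (hidx _ _ a b x3 x4)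
          (ih (by omega) (by omega))
      | pred i hi ih =>
        intro a b
        exact hstep _ _ (by show |i - (i - 1)| + |x.2 - x.2| = 1; simp) (hidx _ _ a b x3 x4)
          (ih (by omega) (by omega))
    exact key y.1 y1 y2
  have key : ∀ j, o.2 + ℓ * k.2 ≤ j → j < o.2 + ℓ * k.2 + ℓ → (y.1, j) ∈ G.sites := by
    intro j
    induction j using Int.inductionOn' (b := x.2) with
    | zero => exact fun _ _ => h1
    | succ i hi ih =>
      intro a b
      exact hstep _ _ (by show |y.1 - y.1| + |i - (i + 1)| = 1; simp) (hidx _ _ y1 y2 a b)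
        (ih (by omega) (by omega))
    | pred i hi ih =>
      intro a b
      exact hstep _ _ (by show |y.1 - y.1| + |i - (i - 1)| = 1; simp) (hidx _ _ y1 y2 a b)
        (ih (by omega) (by omega))
  exact key y.2 y3 y4

/-- The direction of a good region can be read off from any of its tiles. -/
lemma isVerticallyStriped_iff (hℓ : 1 ≤ ℓ) {G : GoodRegion σ o ℓ} {x : Site} (hx : x ∈ G.sites) :
    IsVerticallyStriped σ G.sites ↔ RowsCornered σ (tile o ℓ (tileIndex o ℓ x)) := by
  obtain ⟨hxg, _⟩ := (G.mem_sites x).1 hx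
  rw [rowsCornered_iff_of_good ((mem_goodSites hℓ _).1 hxg)]
  constructor
  · rintro h ⟨v, hb, hs⟩
    have hsub : ∀ y ∈ tile o ℓ (tileIndex o ℓ x), y ∈ G.sites := fun y hy =>
      mem_sites_of_tileIndex_eq hℓ hx ((mem_tile_iff hℓ _ _).1 hy)
    have := h ⟨.horizontal, v⟩ ⟨hb, hs.imp (fun h => ⟨h.1, hsub _ h.2⟩) fun h => ⟨h.1, hsub _ h.2⟩⟩
    simp at this
  · rintro h ⟨d, v⟩ ⟨hb, hs⟩
    cases d
    · exfalso
      rcases hs with ⟨h1, h2⟩ | ⟨h1, h2⟩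
      · exact h ((hasBond_iff_of_mem_sites hℓ hx h2).2
          ⟨v, hb, Or.inl ⟨h1, (mem_tile_iff hℓ _ _).2 rfl⟩⟩)
      · exact h ((hasBond_iff_of_mem_sites hℓ hx h2).2
          ⟨v, hb, Or.inr ⟨h1, (mem_tile_iff hℓ _ _).2 rfl⟩⟩)
    · rfl

lemma IsUniformOn.exists_eq {R : Set Site} (hu : IsUniformOn σ R) : ∃ u, ∀ x ∈ R, σ x = u := by
  rcases hu with hu | hu
  · exact ⟨_, hu⟩
  · exact ⟨_, hu⟩

lemma mem_rect (a x : Site) (w t : ℕ) :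
    x ∈ rect a w t ↔ a.1 ≤ x.1 ∧ x.1 < a.1 + w ∧ a.2 ≤ x.2 ∧ x.2 < a.2 + t := by
  unfold rect
  rw [Set.mem_ofPred_eq]

open Classical in
/-- On a rectangular portion of a stripe of width `h`, the width across the stripes is `h`. -/
lemma width_of_isStripePortion (hℓ : 1 ≤ ℓ) {G : GoodRegion σ o ℓ} {h : ℕ} {R : Set Site}
    (hR : IsStripePortion σ G.sites h R) {x : Site} (hx : x ∈ R) :
    x ∈ G.sites ∧ (if RowsCornered σ (tile o ℓ (tileIndex o ℓ x)) then hWidth σ x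
      else vWidth σ x) = h := by
  rcases hR with ⟨hG, a, t, rfl, hsub, hu, hb⟩ | ⟨hG, a, t, rfl, hsub, hu, hb⟩
  · refine ⟨hsub hx, ?_⟩
    rw [if_pos ((isVerticallyStriped_iff hℓ (hsub hx)).1 hG)]
    obtain ⟨u, hu⟩ := hu.exists_eq
    obtain ⟨x1, x2, x3, x4⟩ := (mem_rect _ _ _ _).1 hx
    obtain ⟨b1, b2⟩ := hb x.2 x3 x4
    have := width_eq (σ := rowOf σ x.2) (i := x.1) (a := a.1) (e := a.1 + h) (u := u) b1.1 b2.1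
      (Set.mem_Ico.2 ⟨x1, x2⟩) fun i hi =>
        hu (i, x.2) ((mem_rect _ _ _ _).2 ⟨hi.1, hi.2, x3, x4⟩)
    unfold hWidth
    rw [this]
    simp
  · refine ⟨hsub hx, ?_⟩
    rw [if_neg fun h => hG ((isVerticallyStriped_iff hℓ (hsub hx)).2 h)]
    obtain ⟨u, hu⟩ := hu.exists_eq
    obtain ⟨x1, x2, x3, x4⟩ := (mem_rect _ _ _ _).1 hx
    obtain ⟨b1, b2⟩ := hb x.1 x1 x2
    have := width_eq (σ := colOf σ x.1) (i := x.2) (a := a.2) (e := a.2 + h) (u := u) b1.1 b2.1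
      (Set.mem_Ico.2 ⟨x3, x4⟩) fun i hi =>
        hu (x.1, i) ((mem_rect _ _ _ _).2 ⟨x1, x2, hi.1, hi.2⟩)
    unfold vWidth
    rw [this]
    simp

open Classical in
/-- Each site of a stripe portion carries the gain of the stripe; no site lies in portions of two
different widths or in two good regions. -/
lemma tsum_stripeArea_le (hℓ : 1 ≤ ℓ) (p J : ℝ) (hs : ℕ) {B : Finset Site}
    (hB : ∀ x ∉ B, siteGain p J hs σ o ℓ x = 0) :
    ∑' (h : {h : ℕ // 1 ≤ h ∧ h ≠ hs}) (G : GoodRegion σ o ℓ),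
      ENNReal.ofReal (stripeEnergy p J h - stripeEnergy p J hs) * stripeArea σ G.sites h ≤
    ∑ x ∈ B.filter (fun x => ¬ IsBad σ ℓ (tile o ℓ (tileIndex o ℓ x))),
      ENNReal.ofReal (siteGain p J hs σ o ℓ x) := by
  set H := {h : ℕ // 1 ≤ h ∧ h ≠ hs}
  set U : H × GoodRegion σ o ℓ → Set Site := fun q =>
    ⋃₀ {R : Set Site | IsStripePortion σ q.2.sites q.1 R} with hU
  set c : H → ℝ≥0∞ := fun h => ENNReal.ofReal (stripeEnergy p J h - stripeEnergy p J hs) with hc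
  have hUx : ∀ q x, x ∈ U q → x ∈ q.2.sites ∧
      (if RowsCornered σ (tile o ℓ (tileIndex o ℓ x)) then hWidth σ x else vWidth σ x) = q.1 := by
    rintro q x ⟨R, hR, hx⟩
    exact width_of_isStripePortion hℓ hR hx
  have harea : ∀ q : H × GoodRegion σ o ℓ, stripeArea σ q.2.sites q.1 =
      ∑' x : Site, (U q).indicator (fun _ => (1 : ℝ≥0∞)) x := by
    intro q
    rw [← tsum_subtype, ENNReal.tsum_set_one]
    rfl
  calc ∑' (h : H) (G : GoodRegion σ o ℓ), c h * stripeArea σ G.sites h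
      = ∑' q : H × GoodRegion σ o ℓ, c q.1 * stripeArea σ q.2.sites q.1 :=
        (ENNReal.tsum_prod (f := fun (h : H) (G : GoodRegion σ o ℓ) =>
          c h * stripeArea σ G.sites h)).symm
    _ = ∑' (q : H × GoodRegion σ o ℓ) (x : Site),
          c q.1 * (U q).indicator (fun _ => (1 : ℝ≥0∞)) x := by
        refine tsum_congr fun q => ?_
        rw [harea, ENNReal.tsum_mul_left]
    _ = ∑' (x : Site) (q : H × GoodRegion σ o ℓ),
          c q.1 * (U q).indicator (fun _ => (1 : ℝ≥0∞)) x := ENNReal.tsum_comm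
    _ ≤ ∑' x : Site, if ¬ IsBad σ ℓ (tile o ℓ (tileIndex o ℓ x)) then
          ENNReal.ofReal (siteGain p J hs σ o ℓ x) else 0 := by
        refine ENNReal.tsum_le_tsum fun x => ?_
        by_cases hex : ∃ q₀, x ∈ U q₀
        · obtain ⟨q₀, hq₀⟩ := hex
          obtain ⟨hG, hw⟩ := hUx q₀ x hq₀
          obtain ⟨hxg, hxG⟩ := (q₀.2.mem_sites x).1 hG
          rw [tsum_eq_single q₀, if_pos ((mem_goodSites hℓ _).1 hxg), Set.indicator_of_mem hq₀,
            mul_one]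
          · unfold siteGain
            rw [hw]
          · intro q hq
            rw [Set.indicator_of_notMem, mul_zero]
            intro hxq
            obtain ⟨hG', hw'⟩ := hUx q x hxq
            obtain ⟨_, hxG'⟩ := (q.2.mem_sites x).1 hG'
            exact hq (Prod.ext (Subtype.ext (hw'.symm.trans hw)) (hxG'.symm.trans hxG))
        · push Not at hex
          rw [ENNReal.tsum_eq_zero.2 fun q => by rw [Set.indicator_of_notMem (hex q), mul_zero]]
          exact zero_le
    _ = ∑ x ∈ B.filter (fun x => ¬ IsBad σ ℓ (tile o ℓ (tileIndex o ℓ x))),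
          ENNReal.ofReal (siteGain p J hs σ o ℓ x) := by
        rw [Finset.sum_filter, tsum_eq_sum]
        intro x hx
        rw [hB x hx]
        simp

end regions

end StripeModel

theorem theorem3 (p : ℝ) (hp : 4 < p) :
    ∃ C₀ C₁ ε : ℝ, 0 < C₀ ∧ 0 < C₁ ∧ 0 < ε ∧
      ∀ J : ℝ, Jc p - ε < J → J < Jc p →
      ∀ hs : ℕ, IsOptimalWidth p J hs →
      ∀ ℓ : ℕ, C₀ * (hs : ℝ) ≤ (ℓ : ℝ) → (ℓ : ℝ) ≤ (C₀ * (Jc p - J))⁻¹ →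
      ∀ (o : Site) (s : Config) (X : Finset Site),
        ((ENNReal.ofReal C₁ *
              (numCorners (glue X s (stripe hs)) +
                ENNReal.ofReal ((Jc p - J) ^ ((p - 2) / (p - 3)) * (ℓ : ℝ) ^ 2) *
                  numBadHole (glue X s (stripe hs)) o ℓ) +
            ENNReal.ofReal (1 / 2) *
              ∑' (h : {h : ℕ // 1 ≤ h ∧ h ≠ hs}) (G : GoodRegion (glue X s (stripe hs)) o ℓ),
                ENNReal.ofReal (stripeEnergy p J h - stripeEnergy p J hs) *
                  stripeArea (glue X s (stripe hs)) G.sites h : ℝ≥0∞) : EReal) ≤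
          ((energy p J X s (stripe hs) - energy p J X (stripe hs) (stripe hs) : ℝ) : EReal) := by
  classical
  have hp3 : 3 < p := by linarith
  obtain ⟨c, hc0, hc⟩ := exists_optimal_bounds hp.le
  have h2p : (0 : ℝ) < 2 ^ (-p) := Real.rpow_pos_of_pos two_pos _
  -- The three terms ensure that the stripes are narrower than `ℓ / 5`, that the missing energy of a
  -- hole exceeds the cost of the walls in its tile, and that so does the energy of a corner.
  set C₀ : ℝ := 6 + 1000 / c + 56 / 2 ^ (-p) with hC₀
  have hC₀0 : 0 < C₀ := by positivity
  -- The minimum is over the energies available for corners (each vertex carries at most two) and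
  -- for holes.
  set C₁ : ℝ := min (2 ^ (-p) / 2) (c / 100) with hC₁
  have hC₁0 : 0 < C₁ := lt_min (by positivity) (by positivity)
  refine ⟨C₀, C₁, 1, hC₀0, hC₁0, one_pos, fun J hJ1 hJ2 hs hopt ℓ hℓ1 hℓ2 o s X => ?_⟩
  obtain ⟨hc1, hc2⟩ := hc J hJ1 hJ2 hs hopt
  set τ := Jc p - J with hτ
  have hτ0 : 0 < τ := sub_pos.2 hJ2
  set σ := glue X s (stripe hs) with hσ
  have hX : ∀ x ∉ X, σ x = stripe hs x := fun x hx => if_neg hx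
  have hin : ∀ x ∈ X, σ x = s x := fun x hx => if_pos hx
  have hhs : (1 : ℝ) ≤ hs := by exact_mod_cast hopt.1
  have hneg : 0 ≤ -stripeEnergy p J hs := le_trans (by positivity) hc1
  have h6 : 6 * (hs : ℝ) ≤ ℓ := le_trans (by gcongr; rw [hC₀]; linarith [
    (by positivity : 0 ≤ 1000 / c), (by positivity : (0 : ℝ) ≤ 56 / 2 ^ (-p))]) hℓ1
  have hℓ5 : 5 * hs < ℓ := by
    have : (5 * hs : ℝ) < ℓ := by linarith
    exact_mod_cast this
  have hℓ : 1 ≤ ℓ := by omega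
  have hlarge : 1000 * (Jc p - J) ≤ ℓ * -stripeEnergy p J hs := by
    have h1 : 1000 / c * hs ≤ ℓ := le_trans (by gcongr; rw [hC₀]; linarith [
      (by positivity : (0 : ℝ) ≤ 56 / 2 ^ (-p))]) hℓ1
    calc 1000 * τ = 1000 / c * (c * τ) := by field_simp
      _ ≤ 1000 / c * (hs * -stripeEnergy p J hs) := by gcongr
      _ = 1000 / c * hs * -stripeEnergy p J hs := by ring
      _ ≤ ℓ * -stripeEnergy p J hs := by gcongr
  have hsmall : 56 * ((Jc p - J) * ℓ) ≤ 2 ^ (-p) := by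
    have h1 : C₀ * (τ * ℓ) ≤ 1 := by
      have := mul_le_mul_of_nonneg_left hℓ2 (mul_pos hC₀0 hτ0).le
      rw [mul_inv_cancel₀ (mul_pos hC₀0 hτ0).ne'] at this
      linarith
    have h2 : 56 / 2 ^ (-p) * (τ * ℓ) ≤ C₀ * (τ * ℓ) := by
      gcongr
      rw [hC₀]
      linarith [(by positivity : 0 ≤ 1000 / c)]
    have h3 := h2.trans h1
    rw [div_mul_eq_mul_div, div_le_one h2p] at h3
    exact h3
  obtain ⟨B, bad, V, hV, hbad, hB, hE⟩ := energy_sub_ge_gain hp3 hJ2 hopt (by linarith) hX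
    hℓ5 hlarge hsmall (o := o)
  rw [energy_congr hin] at hE
  set N := bad.filter fun k => HasHole σ ℓ (tile o ℓ k) with hN
  have hhole : numBadHole σ o ℓ = (N.card : ℝ≥0∞) := by
    have : {k : ℤ × ℤ | IsBad σ ℓ (tile o ℓ k) ∧ HasHole σ ℓ (tile o ℓ k)} = (N : Set (ℤ × ℤ)) := by
      ext k
      simp [hN, hbad]
    unfold numBadHole
    rw [this, Set.encard_coe_eq_coe_finsetCard]
    simp
  have harea := tsum_stripeArea_le hℓ p J hs hB
  simp only [hbad] at hE
  have hg0 : ∀ x, 0 ≤ siteGain p J hs σ o ℓ x := siteGain_nonneg hp3 hopt (by linarith) σ o ℓ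
  rw [← ENNReal.ofReal_sum_of_nonneg fun x _ => hg0 x] at harea
  set g := ∑ x ∈ B.filter (fun x => ¬ IsBad σ ℓ (tile o ℓ (tileIndex o ℓ x))),
    siteGain p J hs σ o ℓ x with hg
  have hgnn : 0 ≤ g := Finset.sum_nonneg fun x _ => hg0 x
  set D := energy p J X s (stripe hs) - energy p J X (stripe hs) (stripe hs) with hD
  have hmain : ENNReal.ofReal C₁ * (numCorners σ +
      ENNReal.ofReal (τ ^ ((p - 2) / (p - 3)) * (ℓ : ℝ) ^ 2) * numBadHole σ o ℓ) +
      ENNReal.ofReal (1 / 2) *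
        ∑' (h : {h : ℕ // 1 ≤ h ∧ h ≠ hs}) (G : GoodRegion σ o ℓ),
          ENNReal.ofReal (stripeEnergy p J h - stripeEnergy p J hs) * stripeArea σ G.sites h ≤
      ENNReal.ofReal D := by
    set θ := τ ^ ((p - 2) / (p - 3)) with hθ
    have hθ0 : 0 ≤ θ := by positivity
    calc _ ≤ ENNReal.ofReal C₁ * (2 * V.card + ENNReal.ofReal (θ * (ℓ : ℝ) ^ 2) * N.card) +
          ENNReal.ofReal (1 / 2) * ENNReal.ofReal g := by
          rw [hhole]
          gcongr
          exact numCorners_le hV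
      _ = ENNReal.ofReal (C₁ * (2 * V.card + θ * (ℓ : ℝ) ^ 2 * N.card) + 1 / 2 * g) := by
          rw [ENNReal.ofReal_add (by positivity) (by positivity), ENNReal.ofReal_mul hC₁0.le,
            ENNReal.ofReal_add (by positivity) (by positivity), ENNReal.ofReal_mul zero_le_two,
            ENNReal.ofReal_mul (by positivity : 0 ≤ θ * (ℓ : ℝ) ^ 2), ENNReal.ofReal_natCast,
            ENNReal.ofReal_natCast, ENNReal.ofReal_ofNat,
            ENNReal.ofReal_mul (by norm_num : (0 : ℝ) ≤ 1 / 2)]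
      _ ≤ ENNReal.ofReal D := by
          refine ENNReal.ofReal_le_ofReal ?_
          have a1 : C₁ * (2 * V.card) ≤ 2 ^ (-p) / 2 * (2 * V.card) :=
            mul_le_mul_of_nonneg_right (min_le_left _ _) (by positivity)
          have a2 : C₁ * (θ * (ℓ : ℝ) ^ 2 * N.card) ≤
              (ℓ : ℝ) ^ 2 * -stripeEnergy p J hs / 100 * N.card := by
            calc C₁ * (θ * (ℓ : ℝ) ^ 2 * N.card) ≤ c / 100 * (θ * (ℓ : ℝ) ^ 2 * N.card) := by
                  gcongr
                  exact min_le_right _ _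
              _ = (ℓ : ℝ) ^ 2 * (c * θ) / 100 * N.card := by ring
              _ ≤ (ℓ : ℝ) ^ 2 * -stripeEnergy p J hs / 100 * N.card := by gcongr
          linarith
  have hD0 : 0 ≤ D := by
    have : 0 ≤ (ℓ : ℝ) ^ 2 * -stripeEnergy p J hs / 100 * N.card := by positivity
    have : (0 : ℝ) ≤ 2 ^ (-p) * V.card := by positivity
    linarith
  calc _ ≤ ((ENNReal.ofReal D : ℝ≥0∞) : EReal) := by exact_mod_cast hmain
    _ = (D : EReal) := by rw [EReal.coe_ennreal_ofReal, max_eq_left hD0]
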